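/- Let $\mathcal D\subset\mathbb R^2$ be a bounded domain of class $H^4$ (its boundary consists of finitely many disjoint simple closed curves, $\mathcal D$ lying locally on one side of them), with outward unit normal $N$. Let $T,\mathcal M>0$ and $g\in\mathbb R$. For $t\in[0,T)$ let $\Gamma(t)\subset\mathcal D$ be a simple closed curve of class $W^{4,\infty}$ with $\mathcal D=\Omega^+(t)\cup\Gamma(t)\cup\Omega^-(t)$ a disjoint union, where $\Omega^\pm(t)$ are open, both lie locally on one side of $\Gamma(t)$, $\overline{\Omega^+(t)}\subset\mathcal D$, and $\Omega^\pm=\Omega^\pm(0)$ are connected; $\Gamma=\Gamma(0)$. Assume that $\Gamma(t)$ has regular $W^{4,\infty}$ parametrizations that are jointly $C^1$ in time and parameter. Let $\mathcal N,\mathcal T$ be the unit normal (pointing into $\Omega^-(t)$) and the unit tangent of $\Gamma(t)$, $\nabla_{\mathcal T}$ the tangential derivative, $H=\nabla_{\mathcal T}\mathcal N\cdot\mathcal T$ the curvature, and $\|f\|_{W^{k,\infty}(\Gamma(t))}=\sum_{i=0}^k\|\nabla_{\mathcal T}^i f\|_{L^\infty(\Gamma(t))}$. Let $u^\pm,p^\pm$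 be a solution on $[0,T)$ of the two-phase incompressible irrotational Euler equations with unit densities and unit surface tension, $$u^\pm_t+u^\pm\cdot\nabla u^\pm+\nabla p^\pm=-g\,e_2,\quad \operatorname{curl}u^\pm=0,\quad\operatorname{div}u^\pm=0\quad\text{in }\Omega^\pm(t),$$ $$p^+-p^-=H,\quad (u^+-u^-)\cdot\mathcal N=0\quad\text{on }\Gamma(t),\qquad u^-\cdot N=0\quad\text{on }\partial\mathcal D,$$ such that $\Gamma(t)$ moves with normal velocity $u^+\cdot\mathcal N$. The equations hold classically: $u^\pm,\nabla u^\pm$ (for $0\le t<T$) and $p^\pm,\nabla p^\pm$ (for $0<t<T$) are continuous in space-time up to the spatial boundary. Let $\eta(\cdot,t):\overline{\Omega^-}\to\overline{\Omega^-(t)}$, with $\eta(\Omega^-,t)=\Omega^-(t)$ and $\eta(\Gamma,t)=\Gamma(t)$, be the flow map of $u^-$: $\eta_t=u^-(\eta,t)$, $\eta(x,0)=x$; on $\Gamma$ put $\eta(x,T)=x+\int_0^Tu^-(\eta(x,s),s)\,ds$. Fix a regular $W^{4,\infty}$ parametrization $\theta$ of $\Gamma$ (one of the jointly $C^1$ family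 at $t=0$), and let $\eta'$ be the derivative of $\eta(\theta(s),t)$ with respect to the parameter $s$. Suppose that for all $t\in[0,T)$ one has $\operatorname{dist}(\Gamma(t),\partial\mathcal D)>1/\mathcal M$, and that $$\sup_{t\in[0,T)}\Big(\|u^+(\cdot,t)\|_{W^{2,\infty}(\Gamma(t))}+\|H(\cdot,t)\|_{W^{2,\infty}(\Gamma(t))}\Big)<\mathcal M .$$ Then there is a constant $C$, depending only on $T$, $\mathcal M$, $g$, $\mathcal D$ and the initial data $(\Omega^\pm,\theta,u^\pm(\cdot,0))$, such that $\eta(\theta(\cdot),t)$ is differentiable and $|\eta'(\cdot,t)|$ attains its minimum for every $t\in[0,T]$, and, for every $t\in[0,T)$, $\min_\Gamma|\eta'(\cdot,t)|>0$ and $$\|\nabla u^-(\cdot,t)\|_{L^\infty(\Omega^-(t))}\le \frac{C\,\mathcal M}{\min_\Gamma|\eta'(\cdot,t)|}.$$ At $t=T$ the estimate holds in the limit: if $y\in\Omega^-(t)$ for all $t<T$ close to $T$ and $\nabla u^-(y,t)\to A$ as $t\to T$, then $|A|\,\min_\Gamma|\eta'(\cdot,T)|\le C\,\mathcal M$. Consequently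 $\nabla u^-$ can blow up only if the Lagrangian parametrization of the interface degenerates: if $t_n\in[0,T)$, $y_n\in\Omega^-(t_n)$ and $|\nabla u^-(y_n,t_n)|\to\infty$, then $\min_\Gamma|\eta'(\cdot,t_n)|\to0$. -/

import Mathlib

open Set Filter Topology MeasureTheory
open scoped ENNReal

namespace VortexSheet

noncomputable section

/-- The Euclidean plane. -/
abbrev Plane := EuclideanSpace ℝ (Fin 2)

/-- The standard basis vectors of the plane. -/
def basisVec (i : Fin 2) : Plane := EuclideanSpace.single i 1

/-- `(x₁, x₂)^⊥ = (-x₂, x₁)`. -/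
def perp (x : Plane) : Plane := !₂[-(x 1), x 0]

/-! ### Closed curves -/

/-- A regular, simple closed curve, parametrized with period one. -/
structure IsClosedCurve (z : ℝ → Plane) : Prop where
  periodic : Function.Periodic z 1
  contDiff : ContDiff ℝ 1 z
  regular : ∀ s, deriv z s ≠ 0
  simple : InjOn z (Ico 0 1)

/-- Class `W^{4,∞}`: the third derivative is Lipschitz. -/
def IsW4Inf (z : ℝ → Plane) : Prop :=
  ContDiff ℝ 3 z ∧ ∃ K, LipschitzWith K (iteratedDeriv 3 z)

/-- Class `H⁴` (for curves of period one): the third derivative is an indefinite integral of a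
square integrable function. -/
def IsH4 (z : ℝ → Plane) : Prop :=
  ContDiff ℝ 3 z ∧ ∃ h : ℝ → Plane, MemLp h 2 (volume.restrict (Ioc 0 1)) ∧
    ∀ s ∈ Icc (0 : ℝ) 1, iteratedDeriv 3 z s = iteratedDeriv 3 z 0 + ∫ r in (0 : ℝ)..s, h r

/-- The unit tangent `z' / |z'|` at parameter `s`. -/
def tangent (z : ℝ → Plane) (s : ℝ) : Plane := ‖deriv z s‖⁻¹ • deriv z s

/-- The unit normal `z'^⊥ / |z'|` at parameter `s`. -/
def normal (z : ℝ → Plane) (s : ℝ) : Plane := perp (tangent z s)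

/-- The tangential (arc-length) derivative along the curve `z` of a function `f` on the curve,
where `f` is given as a function of the parameter: `(∇_T f) ∘ z = |z'|⁻¹ (f ∘ z)'`. -/
def tangentialDeriv {F : Type*} [NormedAddCommGroup F] [NormedSpace ℝ F]
    (z : ℝ → Plane) (f : ℝ → F) : ℝ → F :=
  fun s => ‖deriv z s‖⁻¹ • deriv f s

/-- The curvature (twice the mean curvature) with respect to the unit normal:
`H = ∇_T N · T`. It is positive for a circle whose normal points outwards. -/
def curvature (z : ℝ → Plane) (s : ℝ) : ℝ :=
  inner ℝ (tangentialDeriv z (normal z) s) (tangent z s)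

/-- Membership in `W^{k,∞}` of the curve, for `k ≥ 1`: all tangential derivatives of order less
than `k` are Lipschitz. -/
def MemWInf {F : Type*} [NormedAddCommGroup F] [NormedSpace ℝ F]
    (k : ℕ) (z : ℝ → Plane) (f : ℝ → F) : Prop :=
  ∀ i < k, ∃ K, LipschitzWith K ((tangentialDeriv z)^[i] f)

/-- The norm `∑_{i ≤ k} ‖∇_T^i f‖_{L^∞}` of `W^{k,∞}` of the curve. -/
def wInfNorm {F : Type*} [NormedAddCommGroup F] [NormedSpace ℝ F]
    (k : ℕ) (z : ℝ → Plane) (f : ℝ → F) : ℝ≥0∞ :=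
  ∑ i ∈ Finset.range (k + 1), eLpNorm ((tangentialDeriv z)^[i] f) ∞ volume

/-! ### The container and its two phases -/

/-- A bounded planar domain of class `H⁴`. Its boundary consists of finitely many disjoint simple
closed curves, oriented so that `normal` is the outward unit normal; the domain lies locally on
one side of them. -/
structure H4Domain where
  carrier : Set Plane
  isOpen : IsOpen carrier
  isConnected : IsConnected carrier
  isBounded : Bornology.IsBounded carrier
  numWalls : ℕ
  wall : Fin numWalls → ℝ → Plane
  wall_curve : ∀ i, IsClosedCurve (wall i)
  wall_class : ∀ i, IsH4 (wall i)
  wall_disjoint : Pairwise fun i j => Disjoint (range (wall i)) (range (wall j))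
  frontier_eq : frontier carrier = ⋃ i, range (wall i)
  wall_outward : ∀ i s, ∀ᶠ ε in 𝓝[>] (0 : ℝ),
    wall i s - ε • normal (wall i) s ∈ carrier ∧
      wall i s + ε • normal (wall i) s ∉ closure carrier

/-- The open sets `Ωp` (inner phase `+`) and `Ωm` (outer phase `-`, adjacent to the walls) and the
simple closed curve `z` of class `W^{4,∞}` partition the domain; both phases lie locally on one
side of the curve, and the unit normal of the curve points into `Ωm`. -/
structure IsPartition (D : H4Domain) (Ωp Ωm : Set Plane) (z : ℝ → Plane) : Prop where
  isOpen_p : IsOpen Ωp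
  isOpen_m : IsOpen Ωm
  disjoint : Disjoint Ωp Ωm
  disjoint_p : Disjoint Ωp (range z)
  disjoint_m : Disjoint Ωm (range z)
  union_eq : Ωp ∪ range z ∪ Ωm = D.carrier
  closure_p : closure Ωp ⊆ D.carrier
  curve : IsClosedCurve z
  curve_class : IsW4Inf z
  sides : ∀ s, ∀ᶠ ε in 𝓝[>] (0 : ℝ), z s + ε • normal z s ∈ Ωm ∧ z s - ε • normal z s ∈ Ωp

/-! ### The two-phase Euler equations -/

/-- The space-time set swept out by the sets `S t` for `t ∈ J`. -/
def spaceTime (J : Set ℝ) (S : ℝ → Set Plane) : Set (ℝ × Plane) :=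
  {q | q.1 ∈ J ∧ q.2 ∈ S q.1}

/-- The function `f`, given on the space-time set over the moving open sets `Ω t`, `t ∈ J`, is
continuous there and extends continuously up to the spatial boundary. -/
def ExtendsToClosure {F : Type*} [TopologicalSpace F] (J : Set ℝ) (Ω : ℝ → Set Plane)
    (f : ℝ → Plane → F) : Prop :=
  ∀ q ∈ spaceTime J (fun t => closure (Ω t)), ∃ l,
    Tendsto (fun r : ℝ × Plane => f r.1 r.2) (𝓝[spaceTime J Ω] q) (𝓝 l)

/-- Incompressible, irrotational Euler flow of density one under gravity `g` in the moving set
`Ω t`, `0 ≤ t < T`: the velocity and its spatial gradient (for `0 ≤ t < T`), and the pressure and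
its gradient (for `0 < t < T`), are continuous up to the boundary, and the equations hold
pointwise. -/
structure IsEulerFlow (g T : ℝ) (Ω : ℝ → Set Plane) (u : ℝ → Plane → Plane)
    (p : ℝ → Plane → ℝ) : Prop where
  velocity_cont : ContinuousOn (Function.uncurry u) (spaceTime (Ico 0 T) fun t => closure (Ω t))
  velocity_diff : ∀ t ∈ Ico 0 T, ∀ x ∈ Ω t, DifferentiableAt ℝ (u t) x
  velocity_grad : ExtendsToClosure (Ico 0 T) Ω fun t => fderiv ℝ (u t)
  pressure_cont : ContinuousOn (Function.uncurry p) (spaceTime (Ioo 0 T) fun t => closure (Ω t))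
  pressure_diff : ∀ t ∈ Ioo 0 T, ∀ x ∈ Ω t, DifferentiableAt ℝ (p t) x
  pressure_grad : ExtendsToClosure (Ioo 0 T) Ω fun t => gradient (p t)
  time_diff : ∀ t ∈ Ioo 0 T, ∀ x ∈ Ω t, DifferentiableAt ℝ (fun r => u r x) t
  momentum : ∀ t ∈ Ioo 0 T, ∀ x ∈ Ω t,
    deriv (fun r => u r x) t + fderiv ℝ (u t) x (u t x) + gradient (p t) x = -(g • basisVec 1)
  curl_free : ∀ t ∈ Ico 0 T, ∀ x ∈ Ω t,
    fderiv ℝ (u t) x (basisVec 0) 1 - fderiv ℝ (u t) x (basisVec 1) 0 = 0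
  div_free : ∀ t ∈ Ico 0 T, ∀ x ∈ Ω t,
    fderiv ℝ (u t) x (basisVec 0) 0 + fderiv ℝ (u t) x (basisVec 1) 1 = 0

/-- A vortex sheet on `[0, T)` (densities and surface tension equal to one): the two phases
`Ωp t`, `Ωm t`, the interface `Γ(t) = range (z t)`, the velocities and the pressures. -/
structure IsVortexSheet (g T : ℝ) (D : H4Domain) (Ωp Ωm : ℝ → Set Plane) (z : ℝ → ℝ → Plane)
    (up um : ℝ → Plane → Plane) (pp pm : ℝ → Plane → ℝ) : Prop where
  partition : ∀ t ∈ Ico 0 T, IsPartition D (Ωp t) (Ωm t) (z t)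
  flow_p : IsEulerFlow g T Ωp up pp
  flow_m : IsEulerFlow g T Ωm um pm
  pressure_jump : ∀ t ∈ Ioo 0 T, ∀ s, pp t (z t s) - pm t (z t s) = curvature (z t) s
  normal_jump : ∀ t ∈ Ico 0 T, ∀ s,
    inner ℝ (up t (z t s) - um t (z t s)) (normal (z t) s) = 0
  wall_condition : ∀ t ∈ Ico 0 T, ∀ i s,
    inner ℝ (um t (D.wall i s)) (normal (D.wall i) s) = 0
  motion_contDiff : ContDiffOn ℝ 1 (Function.uncurry z) (Ico 0 T ×ˢ univ)
  normal_speed : ∀ t ∈ Ioo 0 T, ∀ s,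
    inner ℝ (deriv (fun r => z r s) t) (normal (z t) s) =
      inner ℝ (up t (z t s)) (normal (z t) s)

/-- The initial state of the flow: the two phases, the parametrized interface, the velocities. -/
structure HasInitialState (Ωp Ωm : ℝ → Set Plane) (z : ℝ → ℝ → Plane)
    (up um : ℝ → Plane → Plane) (Ωp₀ Ωm₀ : Set Plane) (θ : ℝ → Plane)
    (up₀ um₀ : Plane → Plane) : Prop where
  phase_p : Ωp 0 = Ωp₀
  phase_m : Ωm 0 = Ωm₀
  interface : z 0 = θ
  velocity_p : EqOn (up 0) up₀ Ωp₀
  velocity_m : EqOn (um 0) um₀ Ωm₀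

/-- The a priori bounds: the interface keeps distance more than `1 / M` from the walls, and
`sup_t (‖u⁺‖_{W^{2,∞}(Γ(t))} + ‖H‖_{W^{2,∞}(Γ(t))}) < M`. -/
structure HasBounds (T M : ℝ) (D : H4Domain) (z : ℝ → ℝ → Plane) (up : ℝ → Plane → Plane) :
    Prop where
  wall_dist : ∀ t ∈ Ico 0 T, ∀ s, 1 / M < Metric.infDist (z t s) (frontier D.carrier)
  mem_velocity : ∀ t ∈ Ico 0 T, MemWInf 2 (z t) fun s => up t (z t s)
  mem_curvature : ∀ t ∈ Ico 0 T, MemWInf 2 (z t) (curvature (z t))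
  norm_lt : (⨆ t ∈ Ico 0 T, (wInfNorm 2 (z t) (fun s => up t (z t s)) +
    wInfNorm 2 (z t) (curvature (z t)))) < ENNReal.ofReal M

/-- The Lagrangian flow map `η t x` of `u⁻` on the closure of `Ω⁻(0)`. On the interface it is
extended to the final time by `η(x, T) = x + ∫₀ᵀ u⁻(η(x, s), s) ds`. -/
structure IsLagrangianFlow (T : ℝ) (Ωm : ℝ → Set Plane) (z : ℝ → ℝ → Plane)
    (um : ℝ → Plane → Plane) (η : ℝ → Plane → Plane) : Prop where
  initial : ∀ x ∈ closure (Ωm 0), η 0 x = x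
  mapsTo : ∀ t ∈ Ico 0 T, MapsTo (η t) (closure (Ωm 0)) (closure (Ωm t))
  ode : ∀ x ∈ closure (Ωm 0), ∀ t ∈ Ico 0 T,
    HasDerivWithinAt (fun r => η r x) (um t (η t x)) (Ico 0 T) t
  image_phase : ∀ t ∈ Ico 0 T, η t '' Ωm 0 = Ωm t
  image_interface : ∀ t ∈ Ico 0 T, η t '' range (z 0) = range (z t)
  final : ∀ x ∈ range (z 0), η T x = x + ∫ s in (0 : ℝ)..T, um s (η s x)

/-- `|η'(·, t)|` on the initial interface, parametrized by `θ`. -/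
def speed (η : ℝ → Plane → Plane) (θ : ℝ → Plane) (t s : ℝ) : ℝ :=
  ‖deriv (fun r => η t (θ r)) s‖

/-- `min_Γ |η'(·, t)|`. -/
def minSpeed (η : ℝ → Plane → Plane) (θ : ℝ → Plane) (t : ℝ) : ℝ :=
  ⨅ s, speed η θ t s

end

end VortexSheet

open VortexSheet

/-! On the interface the jump `u⁻ - u⁺` is tangential, say `λ τ`. Take the difference of the two
momentum equations along the trajectories of `u⁻`: gravity drops out, the pressure jump is `H`, and
what remains is `λ_t = ∇_T H - λ (∇_T u⁺ · τ)`, an equation in which `∇u⁻` does not occur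
(`hasDerivAt_shear`). Gronwall bounds `λ`, and with it `u⁻` on the interface. Moreover `η` and `λ`
together solve a closed system, `η_t = u⁺ + λ τ` and the equation above, whose right-hand side is
Lipschitz along the interface with constants made of `M` and the bound for `λ`; this is where the
`W^{2,∞}` bounds enter. Hence `η` and `u⁻ ∘ η` are Lipschitz in the parameter with a constant `A`
fixed by the data (`deriv_le_of_initial`).

By the chain rule `∇u⁻` maps `η'` to the parameter derivative of `u⁻ ∘ η`. A symmetric trace-free
2×2 matrix is a multiple of an isometry, so a single direction controls all of it: `|∇u⁻| |η'| ≤ A`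
on the interface.

Inside the phase, `u₁ - i u₂` is holomorphic and its derivative has modulus `|∇u⁻|`, so the maximum
principle reduces the estimate to the interface and the walls. On the walls `|∇u⁻|` is bounded by a
multiple of the supremum of `|u⁻|` over the interface (`WallData.exists_bound_of_inner_bound`). This
has two ingredients. A logarithmic barrier bounds the derivative at a wall by the supremum of the
function (`WallData.exists_norm_deriv_le`). A two-constants theorem bounds that supremum by the
values on the interface. The constants may not depend on the shape of the moving interface; they use
only its distance from the walls, more than `1 / M`, and its diameter, at least `1 / M` because the
curvature is at most `M`. As `min |η'| ≤ A`, the wall bound is also a multiple of `1 / min |η'|`.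

Bounds obtained by compactness on `[0, t₁]` with `t₁ < T` may degenerate as `t₁ → T`. They serve
qualitative purposes only: differentiability, `η' ≠ 0`, orientation. The uniform bound `A` makes
`η'` Lipschitz in time, which carries the statement to `t = T`. -/

/-! ### A maximum principle -/

/-- Near `x`, the function `g` is the modulus of a holomorphic function. -/
def LocallyNormHolo (g : ℂ → ℝ) (x : ℂ) : Prop :=
  ∃ F : ℂ → ℂ, (∀ᶠ y in 𝓝 x, DifferentiableAt ℂ F y) ∧ ∀ᶠ y in 𝓝 x, g y = ‖F y‖

theorem LocallyNormHolo.mul {g h : ℂ → ℝ} {x : ℂ} (hg : LocallyNormHolo g x)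
    (hh : LocallyNormHolo h x) : LocallyNormHolo (fun y => g y * h y) x := by
  obtain ⟨F, hF, hF'⟩ := hg
  obtain ⟨G, hG, hG'⟩ := hh
  refine ⟨fun y => F y * G y, ?_, ?_⟩
  · filter_upwards [hF, hG] with y h1 h2 using h1.mul h2
  · filter_upwards [hF', hG'] with y h1 h2
    rw [h1, h2, norm_mul]

theorem LocallyNormHolo.of_differentiable {f : ℂ → ℂ} {U : Set ℂ} {x : ℂ} (hU : IsOpen U)
    (hx : x ∈ U) (hf : ∀ y ∈ U, DifferentiableAt ℂ f y) :
    LocallyNormHolo (fun y => ‖f y‖) x :=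
  ⟨f, by filter_upwards [hU.mem_nhds hx] with y hy using hf y hy, Eventually.of_forall fun _ => rfl⟩

theorem LocallyNormHolo.const {c : ℝ} (hc : 0 ≤ c) (x : ℂ) : LocallyNormHolo (fun _ => c) x :=
  ⟨fun _ => (c : ℂ), Eventually.of_forall fun _ => differentiableAt_const _,
    Eventually.of_forall fun _ => by simp [abs_of_nonneg hc]⟩

/-- Normalizing to `(y - a) / (x - a)`, which is near `1` for `y` near `x`, places it in the slit
plane, where the logarithm is holomorphic. Such powers are the comparison functions of all later
barrier arguments. -/
theorem LocallyNormHolo.rpow_dist {a x : ℂ} (h : x ≠ a) (b : ℝ) :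
    LocallyNormHolo (fun y => ‖y - a‖ ^ b) x := by
  have hxa : x - a ≠ 0 := sub_ne_zero.2 h
  have hpos : 0 < ‖x - a‖ := norm_pos_iff.2 hxa
  have hslit : ∀ᶠ y in 𝓝 x, (y - a) / (x - a) ∈ Complex.slitPlane := by
    have : ContinuousAt (fun y : ℂ => (y - a) / (x - a)) x := by fun_prop
    refine this.eventually (Complex.isOpen_slitPlane.mem_nhds ?_)
    change (x - a) / (x - a) ∈ _
    rw [div_self hxa]
    exact Complex.one_mem_slitPlane
  refine ⟨fun y => (‖x - a‖ ^ b : ℝ) * Complex.exp (b * Complex.log ((y - a) / (x - a))), ?_, ?_⟩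
  · filter_upwards [hslit] with y hy
    refine DifferentiableAt.const_mul ?_ _
    refine DifferentiableAt.cexp ?_
    refine DifferentiableAt.const_mul ?_ _
    exact DifferentiableAt.clog (by fun_prop) hy
  · filter_upwards [hslit] with y hy
    have hy0 : (y - a) / (x - a) ≠ 0 := Complex.slitPlane_ne_zero hy
    rw [norm_mul, Complex.norm_exp, Complex.re_ofReal_mul, Complex.log_re, mul_comm b,
      ← Real.rpow_def_of_pos (norm_pos_iff.2 hy0), Complex.norm_real, Real.norm_eq_abs,
      abs_of_pos (Real.rpow_pos_of_pos hpos _), ← Real.mul_rpow hpos.le (norm_nonneg _), norm_div,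
      mul_div_cancel₀ _ hpos.ne']

theorem LocallyNormHolo.prod {ι : Type*} (s : Finset ι) {g : ι → ℂ → ℝ} {x : ℂ}
    (h : ∀ i ∈ s, LocallyNormHolo (g i) x) : LocallyNormHolo (fun y => ∏ i ∈ s, g i y) x := by
  classical
  induction s using Finset.induction_on with
  | empty => simpa using LocallyNormHolo.const zero_le_one x
  | insert i s hi ih =>
    simp only [Finset.prod_insert hi]
    exact (h i (by simp)).mul (ih fun j hj => h j (by simp [hj]))

/-- If the maximum exceeded `B`, the set where it is attained would lie in `U`, be closed by
continuity and open by the local maximum modulus principle. A nonempty clopen set is all of `ℂ`,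
which is unbounded. Connectedness of `U` plays no role. -/
theorem le_of_forall_frontier_le {U : Set ℂ} (hU : IsOpen U) (hb : Bornology.IsBounded U)
    {g : ℂ → ℝ} (hg : ContinuousOn g (closure U)) (hh : ∀ x ∈ U, LocallyNormHolo g x) {B : ℝ}
    (hB : ∀ x ∈ frontier U, g x ≤ B) {x : ℂ} (hx : x ∈ closure U) : g x ≤ B := by
  by_contra! hlt
  have hK : IsCompact (closure U) := hb.isCompact_closure
  obtain ⟨x₀, hx₀, hmax⟩ := hK.exists_isMaxOn ⟨x, hx⟩ hg
  have hBm : B < g x₀ := hlt.trans_le (hmax hx)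
  set A := closure U ∩ g ⁻¹' {g x₀} with hA
  have hAU : A ⊆ U := by
    rintro y ⟨hy, hy'⟩
    by_contra hyU
    have := hB y ⟨hy, by rwa [hU.interior_eq]⟩
    rw [mem_preimage, mem_singleton_iff] at hy'
    linarith
  have hAc : IsClosed A := hg.preimage_isClosed_of_isClosed isClosed_closure isClosed_singleton
  have hAo : IsOpen A := by
    rw [isOpen_iff_mem_nhds]
    intro y hy
    have hyU := hAU hy
    obtain ⟨F, hF, hF'⟩ := hh y hyU
    have hUn := hU.mem_nhds hyU
    have hloc : IsLocalMax (norm ∘ F) y := by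
      filter_upwards [hUn, hF'] with w hw hw'
      have h1 := hmax (subset_closure hw)
      simp only [mem_ofPred_eq] at h1
      have h2 : g y = g x₀ := hy.2
      rw [Function.comp_apply, Function.comp_apply, ← hw', ← hF'.self_of_nhds, h2]
      exact h1
    filter_upwards [hUn, hF', Complex.norm_eventually_eq_of_isLocalMax hF hloc] with w hw h1 h2
    refine ⟨subset_closure hw, ?_⟩
    have h3 : g y = g x₀ := hy.2
    rw [mem_preimage, mem_singleton_iff, h1, h2, ← hF'.self_of_nhds, h3]
  have huniv : A = univ := IsClopen.eq_univ ⟨hAc, hAo⟩ ⟨x₀, hx₀, rfl⟩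
  have : Bornology.IsBounded (univ : Set ℂ) := (hb.subset hAU).subset (huniv ▸ subset_rfl)
  exact NormedSpace.unbounded_univ ℝ ℂ this

/-! ### Derivative bounds for holomorphic functions -/

/-- The modulus of `exp (i F / m)` lies between `1 / e` and `e`. Cauchy's estimate on the half ball
bounds its derivative, and the lower bound at the centre converts this into a bound for `F'`. -/
theorem norm_deriv_le_of_abs_im_le {F : ℂ → ℂ} {c : ℂ} {r m : ℝ} (hr : 0 < r) (hm : 0 < m)
    (hd : ∀ y ∈ Metric.ball c r, DifferentiableAt ℂ F y)
    (hF : ∀ y ∈ Metric.ball c r, |(F y).im| ≤ m) :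
    ‖deriv F c‖ ≤ 2 * Real.exp 2 * m / r := by
  set h : ℂ → ℂ := fun y => Complex.exp (Complex.I * (F y / m)) with hh
  have hmC : (m : ℂ) ≠ 0 := by exact_mod_cast hm.ne'
  have hnorm : ∀ y, ‖h y‖ = Real.exp (-((F y).im / m)) := by
    intro y
    rw [hh, Complex.norm_exp]
    congr 1
    rw [Complex.I_mul_re, Complex.div_ofReal_im]
  have hle : ∀ y ∈ Metric.ball c r, ‖h y‖ ≤ Real.exp 1 := by
    intro y hy
    rw [hnorm, Real.exp_le_exp]
    have := (abs_le.1 (hF y hy)).1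
    rw [neg_le, le_div_iff₀ hm]
    linarith
  have hc : c ∈ Metric.ball c r := Metric.mem_ball_self hr
  have hlow : Real.exp (-1) ≤ ‖h c‖ := by
    rw [hnorm, Real.exp_le_exp, neg_le_neg_iff, div_le_one hm]
    exact (abs_le.1 (hF c hc)).2
  have hdh : ∀ y ∈ Metric.ball c r, DifferentiableAt ℂ h y := by
    intro y hy
    exact (((hd y hy).div_const _).const_mul _).cexp
  have hder : HasDerivAt h (h c * (Complex.I * (deriv F c / m))) c :=
    ((((hd c hc).hasDerivAt).div_const (m : ℂ)).const_mul Complex.I).cexp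
  have hcauchy : ‖deriv h c‖ ≤ Real.exp 1 / (r / 2) := by
    refine Complex.norm_deriv_le_of_forall_mem_sphere_norm_le (by positivity) ?_ ?_
    · refine DifferentiableOn.diffContOnCl ?_
      intro y hy
      refine (hdh y ?_).differentiableWithinAt
      have := Metric.closure_ball_subset_closedBall hy
      exact Metric.closedBall_subset_ball (by linarith) this
    · intro y hy
      exact hle y (Metric.closedBall_subset_ball (by linarith) (Metric.sphere_subset_closedBall hy))
  rw [hder.deriv, norm_mul, norm_mul, norm_div, Complex.norm_I, one_mul, Complex.norm_real,
    Real.norm_eq_abs, abs_of_pos hm] at hcauchy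
  have h1 : Real.exp (-1) * (‖deriv F c‖ / m) ≤ Real.exp 1 / (r / 2) :=
    (mul_le_mul_of_nonneg_right hlow (by positivity)).trans hcauchy
  have he : Real.exp 2 = Real.exp 1 * Real.exp 1 := by rw [← Real.exp_add]; norm_num
  have he' : Real.exp (-1) * Real.exp 1 = 1 := by rw [← Real.exp_add]; norm_num
  have hpos := Real.exp_pos 1
  calc ‖deriv F c‖ = (Real.exp (-1) * Real.exp 1) * (‖deriv F c‖ / m) * m := by
        rw [he']; field_simp
    _ = Real.exp 1 * (Real.exp (-1) * (‖deriv F c‖ / m)) * m := by ring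
    _ ≤ Real.exp 1 * (Real.exp 1 / (r / 2)) * m := by gcongr
    _ = 2 * Real.exp 2 * m / r := by rw [he]; field_simp

/-! ### Holomorphic functions that are tangent to the walls -/

/-- Second order information on the boundary of a planar domain: `t j` is the unit tangent at the
boundary point `P j`, and `Complex.I * t j` the outward unit normal. -/
structure WallData (D : Set ℂ) {ι : Type*} (P t : ι → ℂ) (K : ℝ) : Prop where
  pos : 0 < K
  isOpen : IsOpen D
  bounded : Bornology.IsBounded D
  range_eq : range P = frontier D
  norm_t : ∀ j, ‖t j‖ = 1
  outer : ∀ j, ∀ w ∈ closure D, inner ℝ (w - P j) (Complex.I * t j) ≤ K * ‖w - P j‖ ^ 2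
  inner_ball : ∀ j, Metric.ball (P j - ((1 / (2 * K) : ℝ) : ℂ) * (Complex.I * t j)) (1 / (2 * K)) ⊆ D
  tangent_expansion : ∀ j, ∃ κ : ℂ, ‖κ‖ ≤ K ∧ ∀ k, ∃ l : ℝ,
    ‖t j + κ * (P k - P j) - l * t k‖ ≤ K * ‖P k - P j‖ ^ 2

/-- A holomorphic function `f` on `Ω ⊆ D`, with derivative `g`, both continuous up to the boundary;
`Ω` contains a collar of width `d` of the boundary of `D`, along which the vector field conjugate
to `f` is tangential. -/
structure TangentField (D : Set ℂ) {ι : Type*} (P t : ι → ℂ) (d S : ℝ) (Ω : Set ℂ) (f g : ℂ → ℂ) :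
    Prop where
  isOpen : IsOpen Ω
  subset : Ω ⊆ D
  collar : ∀ x ∈ D, Metric.infDist x (frontier D) < d → x ∈ Ω
  cont_f : ContinuousOn f (closure Ω)
  cont_g : ContinuousOn g (closure Ω)
  hasDerivAt : ∀ x ∈ Ω, HasDerivAt f (g x) x
  bound_pos : 0 < S
  bound : ∀ x ∈ closure Ω, ‖f x‖ ≤ S
  tangential : ∀ j, (f (P j) * t j).im = 0

section

variable {D : Set ℂ} {ι : Type*} {P t : ι → ℂ} {K d S : ℝ} {Ω : Set ℂ} {f g : ℂ → ℂ}

theorem WallData.norm_normal (h : WallData D P t K) (j : ι) : ‖Complex.I * t j‖ = 1 := by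
  rw [norm_mul, Complex.norm_I, one_mul, h.norm_t]

theorem WallData.mem_frontier (h : WallData D P t K) (j : ι) : P j ∈ frontier D :=
  h.range_eq ▸ mem_range_self j

theorem WallData.ball_subset (h : WallData D P t K) (j : ι) {r : ℝ}
    (hr' : r ≤ 1 / (2 * K)) : Metric.ball (P j - (r : ℂ) * (Complex.I * t j)) r ⊆ D := by
  refine Subset.trans ?_ (h.inner_ball j)
  refine Metric.ball_subset_ball' ?_
  rw [dist_eq_norm]
  have : P j - (r : ℂ) * (Complex.I * t j) - (P j - ((1 / (2 * K) : ℝ) : ℂ) * (Complex.I * t j))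
      = ((1 / (2 * K) - r : ℝ) : ℂ) * (Complex.I * t j) := by
    rw [Complex.ofReal_sub]; ring
  rw [this, norm_mul, h.norm_normal, Complex.norm_real, Real.norm_eq_abs,
    abs_of_nonneg (by linarith)]
  linarith

theorem WallData.dist_center (h : WallData D P t K) (j : ι) {r : ℝ} (hr : 0 ≤ r) :
    ‖P j - (r : ℂ) * (Complex.I * t j) - P j‖ = r := by
  rw [sub_sub_cancel_left, norm_neg, norm_mul, h.norm_normal, Complex.norm_real, Real.norm_eq_abs,
    abs_of_nonneg hr, mul_one]

theorem WallData.infDist_le (h : WallData D P t K) (j : ι) (x : ℂ) :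
    Metric.infDist x (frontier D) ≤ ‖x - P j‖ := by
  rw [← dist_eq_norm]
  exact Metric.infDist_le_dist_of_mem (h.mem_frontier j)

theorem TangentField.ball_subset (hf : TangentField D P t d S Ω f g) (h : WallData D P t K) (j : ι)
    {r : ℝ} (hr : 0 < r) (hr' : r ≤ 1 / (2 * K)) (hd : 2 * r ≤ d) :
    Metric.ball (P j - (r : ℂ) * (Complex.I * t j)) r ⊆ Ω := by
  intro x hx
  refine hf.collar x (h.ball_subset j hr' hx) ?_
  refine (h.infDist_le j x).trans_lt ?_
  calc ‖x - P j‖ ≤ ‖x - (P j - (r : ℂ) * (Complex.I * t j))‖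
        + ‖P j - (r : ℂ) * (Complex.I * t j) - P j‖ := norm_sub_le_norm_sub_add_norm_sub _ _ _
    _ < r + r := by
        rw [h.dist_center j hr.le]
        gcongr
        rwa [← dist_eq_norm]
    _ ≤ d := by linarith

theorem TangentField.tendsto_center (hf : TangentField D P t d S Ω f g) (h : WallData D P t K)
    (hd : 0 < d) (j : ι) :
    Tendsto (fun r : ℝ => P j - (r : ℂ) * (Complex.I * t j)) (𝓝[>] 0) (𝓝[Ω] (P j)) := by
  rw [tendsto_nhdsWithin_iff]
  constructor
  · have : ContinuousAt (fun r : ℝ => P j - (r : ℂ) * (Complex.I * t j)) 0 := by fun_prop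
    have h2 := this.tendsto
    simp only [Complex.ofReal_zero, zero_mul, sub_zero] at h2
    exact h2.mono_left nhdsWithin_le_nhds
  · have h1 : (0 : ℝ) < min (1 / (2 * K)) (d / 2) := by
      have := h.pos
      positivity
    filter_upwards [Ioo_mem_nhdsGT h1] with r hr
    have hr2 := hr.2.le
    rw [le_min_iff] at hr2
    exact hf.ball_subset h j hr.1 hr2.1 (by linarith) (Metric.mem_ball_self hr.1)

theorem TangentField.mem_closure (hf : TangentField D P t d S Ω f g) (h : WallData D P t K)
    (hd : 0 < d) (j : ι) : P j ∈ closure Ω :=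
  mem_closure_iff_nhdsWithin_neBot.2 ((hf.tendsto_center h hd j).neBot)

theorem TangentField.frontier_subset (hf : TangentField D P t d S Ω f g) {x : ℂ}
    (hx : x ∈ frontier Ω) : x ∈ frontier D ∨ (x ∈ D ∧ d ≤ Metric.infDist x (frontier D)) := by
  by_cases hxD : x ∈ D
  · right
    refine ⟨hxD, ?_⟩
    by_contra! hlt
    exact (hf.isOpen.frontier_eq ▸ hx).2 (hf.collar x hxD hlt)
  · left
    exact ⟨closure_mono hf.subset hx.1, fun h' => hxD (interior_subset h')⟩

/-- The gradient estimate at the walls. -/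
theorem WallData.exists_norm_deriv_le (h : WallData D P t K) (hd : 0 < d) :
    ∃ C, 0 < C ∧ ∀ (S : ℝ) (Ω : Set ℂ) (f g : ℂ → ℂ), TangentField D P t d S Ω f g →
      ∀ j, ‖g (P j)‖ ≤ C * S := by
  obtain ⟨Λ, hΛ0, hΛ⟩ : ∃ Λ : ℝ, 0 < Λ ∧ ∀ x ∈ closure D, ∀ y ∈ closure D, ‖x - y‖ ≤ Λ := by
    refine ⟨Metric.diam (closure D) + 1, by positivity, fun x hx y hy => ?_⟩
    rw [← dist_eq_norm]
    have := Metric.dist_le_diam_of_mem h.bounded.closure hx hy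
    linarith
  have hK := h.pos
  -- Half the radius `1 / (2K)` of an exterior touching disc; the slack produces the term `‖x - w₀‖
  -- ^ 2 / 2` in `hsq`.
  set R : ℝ := 1 / (4 * K) with hR
  have hR0 : 0 < R := by positivity
  set C₀ : ℝ := K + (1 + K * Λ) / d ^ 2 with hC₀
  have hC₀0 : 0 < C₀ := by positivity
  set A₀ : ℝ := C₀ * (2 * R ^ 2 + Λ ^ 2) with hA₀
  have hA₀0 : 0 < A₀ := by positivity
  refine ⟨2 * Real.exp 2 * (4 * A₀ / R) + K, by positivity, ?_⟩
  intro S Ω f g hf j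
  have hS := hf.bound_pos
  obtain ⟨κ, hκ, hq⟩ := h.tangent_expansion j
  set w₀ := P j with hw₀
  set ν := Complex.I * t j with hν
  have hνn : ‖ν‖ = 1 := h.norm_normal j
  set a := w₀ + (R : ℂ) * ν with ha
  have hw₀D : w₀ ∈ closure D := frontier_subset_closure (h.mem_frontier j)
  -- A holomorphic first-order model of the tangent: with it `Im F` vanishes to second order at `w₀`
  -- along the wall, whereas the constant `t j` would give first order only.
  set F : ℂ → ℂ := fun x => f x * (t j + κ * (x - w₀)) with hF
  set A := S * A₀ with hA
  have hA0 : 0 < A := by positivity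
  have hΩD : closure Ω ⊆ closure D := closure_mono hf.subset
  have hsq : ∀ x ∈ closure D, R ^ 2 + ‖x - w₀‖ ^ 2 / 2 ≤ ‖x - a‖ ^ 2 := by
    intro x hx
    have h1 := h.outer j x hx
    have h2 : x - a = (x - w₀) - R • ν := by rw [ha, Complex.real_smul]; ring
    rw [h2, norm_sub_sq_real (x - w₀) (R • ν), inner_smul_right, norm_smul, hνn, Real.norm_eq_abs, abs_of_pos hR0]
    have h3 : R * inner ℝ (x - w₀) ν ≤ R * (K * ‖x - w₀‖ ^ 2) := by gcongr
    have h4 : R * (K * ‖x - w₀‖ ^ 2) = ‖x - w₀‖ ^ 2 / 4 := by rw [hR]; field_simp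
    nlinarith
  have hdist : ∀ x ∈ closure D, R ≤ ‖x - a‖ := by
    intro x hx
    have := hsq x hx
    refine le_of_sq_le_sq ?_ (norm_nonneg _) |>.trans le_rfl
    nlinarith [sq_nonneg ‖x - w₀‖]
  -- On a wall, `f` times a real multiple of the tangent is real, so only the quadratic error of the
  -- model is left. Elsewhere on the frontier `x` is at least `d` away from `w₀` and the quadratic
  -- bound is trivial.
  have hfr : ∀ x ∈ frontier Ω, |(F x).im| ≤ C₀ * S * ‖x - w₀‖ ^ 2 := by
    intro x hx
    have hxΩ : x ∈ closure Ω := frontier_subset_closure hx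
    have hfx := hf.bound x hxΩ
    rcases hf.frontier_subset hx with hxF | ⟨hxD, hxd⟩
    · rw [← h.range_eq] at hxF
      obtain ⟨k, rfl⟩ := hxF
      obtain ⟨l, hl⟩ := hq k
      have h1 : (F (P k)).im = (f (P k) * (t j + κ * (P k - w₀) - l * t k)).im := by
        have h2 : f (P k) * (t j + κ * (P k - w₀) - l * t k)
            = F (P k) - (l : ℂ) * (f (P k) * t k) := by rw [hF]; ring
        rw [h2, Complex.sub_im, Complex.im_ofReal_mul, hf.tangential k, mul_zero, sub_zero]
      rw [h1]
      calc |(f (P k) * (t j + κ * (P k - w₀) - l * t k)).im|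
          ≤ ‖f (P k) * (t j + κ * (P k - w₀) - l * t k)‖ := Complex.abs_im_le_norm _
        _ ≤ S * (K * ‖P k - w₀‖ ^ 2) := by
            rw [norm_mul]
            exact mul_le_mul hfx hl (norm_nonneg _) hS.le
        _ ≤ C₀ * S * ‖P k - w₀‖ ^ 2 := by
            have : K ≤ C₀ := by rw [hC₀]; have : 0 ≤ (1 + K * Λ) / d ^ 2 := by positivity
                                linarith
            calc S * (K * ‖P k - w₀‖ ^ 2) = K * S * ‖P k - w₀‖ ^ 2 := by ring
              _ ≤ _ := by gcongr
    · have hxw : d ≤ ‖x - w₀‖ := hxd.trans (h.infDist_le j x)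
      have hxΛ := hΛ x (hΩD hxΩ) w₀ hw₀D
      calc |(F x).im| ≤ ‖F x‖ := Complex.abs_im_le_norm _
        _ ≤ S * (1 + K * Λ) := by
            rw [hF, norm_mul]
            refine mul_le_mul hfx ?_ (norm_nonneg _) hS.le
            refine (norm_add_le _ _).trans ?_
            rw [h.norm_t, norm_mul]
            gcongr
        _ = (1 + K * Λ) / d ^ 2 * S * d ^ 2 := by field_simp
        _ ≤ C₀ * S * ‖x - w₀‖ ^ 2 := by
            have : (1 + K * Λ) / d ^ 2 ≤ C₀ := by rw [hC₀]; linarith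
            gcongr
  -- The barrier is harmonic off `a`, vanishes at `w₀`, and dominates the quadratic bound thanks to
  -- `hsq` and `1 - 1 / y ≤ log y`.
  have hlog : ∀ x ∈ frontier Ω, |(F x).im| ≤ 2 * A * (Real.log ‖x - a‖ - Real.log R) := by
    intro x hx
    have hxD := hΩD (frontier_subset_closure hx)
    have h1 := hsq x hxD
    have hxa : 0 < ‖x - a‖ := hR0.trans_le (hdist x hxD)
    have h2 := Real.one_sub_inv_le_log_of_pos (x := ‖x - a‖ ^ 2 / R ^ 2) (by positivity)
    rw [Real.log_div (by positivity) (by positivity), Real.log_pow, Real.log_pow] at h2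
    push_cast at h2
    have h3 : ‖x - w₀‖ ^ 2 / (2 * R ^ 2 + Λ ^ 2) ≤ 1 - (‖x - a‖ ^ 2 / R ^ 2)⁻¹ := by
      rw [inv_div]
      have hy := hΛ x hxD w₀ hw₀D
      have hy2 : ‖x - w₀‖ ^ 2 ≤ Λ ^ 2 := by gcongr
      rw [div_le_iff₀ (by positivity)]
      have h4 : R ^ 2 / ‖x - a‖ ^ 2 ≤ R ^ 2 / (R ^ 2 + ‖x - w₀‖ ^ 2 / 2) := by gcongr
      have h5 : ‖x - w₀‖ ^ 2 ≤ (1 - R ^ 2 / (R ^ 2 + ‖x - w₀‖ ^ 2 / 2)) * (2 * R ^ 2 + Λ ^ 2) := by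
        have h6 : (1 - R ^ 2 / (R ^ 2 + ‖x - w₀‖ ^ 2 / 2))
            = ‖x - w₀‖ ^ 2 / (2 * R ^ 2 + ‖x - w₀‖ ^ 2) := by field_simp; ring
        rw [h6, div_mul_eq_mul_div, le_div_iff₀ (by positivity)]
        nlinarith [sq_nonneg ‖x - w₀‖]
      refine h5.trans ?_
      gcongr
    have h7 := hfr x hx
    calc |(F x).im| ≤ C₀ * S * ‖x - w₀‖ ^ 2 := h7
      _ = A * (‖x - w₀‖ ^ 2 / (2 * R ^ 2 + Λ ^ 2)) := by rw [hA, hA₀]; field_simp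
      _ ≤ A * (2 * Real.log ‖x - a‖ - 2 * Real.log R) := by
          gcongr
          exact h3.trans h2
      _ = _ := by ring
  have hFd : ∀ x ∈ Ω, HasDerivAt F (g x * (t j + κ * (x - w₀)) + f x * κ) x := by
    intro x hx
    have h1 : HasDerivAt (fun x => t j + κ * (x - w₀)) κ x := by
      simpa using (((hasDerivAt_id x).sub_const w₀).const_mul κ).const_add (t j)
    exact (hf.hasDerivAt x hx).mul h1
  have hFc : ContinuousOn F (closure Ω) := hf.cont_f.mul (by fun_prop)
  -- Exponentiating the barrier inequality turns it into a bound for a function that is locally the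
  -- modulus of a holomorphic one; the two values of `c` give the two signs of `Im F`.
  have hmax : ∀ c : ℂ, (c = Complex.I ∨ c = -Complex.I) → ∀ x ∈ closure Ω,
      (c * F x).re ≤ 2 * A * (Real.log ‖x - a‖ - Real.log R) := by
    intro c hc x hx
    have hcre : ∀ y, (c * F y).re ≤ |(F y).im| := by
      intro y
      rcases hc with rfl | rfl
      · rw [Complex.I_mul_re]; exact neg_le_abs _
      · rw [neg_mul, Complex.neg_re, Complex.I_mul_re, neg_neg]; exact le_abs_self _
    have hpos : ∀ y ∈ closure Ω, 0 < ‖y - a‖ := fun y hy => hR0.trans_le (hdist y (hΩD hy))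
    have key : ∀ y ∈ closure Ω, (‖Complex.exp (c * F y)‖ * ‖y - a‖ ^ (-(2 * A)) ≤ R ^ (-(2 * A)) ↔
        (c * F y).re ≤ 2 * A * (Real.log ‖y - a‖ - Real.log R)) := by
      intro y hy
      rw [Complex.norm_exp, Real.rpow_def_of_pos (hpos y hy), Real.rpow_def_of_pos hR0,
        ← Real.exp_add, Real.exp_le_exp]
      constructor <;> intro h' <;> linarith
    rw [← key x hx]
    refine le_of_forall_frontier_le (g := fun y => ‖Complex.exp (c * F y)‖ * ‖y - a‖ ^ (-(2 * A)))
      hf.isOpen (h.bounded.subset hf.subset) ?_ ?_ ?_ hx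
    · refine ContinuousOn.mul ?_ ?_
      · exact (Complex.continuous_exp.comp_continuousOn (continuousOn_const.mul hFc)).norm
      · refine ContinuousOn.rpow_const (by fun_prop) fun y hy => Or.inl (hpos y hy).ne'
    · intro y hy
      refine LocallyNormHolo.mul ?_ ?_
      · exact LocallyNormHolo.of_differentiable (f := fun y => Complex.exp (c * F y)) hf.isOpen hy
          fun w hw => ((hFd w hw).differentiableAt.const_mul c).cexp
      · refine LocallyNormHolo.rpow_dist ?_ _
        intro hya
        have := hpos y (subset_closure hy)
        rw [hya, sub_self, norm_zero] at this
        exact lt_irrefl _ this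
    · intro y hy
      rw [key y (frontier_subset_closure hy)]
      exact (hcre y).trans (hlog y hy)
  have hlin : ∀ x ∈ closure Ω, |(F x).im| ≤ 2 * A / R * ‖x - w₀‖ := by
    intro x hx
    have hxa : 0 < ‖x - a‖ := hR0.trans_le (hdist x (hΩD hx))
    have h1 : |(F x).im| ≤ 2 * A * (Real.log ‖x - a‖ - Real.log R) := by
      rw [abs_le']
      constructor
      · have := hmax _ (Or.inr rfl) x hx
        rwa [neg_mul, Complex.neg_re, Complex.I_mul_re, neg_neg] at this
      · have := hmax _ (Or.inl rfl) x hx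
        rwa [Complex.I_mul_re] at this
    refine h1.trans ?_
    rw [← Real.log_div hxa.ne' hR0.ne']
    have h2 := Real.log_le_sub_one_of_pos (x := ‖x - a‖ / R) (by positivity)
    have h3 : ‖x - a‖ ≤ ‖x - w₀‖ + R := by
      have h4 : x - a = (x - w₀) - (R : ℂ) * ν := by rw [ha]; ring
      rw [h4]
      refine (norm_sub_le _ _).trans ?_
      rw [norm_mul, hνn, Complex.norm_real, Real.norm_eq_abs, abs_of_pos hR0, mul_one]
    calc 2 * A * Real.log (‖x - a‖ / R) ≤ 2 * A * (‖x - a‖ / R - 1) := by gcongr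
      _ ≤ 2 * A * ((‖x - w₀‖ + R) / R - 1) := by gcongr
      _ = _ := by field_simp; ring
  -- On the interior disc of radius `r` touching at `w₀`, `|Im F|` is at most `4 A r / R`. The
  -- derivative bound at its centre is therefore independent of `r`, and `r → 0` reaches the wall.
  have hev : ∀ᶠ r : ℝ in 𝓝[>] 0, ‖g (w₀ - (r : ℂ) * ν) * (t j + κ * (w₀ - (r : ℂ) * ν - w₀))
      + f (w₀ - (r : ℂ) * ν) * κ‖ ≤ 2 * Real.exp 2 * (4 * A / R) := by
    have h1 : (0 : ℝ) < min (1 / (2 * K)) (d / 2) := by positivity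
    filter_upwards [Ioo_mem_nhdsGT h1] with r hr
    have hr0 := hr.1
    have hr2 := hr.2.le
    rw [le_min_iff] at hr2
    have hball := hf.ball_subset h j hr.1 hr2.1 (by linarith)
    rw [← (hFd _ (hball (Metric.mem_ball_self hr.1))).deriv]
    have := norm_deriv_le_of_abs_im_le (F := F) (c := w₀ - (r : ℂ) * ν) (r := r)
      (m := 2 * A / R * (2 * r)) hr.1 (by positivity)
      (fun y hy => (hFd y (hball hy)).differentiableAt) ?_
    · refine this.trans (le_of_eq ?_)
      field_simp
      norm_num
    · intro y hy
      refine (hlin y (subset_closure (hball hy))).trans ?_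
      gcongr
      calc ‖y - w₀‖ ≤ ‖y - (w₀ - (r : ℂ) * ν)‖ + ‖w₀ - (r : ℂ) * ν - w₀‖ :=
            norm_sub_le_norm_sub_add_norm_sub _ _ _
        _ ≤ r + r := by
            rw [h.dist_center j hr.1.le]
            gcongr
            rw [← dist_eq_norm]
            exact (Metric.mem_ball.1 hy).le
        _ = 2 * r := by ring
  have htend := hf.tendsto_center h hd j
  have hmono : 𝓝[Ω] w₀ ≤ 𝓝[closure Ω] w₀ := nhdsWithin_mono _ subset_closure
  have hcl := hf.mem_closure h hd j
  have hgl : Tendsto (fun r : ℝ => g (w₀ - (r : ℂ) * ν)) (𝓝[>] 0) (𝓝 (g w₀)) :=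
    (hf.cont_g w₀ hcl).tendsto.comp (htend.mono_right hmono)
  have hfl : Tendsto (fun r : ℝ => f (w₀ - (r : ℂ) * ν)) (𝓝[>] 0) (𝓝 (f w₀)) :=
    (hf.cont_f w₀ hcl).tendsto.comp (htend.mono_right hmono)
  have hql : Tendsto (fun r : ℝ => t j + κ * (w₀ - (r : ℂ) * ν - w₀)) (𝓝[>] 0) (𝓝 (t j)) := by
    have : ContinuousAt (fun r : ℝ => t j + κ * (w₀ - (r : ℂ) * ν - w₀)) 0 := by fun_prop
    have h2 := this.tendsto
    simp only [Complex.ofReal_zero, zero_mul, sub_zero, sub_self, mul_zero, add_zero] at h2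
    exact h2.mono_left nhdsWithin_le_nhds
  have hlim := le_of_tendsto ((hgl.mul hql).add (hfl.mul_const κ)).norm hev
  have hfin : ‖g w₀‖ ≤ 2 * Real.exp 2 * (4 * A / R) + S * K := by
    have h1 : ‖g w₀‖ = ‖(g w₀ * t j + f w₀ * κ) - f w₀ * κ‖ := by
      rw [add_sub_cancel_right, norm_mul, h.norm_t, mul_one]
    rw [h1]
    refine (norm_sub_le _ _).trans (add_le_add hlim ?_)
    rw [norm_mul]
    exact mul_le_mul (hf.bound _ hcl) hκ (norm_nonneg _) hS.le
  refine hfin.trans (le_of_eq ?_)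
  rw [hA]
  ring

end

/-! ### A two-constants theorem -/

theorem IsPreconnected.subset_of_disjoint_frontier {X : Type*} [TopologicalSpace X] {s D : Set X}
    (hs : IsPreconnected s) (hD : IsOpen D) (hne : (s ∩ D).Nonempty)
    (hdisj : Disjoint s (frontier D)) : s ⊆ D := by
  refine hs.subset_of_closure_inter_subset hD hne ?_
  rintro x ⟨hx, hxs⟩
  by_contra hxD
  exact hdisj.le_bot ⟨hxs, hD.frontier_eq ▸ ⟨hx, hxD⟩⟩

theorem ball_subset_of_le_infDist {X : Type*} [NormedAddCommGroup X] [NormedSpace ℝ X] {D : Set X}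
    (hD : IsOpen D) {x : X} (hx : x ∈ D) {r : ℝ} (hr : r ≤ Metric.infDist x (frontier D)) :
    Metric.ball x r ⊆ D := by
  rcases le_or_gt r 0 with h0 | h0
  · rw [Metric.ball_eq_empty.2 h0]; exact empty_subset _
  refine (convex_ball x r).isPreconnected.subset_of_disjoint_frontier hD
    ⟨x, Metric.mem_ball_self h0, hx⟩ ?_
  rw [Set.disjoint_left]
  intro y hy hyF
  have := Metric.infDist_le_dist_of_mem (x := x) hyF
  rw [Metric.mem_ball, dist_comm] at hy
  linarith

/-- A holomorphic function on `Ω ⊆ D`, bounded by `S`, and by the fraction `S * e` at the boundary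
points of `Ω` in the interior of `D`. -/
structure TwoConstants (D Ω : Set ℂ) (f : ℂ → ℂ) (S e : ℝ) : Prop where
  isOpen : IsOpen Ω
  subset : Ω ⊆ D
  cont : ContinuousOn f (closure Ω)
  diff : ∀ x ∈ Ω, DifferentiableAt ℂ f x
  bound_pos : 0 < S
  pos : 0 < e
  le_one : e ≤ 1
  bound : ∀ x ∈ closure Ω, ‖f x‖ ≤ S
  inner_bound : ∀ x ∈ frontier Ω, x ∈ D → ‖f x‖ ≤ S * e

/-- The function `f` is bounded by `S * e ^ a` in a disc. -/
def SmallOn (Ω : Set ℂ) (f : ℂ → ℂ) (S e : ℝ) (x : ℂ) (r a : ℝ) : Prop :=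
  ∀ w ∈ closure Ω, dist w x ≤ r → ‖f w‖ ≤ S * e ^ a

section

variable {D Ω : Set ℂ} {f : ℂ → ℂ} {S e : ℝ}

theorem SmallOn.mono (hf : TwoConstants D Ω f S e) {x y : ℂ} {r r' a a' : ℝ}
    (h : SmallOn Ω f S e x r a) (hr : dist y x + r' ≤ r) (ha : a' ≤ a) :
    SmallOn Ω f S e y r' a' := by
  intro w hw hwy
  refine (h w hw ?_).trans ?_
  · have := dist_triangle w y x
    linarith
  · have := hf.bound_pos.le
    gcongr 1
    exact Real.rpow_le_rpow_of_exponent_ge hf.pos hf.le_one ha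

/-- Hadamard's three circles theorem. The exponent `β` is such that `‖f y‖ * ‖y - x‖ ^ (-β)` has the
same bound on both circles (`hkey`). Boundary points of `Ω` inside the annulus are interior to `D`,
so the bound `S * e` holds there and is even better. -/
theorem TwoConstants.smallOn_annulus (hf : TwoConstants D Ω f S e) (hb : Bornology.IsBounded D)
    {x : ℂ} {ρ R₁ R₂ a : ℝ} (hρ : 0 < ρ) (h₁ : ρ ≤ R₁) (h₂ : R₁ < R₂)
    (hD : Metric.closedBall x R₂ ⊆ D) (ha : 0 ≤ a) (ha' : a ≤ 1) (h : SmallOn Ω f S e x ρ a) :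
    SmallOn Ω f S e x R₁ (Real.log (R₂ / R₁) / Real.log (R₂ / ρ) * a) := by
  have he := hf.pos
  have hS := hf.bound_pos
  have hR₁ : 0 < R₁ := hρ.trans_le h₁
  have hR₂ : 0 < R₂ := hR₁.trans h₂
  have hL : 0 < Real.log (R₂ / ρ) := Real.log_pos ((one_lt_div hρ).2 (h₁.trans_lt h₂))
  set θ := Real.log (R₂ / R₁) / Real.log (R₂ / ρ) with hθ
  have hθ1 : θ ≤ 1 := by
    rw [hθ, div_le_one hL]
    exact Real.log_le_log (by positivity) (by gcongr)
  have hle : Real.log e ≤ 0 := Real.log_nonpos he.le hf.le_one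
  set β := a * (-Real.log e) / Real.log (R₂ / ρ) with hβ
  have hβ0 : 0 ≤ β := div_nonneg (mul_nonneg ha (by linarith)) hL.le
  have hkey : e ^ a * ρ ^ (-β) = R₂ ^ (-β) := by
    rw [Real.rpow_def_of_pos he, Real.rpow_def_of_pos hρ, Real.rpow_def_of_pos hR₂, ← Real.exp_add]
    congr 1
    have : β * Real.log (R₂ / ρ) = a * (-Real.log e) := by rw [hβ]; field_simp
    rw [Real.log_div hR₂.ne' hρ.ne'] at this
    linarith
  intro w hw hwx
  rcases le_or_gt (dist w x) ρ with hwρ | hwρ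
  · refine (h w hw hwρ).trans ?_
    gcongr 1
    refine Real.rpow_le_rpow_of_exponent_ge he hf.le_one ?_
    calc θ * a ≤ 1 * a := by gcongr
      _ = a := one_mul a
  set V := {w : ℂ | ρ < ‖w - x‖} ∩ {w : ℂ | ‖w - x‖ < R₂} with hV
  have hVo : IsOpen V :=
    (isOpen_lt continuous_const (by fun_prop)).inter (isOpen_lt (by fun_prop) continuous_const)
  have hclV : ∀ y ∈ closure V, ρ ≤ ‖y - x‖ ∧ ‖y - x‖ ≤ R₂ := by
    intro y hy
    have hc : IsClosed ({y : ℂ | ρ ≤ ‖y - x‖} ∩ {y : ℂ | ‖y - x‖ ≤ R₂}) :=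
      (isClosed_le continuous_const (by fun_prop)).inter (isClosed_le (by fun_prop) continuous_const)
    have hsub : V ⊆ {y : ℂ | ρ ≤ ‖y - x‖} ∩ {y : ℂ | ‖y - x‖ ≤ R₂} := by
      intro y hy
      have h1 : ρ < ‖y - x‖ := hy.1
      have h2 : ‖y - x‖ < R₂ := hy.2
      exact ⟨h1.le, h2.le⟩
    exact closure_minimal hsub hc hy
  have hwV : w ∈ V := by
    rw [dist_eq_norm] at hwx hwρ
    exact ⟨hwρ, hwx.trans_lt h₂⟩
  have hwU : w ∈ closure (Ω ∩ V) := by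
    rw [inter_comm]
    exact hVo.inter_closure ⟨hwV, hw⟩
  have hmain : ‖f w‖ * ‖w - x‖ ^ (-β) ≤ S * R₂ ^ (-β) := by
    refine le_of_forall_frontier_le (g := fun y => ‖f y‖ * ‖y - x‖ ^ (-β)) (hf.isOpen.inter hVo)
      (hb.subset (inter_subset_left.trans hf.subset)) ?_ ?_ ?_ hwU
    · refine ContinuousOn.mul (hf.cont.mono (closure_mono inter_subset_left)).norm ?_
      refine ContinuousOn.rpow_const (by fun_prop) fun y hy => Or.inl ?_
      exact (hρ.trans_le (hclV y (closure_mono inter_subset_right hy)).1).ne'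
    · intro y hy
      refine LocallyNormHolo.mul (LocallyNormHolo.of_differentiable hf.isOpen hy.1 hf.diff) ?_
      refine LocallyNormHolo.rpow_dist ?_ _
      intro hyx
      have : ρ < ‖y - x‖ := hy.2.1
      rw [hyx, sub_self, norm_zero] at this
      exact absurd this (not_lt.2 hρ.le)
    · intro y hy
      have hycl := frontier_subset_closure hy
      have hyΩ := closure_mono inter_subset_left hycl
      obtain ⟨hy1, hy2⟩ := hclV y (closure_mono inter_subset_right hycl)
      have hypos : 0 < ‖y - x‖ := hρ.trans_le hy1
      rcases eq_or_lt_of_le hy2 with h3 | h3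
      · rw [h3]
        gcongr
        exact hf.bound y hyΩ
      · have hfy : ‖f y‖ ≤ S * e ^ a := by
          rcases eq_or_lt_of_le hy1 with h4 | h4
          · exact h y hyΩ (by rw [dist_eq_norm, h4])
          · have hyfr : y ∈ frontier Ω := by
              rw [hf.isOpen.frontier_eq]
              refine ⟨hyΩ, fun hyΩ' => ?_⟩
              rw [(hf.isOpen.inter hVo).frontier_eq] at hy
              exact hy.2 ⟨hyΩ', h4, h3⟩
            refine (hf.inner_bound y hyfr (hD ?_)).trans ?_
            · rw [Metric.mem_closedBall, dist_eq_norm]; exact hy2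
            · gcongr 1
              conv_lhs => rw [← Real.rpow_one e]
              exact Real.rpow_le_rpow_of_exponent_ge he hf.le_one ha'
        calc ‖f y‖ * ‖y - x‖ ^ (-β) ≤ (S * e ^ a) * ρ ^ (-β) := by
              gcongr 1
              exact Real.rpow_le_rpow_of_nonpos hρ hy1 (by linarith)
          _ = S * R₂ ^ (-β) := by rw [mul_assoc, hkey]
  have hwpos : 0 < ‖w - x‖ := hρ.trans hwV.1
  rw [Real.rpow_neg hwpos.le, ← div_eq_mul_inv, div_le_iff₀ (by positivity)] at hmain
  rw [dist_eq_norm] at hwx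
  calc ‖f w‖ ≤ S * R₂ ^ (-β) * ‖w - x‖ ^ β := hmain
    _ ≤ S * R₂ ^ (-β) * R₁ ^ β := by gcongr
    _ = S * e ^ (θ * a) := by
      rw [mul_assoc]
      congr 1
      rw [Real.rpow_def_of_pos he, Real.rpow_def_of_pos hR₁, Real.rpow_def_of_pos hR₂,
        ← Real.exp_add]
      congr 1
      have : θ * (a * (-Real.log e)) = β * Real.log (R₂ / R₁) := by rw [hθ, hβ]; ring
      rw [Real.log_div hR₂.ne' hR₁.ne'] at this
      linarith

/-- The points reached by the propagation of smallness from `x` form an open set, and one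
application of the three circles estimate shows that it is relatively closed in the connected set
`D`. Radius and exponent are fixed before `Ω` and `f`, which is the reason for this quantifier
order. -/
theorem exists_smallOn_chain (hD : IsOpen D) (hb : Bornology.IsBounded D) (hc : IsPreconnected D)
    {x : ℂ} (hx : x ∈ D) {ρ : ℝ} (hρ : 0 < ρ) {y : ℂ} (hy : y ∈ D) :
    ∃ ρ' > 0, ∃ κ > 0, κ ≤ 1 ∧ ∀ (Ω : Set ℂ) (f : ℂ → ℂ) (S e : ℝ), TwoConstants D Ω f S e →
      ∀ a, 0 ≤ a → a ≤ 1 → SmallOn Ω f S e x ρ a → SmallOn Ω f S e y ρ' (κ * a) := by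
  set good : Set ℂ := {y | ∃ ρ' > 0, ∃ κ > 0, κ ≤ 1 ∧
    ∀ (Ω : Set ℂ) (f : ℂ → ℂ) (S e : ℝ), TwoConstants D Ω f S e →
      ∀ a, 0 ≤ a → a ≤ 1 → SmallOn Ω f S e x ρ a → SmallOn Ω f S e y ρ' (κ * a)} with hgood
  refine hc.subset_of_closure_inter_subset (u := good) ?_ ?_ ?_ hy
  · rw [Metric.isOpen_iff]
    rintro y ⟨ρ', hρ', κ, hκ, hκ1, H⟩
    refine ⟨ρ' / 2, by positivity, fun y' hy' => ⟨ρ' / 2, by positivity, κ, hκ, hκ1, ?_⟩⟩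
    intro Ω f S e hf a ha ha' h
    refine (H Ω f S e hf a ha ha' h).mono hf ?_ le_rfl
    have := Metric.mem_ball.1 hy'
    linarith
  · exact ⟨x, hx, ρ, hρ, 1, one_pos, le_rfl, fun Ω f S e hf a _ _ h => by rwa [one_mul]⟩
  · rintro y ⟨hycl, hyD⟩
    obtain ⟨r, hr, hball⟩ := Metric.isOpen_iff.1 hD y hyD
    obtain ⟨y', ⟨ρ', hρ', κ, hκ, hκ1, H⟩, hyy'⟩ := Metric.mem_closure_iff.1 hycl (r / 5) (by positivity)
    -- Circles of radii `ρ''`, `2r / 5`, `3r / 5` about `y'`, with `y'` at distance less than `r /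
    -- 5` from `y`: the middle disc contains the disc of radius `r / 5` about `y`, and the largest
    -- one stays in the ball of radius `r` about `y`.
    set ρ'' := min ρ' (r / 5) with hρ''
    have hρ''0 : 0 < ρ'' := by positivity
    have hlog1 : 0 < Real.log (3 * (r / 5) / (2 * (r / 5))) := Real.log_pos (by
      rw [one_lt_div (by positivity)]; linarith)
    have hle : ρ'' ≤ r / 5 := min_le_right _ _
    have hlog2 : Real.log (3 * (r / 5) / (2 * (r / 5))) ≤ Real.log (3 * (r / 5) / ρ'') := by
      refine Real.log_le_log (by positivity) ?_
      gcongr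
      linarith
    refine ⟨r / 5, by positivity,
      Real.log (3 * (r / 5) / (2 * (r / 5))) / Real.log (3 * (r / 5) / ρ'') * κ, ?_, ?_, ?_⟩
    · have := hlog1.trans_le hlog2
      positivity
    · refine mul_le_one₀ ?_ hκ.le hκ1
      exact div_le_one_of_le₀ hlog2 (hlog1.le.trans hlog2)
    · intro Ω f S e hf a ha ha' h
      have h1 := H Ω f S e hf a ha ha' h
      have h2 : SmallOn Ω f S e y' ρ'' (κ * a) :=
        h1.mono hf (by rw [dist_self, zero_add]; exact min_le_left _ _) le_rfl
      have h3 := hf.smallOn_annulus hb (R₁ := 2 * (r / 5)) (R₂ := 3 * (r / 5)) hρ''0 (by linarith)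
        (by linarith) ?_ (by positivity) (mul_le_one₀ hκ1 ha ha') h2
      · rw [← mul_assoc] at h3
        exact h3.mono hf (by linarith) le_rfl
      · intro w hw
        refine hball ?_
        rw [Metric.mem_closedBall] at hw
        rw [Metric.mem_ball]
        have := dist_triangle w y' y
        rw [dist_comm y' y] at this
        linarith

end

/-! ### Capacity of spread-out sets and smallness near them -/

theorem factorial_mul_factorial_eq_prod (m j : ℕ) :
    ∏ k ∈ Finset.range (m + 1 + j), (if k = m then (1 : ℝ) else |(k : ℝ) - m|) =
      (m.factorial : ℝ) * (j.factorial : ℝ) := by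
  rw [Finset.prod_range_add, Finset.prod_range_succ, if_pos rfl, mul_one]
  congr 1
  · rw [← Nat.descFactorial_self m, Nat.descFactorial_eq_prod_range, Nat.cast_prod]
    refine Finset.prod_congr rfl fun k hk => ?_
    have hk' := Finset.mem_range.1 hk
    rw [if_neg hk'.ne, abs_sub_comm, Nat.cast_sub hk'.le, abs_of_nonneg]
    have : (k : ℝ) < m := by exact_mod_cast hk'
    linarith
  · rw [← Finset.prod_range_add_one_eq_factorial, Nat.cast_prod]
    refine Finset.prod_congr rfl fun k _ => ?_
    rw [if_neg (by omega)]
    push_cast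
    have : (m : ℝ) + 1 + k - m = k + 1 := by ring
    rw [this, abs_of_nonneg (by positivity)]

/-- A lower bound for the product of the distances to points that are spread out. -/
theorem pow_le_prod_of_spread {n : ℕ} (hn : 0 < n) {d R y : ℝ} (hd : 0 < d) (hR : d ≤ 4 * R)
    {D : ℕ → ℝ} (h₁ : ∀ k < n, d / n * |y - k| ≤ D k)
    (h₂ : ∀ k < n, R * Real.exp (-n) ≤ D k) :
    (d / (4 * Real.exp 2)) ^ n ≤ ∏ k ∈ Finset.range n, D k := by
  have hR0 : 0 < R := by linarith
  have hn0 : (0 : ℝ) < n := by exact_mod_cast hn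
  -- For the index `m` nearest to `y` one has `|k - m| ≤ 2 |y - k|`, which bounds all other factors
  -- from below. The factor of `m` itself is estimated by `h₂`, at the price of just one geometric
  -- factor `exp (-n)`.
  obtain ⟨m, hm, hmin⟩ := Finset.exists_min_image (Finset.range n) (fun k => |y - k|)
    ⟨0, Finset.mem_range.2 hn⟩
  have hmn := Finset.mem_range.1 hm
  obtain ⟨j, rfl⟩ : ∃ j, n = m + 1 + j := ⟨n - (m + 1), by omega⟩
  set n := m + 1 + j with hndef
  -- The binomial coefficient is at most `2 ^ (n - 1)`. Together with `n! ≥ n ^ n * exp (-n)` this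
  -- cancels the powers of `n` in the spacing `d / n`.
  have hfac : (n.factorial : ℝ) ≤ n * (2 ^ (n - 1) * (m.factorial * j.factorial)) := by
    have h1 : n - 1 = m + j := by omega
    have h2 : n = (m + j) + 1 := by omega
    have h3 := (Nat.add_choose_mul_factorial_mul_factorial m j)
    have h4 := Nat.choose_le_two_pow (m + j) j
    rw [h1]
    rw [h2, Nat.factorial_succ, ← h3]
    have : (m + j + 1) * ((m + j).choose j * m.factorial * j.factorial) ≤
        (m + j + 1) * (2 ^ (m + j) * (m.factorial * j.factorial)) := by
      rw [mul_assoc ((m + j).choose j)]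
      gcongr
    exact_mod_cast this
  have hexp : (n : ℝ) ^ n * Real.exp (-n) ≤ n.factorial := by
    have := Real.pow_div_factorial_le_exp n hn0.le n
    rw [div_le_iff₀ (by positivity)] at this
    rw [Real.exp_neg, ← div_eq_mul_inv, div_le_iff₀ (Real.exp_pos _)]
    linarith
  have hcardm : ((Finset.range n).erase m).card = n - 1 := by
    rw [Finset.card_erase_of_mem hm, Finset.card_range]
  have hlow : R * Real.exp (-n) * ((d / (2 * n)) ^ (n - 1) * (m.factorial * j.factorial)) ≤
      ∏ k ∈ Finset.range n, D k := by
    rw [← Finset.mul_prod_erase _ _ hm]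
    refine mul_le_mul (h₂ m hmn) ?_ (by positivity) ((by positivity : (0 : ℝ) ≤ _).trans (h₂ m hmn))
    rw [← factorial_mul_factorial_eq_prod, ← hndef, ← Finset.mul_prod_erase _ _ hm, if_pos rfl,
      one_mul, ← hcardm, ← Finset.prod_const, ← Finset.prod_mul_distrib]
    refine Finset.prod_le_prod (fun k _ => ?_) fun k hk => ?_
    · split_ifs <;> positivity
    · obtain ⟨hkm, hk'⟩ := Finset.mem_erase.1 hk
      rw [if_neg hkm]
      refine le_trans ?_ (h₁ k (Finset.mem_range.1 hk'))
      have h5 := hmin k hk'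
      have h6 : |(k : ℝ) - m| ≤ |y - k| + |y - m| := by
        have := abs_sub_le (k : ℝ) y m
        rwa [abs_sub_comm (k : ℝ) y] at this
      calc d / (2 * n) * |(k : ℝ) - m| ≤ d / (2 * n) * (2 * |y - k|) := by
            gcongr; linarith
        _ = d / n * |y - k| := by field_simp
  refine le_trans ?_ hlow
  have hE := Real.exp_pos (-(n : ℝ))
  have h7 : Real.exp (-(n : ℝ)) * Real.exp (-(n : ℝ)) = (1 / Real.exp 2) ^ n := by
    rw [one_div, ← Real.exp_neg, ← Real.exp_nat_mul, ← Real.exp_add]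
    congr 1; ring
  have h8 : (n : ℝ) ^ (n - 1) * n = n ^ n := by rw [← pow_succ, Nat.sub_add_cancel hn]
  have h9 : (d / 4) ^ n = (d / 4) ^ (n - 1) * (d / 4) := by rw [← pow_succ, Nat.sub_add_cancel hn]
  calc (d / (4 * Real.exp 2)) ^ n = (d / 4) ^ n * (1 / Real.exp 2) ^ n := by
        rw [← mul_pow]; congr 1; field_simp
    _ = (d / 4) ^ (n - 1) * (d / 4) * (Real.exp (-n) * Real.exp (-n)) := by rw [h7, h9]
    _ ≤ (d / 4) ^ (n - 1) * R * (Real.exp (-n) * Real.exp (-n)) := by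
        gcongr; linarith
    _ = R * Real.exp (-n) * ((d / 4) ^ (n - 1) / n ^ n * (n ^ n * Real.exp (-n))) := by
        field_simp
    _ ≤ R * Real.exp (-n) * ((d / 4) ^ (n - 1) / n ^ n *
          (n * (2 ^ (n - 1) * (m.factorial * j.factorial)))) := by
        gcongr _ * (_ * ?_)
        exact hexp.trans hfac
    _ = R * Real.exp (-n) * ((d / (2 * n)) ^ (n - 1) * (m.factorial * j.factorial)) := by
        have h10 : (d / (2 * n)) ^ (n - 1) = (d / 4) ^ (n - 1) * 2 ^ (n - 1) / (n : ℝ) ^ (n - 1) := by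
          rw [← mul_pow, ← div_pow]; congr 1; field_simp; norm_num
        rw [h10, ← h8]
        field_simp

section

variable {D Ω : Set ℂ} {f : ℂ → ℂ} {S e : ℝ}

/-- A set that meets every circle of radius at most `d` about `z₀` has capacity comparable to `d`.
With `Q` the product of the distances to `n` of its points, compare `‖f‖` with a multiple of `Q ^
α`. Near `G`, where `‖f‖ ≤ S * e`, one has `Q ≥ (b * R) ^ n`; on the frontier of `D`, `Q ≥ R ^ n`;
in the disc of radius `R / 2`, `Q ≤ (3 / 4 * R) ^ n`, which gains a factor `(3 / 4) ^ β`. The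
resulting exponent depends on `d / R` only, not on `n` or `σ`. -/
theorem TwoConstants.smallOn_of_spread (hf : TwoConstants D Ω f S e) (hb : Bornology.IsBounded D)
    {z₀ : ℂ} {d R σ : ℝ} (hd : 0 < d) (hdR : 4 * d ≤ R) {G : Set ℂ}
    (hG : ∀ z ∈ G, R ≤ Metric.infDist z (frontier D)) (hσ : 0 < σ)
    (hnear : ∀ w ∈ closure Ω, ∀ z ∈ G, dist w z ≤ σ → ‖f w‖ ≤ S * e)
    (hspread : ∀ r, 0 ≤ r → r ≤ d → ∃ z ∈ G, ‖z - z₀‖ = r) :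
    SmallOn Ω f S e z₀ (R / 2) (Real.log (4 / 3) / -Real.log (d / (4 * Real.exp 2) / R)) := by
  have he := hf.pos
  have hS := hf.bound_pos
  have hR : 0 < R := by linarith
  set b := d / (4 * Real.exp 2) / R with hb'
  have hb0 : 0 < b := by positivity
  have hexp2 : 1 ≤ Real.exp 2 := Real.one_le_exp (by norm_num)
  have hb1 : b ≤ 1 / 16 := by
    rw [hb', div_le_iff₀ hR, div_le_iff₀ (by positivity)]
    nlinarith
  have hlb : Real.log (4 / 3) ≤ -Real.log b := by
    rw [← Real.log_inv]
    refine Real.log_le_log (by norm_num) ?_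
    rw [le_inv_comm₀ (by norm_num) hb0]
    linarith
  have hL : 0 < -Real.log b := (Real.log_pos (by norm_num)).trans_le hlb
  have hle : Real.log e ≤ 0 := Real.log_nonpos he.le hf.le_one
  set δ := Real.log (4 / 3) / -Real.log b with hδ
  have hδ1 : δ ≤ 1 := by rw [hδ, div_le_one hL]; exact hlb
  have heδ : S * e ≤ S * e ^ δ := by
    gcongr 1
    conv_lhs => rw [← Real.rpow_one e]
    exact Real.rpow_le_rpow_of_exponent_ge he hf.le_one hδ1
  -- Chosen so that `b ^ (-β) = e⁻¹`: then the bounds near `G` and at the frontier of `D` agree.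
  set β := -Real.log e / -Real.log b with hβ
  have hβ0 : 0 ≤ β := div_nonneg (by linarith) hL.le
  -- The discs removed around the points have radius `R * exp (-n)`. They must lie where `f` is
  -- still small, and the same radius is the lower bound for the nearest factor of `Q`.
  obtain ⟨n, hn0, hn⟩ : ∃ n : ℕ, 0 < n ∧ R * Real.exp (-n) ≤ σ := by
    obtain ⟨n, hn⟩ := exists_nat_gt (max 0 (-Real.log (σ / R)))
    have h1 := (le_max_right _ _).trans_lt hn
    have h2 := (le_max_left _ _).trans_lt hn
    refine ⟨n, by exact_mod_cast h2, ?_⟩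
    rw [mul_comm, ← le_div_iff₀ hR, ← Real.le_log_iff_exp_le (by positivity)]
    linarith
  have hnR : (0 : ℝ) < n := by exact_mod_cast hn0
  have hex : ∀ k : ℕ, ∃ z : ℂ, k < n → z ∈ G ∧ ‖z - z₀‖ = ((k : ℝ) + 1) / n * d := by
    intro k
    by_cases hk : k < n
    · have hk' : (k : ℝ) + 1 ≤ n := by exact_mod_cast hk
      obtain ⟨z, hz, hz'⟩ := hspread (((k : ℝ) + 1) / n * d) (by positivity) (by
        have : ((k : ℝ) + 1) / n ≤ 1 := (div_le_one hnR).2 hk'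
        nlinarith)
      exact ⟨z, fun _ => ⟨hz, hz'⟩⟩
    · exact ⟨0, fun h => absurd h hk⟩
  choose z hz using hex
  set α := β / n with hα
  have hα0 : 0 ≤ α := by positivity
  have hnα : n * α = β := by rw [hα]; field_simp
  set ρ := R * Real.exp (-n) with hρ
  have hρ0 : 0 < ρ := by positivity
  set Q : ℂ → ℝ := fun y => ∏ k ∈ Finset.range n, ‖y - z k‖ with hQ
  have hQlow : ∀ y, (∀ k < n, ρ ≤ ‖y - z k‖) → (b * R) ^ n ≤ Q y := by
    intro y hy
    have hbR : b * R = d / (4 * Real.exp 2) := by rw [hb']; field_simp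
    rw [hbR]
    -- Circular projection: the distance from `y` to `z k` is at least the difference of their
    -- distances to `z₀`, and the latter are equally spaced. The shift by `1` accounts for the radii
    -- `(k + 1) / n * d`.
    refine pow_le_prod_of_spread (y := ‖y - z₀‖ * n / d - 1) hn0 hd (by linarith) ?_ hy
    intro k hk
    have h1 : d / n * |‖y - z₀‖ * n / d - 1 - k| = |‖y - z₀‖ - ‖z k - z₀‖| := by
      have hdn : 0 < d / (n : ℝ) := by positivity
      rw [(hz k hk).2]
      conv_lhs => rw [← abs_of_pos hdn, ← abs_mul]
      congr 1
      field_simp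
      ring
    rw [h1]
    refine (abs_norm_sub_norm_le _ _).trans (le_of_eq ?_)
    congr 1
    ring
  intro w hw hwz
  by_cases hcase : ∃ k < n, ‖w - z k‖ ≤ ρ
  · obtain ⟨k, hk, hk'⟩ := hcase
    exact (hnear w hw (z k) (hz k hk).1 (by rw [dist_eq_norm]; exact hk'.trans hn)).trans heδ
  push Not at hcase
  set V : Set ℂ := ⋂ k ∈ Finset.range n, {y : ℂ | ρ < ‖y - z k‖} with hV
  have hmemV : ∀ y, y ∈ V ↔ ∀ k < n, ρ < ‖y - z k‖ := by
    intro y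
    simp [hV]
  have hVo : IsOpen V := isOpen_biInter_finset fun k _ => isOpen_lt continuous_const (by fun_prop)
  have hclV : ∀ y ∈ closure V, ∀ k < n, ρ ≤ ‖y - z k‖ := by
    intro y hy k hk
    have hc : IsClosed {y : ℂ | ρ ≤ ‖y - z k‖} := isClosed_le continuous_const (by fun_prop)
    have hsub : V ⊆ {y : ℂ | ρ ≤ ‖y - z k‖} := fun y hy => le_of_lt ((hmemV y).1 hy k hk)
    exact closure_minimal hsub hc hy
  have hwU : w ∈ closure (Ω ∩ V) := by
    rw [inter_comm]
    exact hVo.inter_closure ⟨(hmemV w).2 hcase, hw⟩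
  have hQpow : ∀ y, Q y ^ (-α) = ∏ k ∈ Finset.range n, ‖y - z k‖ ^ (-α) := fun y =>
    (Real.finsetProd_rpow _ _ (fun k _ => norm_nonneg _) _).symm
  have hbpow : ((b * R) ^ n) ^ (-α) = e⁻¹ * R ^ (-β) := by
    rw [← Real.rpow_natCast, ← Real.rpow_mul (by positivity), mul_neg, hnα,
      Real.mul_rpow hb0.le hR.le]
    congr 1
    rw [Real.rpow_def_of_pos hb0, ← Real.exp_log he, ← Real.exp_neg]
    congr 1
    have hlogb : Real.log b ≠ 0 := by
      intro h0
      rw [h0] at hL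
      simp at hL
    rw [hβ]
    field_simp
  have hRpow : (R ^ n) ^ (-α) = R ^ (-β) := by
    rw [← Real.rpow_natCast, ← Real.rpow_mul hR.le, mul_neg, hnα]
  have hpos : ∀ y ∈ closure V, 0 < Q y := fun y hy =>
    (by positivity : 0 < (b * R) ^ n).trans_le (hQlow y (hclV y hy))
  have hmain : ‖f w‖ * Q w ^ (-α) ≤ S * R ^ (-β) := by
    refine le_of_forall_frontier_le (g := fun y => ‖f y‖ * Q y ^ (-α)) (hf.isOpen.inter hVo)
      (hb.subset (inter_subset_left.trans hf.subset)) ?_ ?_ ?_ hwU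
    · refine ContinuousOn.mul (hf.cont.mono (closure_mono inter_subset_left)).norm ?_
      refine ContinuousOn.rpow_const (by fun_prop) fun y hy => Or.inl ?_
      exact (hpos y (closure_mono inter_subset_right hy)).ne'
    · intro y hy
      refine LocallyNormHolo.mul (LocallyNormHolo.of_differentiable hf.isOpen hy.1 hf.diff) ?_
      simp only [hQpow]
      refine LocallyNormHolo.prod _ fun k hk => LocallyNormHolo.rpow_dist ?_ _
      intro hyz
      have := (hmemV y).1 hy.2 k (Finset.mem_range.1 hk)
      rw [hyz, sub_self, norm_zero] at this
      exact absurd this (not_lt.2 hρ0.le)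
    · intro y hy
      have hycl := frontier_subset_closure hy
      have hyΩ := closure_mono inter_subset_left hycl
      have hyV := closure_mono inter_subset_right hycl
      have hyk := hclV y hyV
      by_cases hsm : ‖f y‖ ≤ S * e
      · calc ‖f y‖ * Q y ^ (-α) ≤ S * e * ((b * R) ^ n) ^ (-α) := by
              gcongr 1
              exact Real.rpow_le_rpow_of_nonpos (by positivity) (hQlow y hyk) (by linarith)
          _ = S * R ^ (-β) := by rw [hbpow]; field_simp
      · have hyV' : y ∈ V := by
          rw [hmemV]
          intro k hk
          refine lt_of_le_of_ne (hyk k hk) fun heq => hsm ?_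
          exact hnear y hyΩ (z k) (hz k hk).1 (by rw [dist_eq_norm, ← heq]; exact hn)
        have hyfr : y ∈ frontier Ω := by
          rw [hf.isOpen.frontier_eq]
          refine ⟨hyΩ, fun hyΩ' => ?_⟩
          rw [(hf.isOpen.inter hVo).frontier_eq] at hy
          exact hy.2 ⟨hyΩ', hyV'⟩
        have hyD : y ∉ D := fun h => hsm (hf.inner_bound y hyfr h)
        have hyF : y ∈ frontier D :=
          ⟨closure_mono hf.subset hyΩ, fun h' => hyD (interior_subset h')⟩
        gcongr
        · exact hf.bound y hyΩ
        · rw [← hRpow]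
          refine Real.rpow_le_rpow_of_nonpos (by positivity) ?_ (by linarith)
          have : R ^ n = ∏ _k ∈ Finset.range n, R := by simp
          rw [this]
          refine Finset.prod_le_prod (fun _ _ => hR.le) fun k hk => ?_
          refine (hG (z k) (hz k (Finset.mem_range.1 hk)).1).trans ?_
          rw [← dist_eq_norm, dist_comm]
          exact Metric.infDist_le_dist_of_mem hyF
  have hQw := hpos w (subset_closure ((hmemV w).2 hcase))
  rw [Real.rpow_neg hQw.le, ← div_eq_mul_inv, div_le_iff₀ (by positivity)] at hmain
  rw [dist_eq_norm] at hwz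
  have hQup : Q w ≤ (3 / 4 * R) ^ n := by
    have : (3 / 4 * R) ^ n = ∏ _k ∈ Finset.range n, (3 / 4 * R) := by simp
    rw [this]
    refine Finset.prod_le_prod (fun _ _ => norm_nonneg _) fun k hk => ?_
    have hk' := Finset.mem_range.1 hk
    have h1 : (k : ℝ) + 1 ≤ n := by exact_mod_cast hk'
    have h2 : ((k : ℝ) + 1) / n ≤ 1 := (div_le_one hnR).2 h1
    have h3 := (hz k hk').2
    have h4 : ‖w - z k‖ ≤ ‖w - z₀‖ + ‖z k - z₀‖ := by
      have : w - z k = (w - z₀) - (z k - z₀) := by ring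
      rw [this]; exact norm_sub_le _ _
    rw [h3] at h4
    nlinarith
  have hpow : ((3 / 4 * R) ^ n) ^ α = (3 / 4) ^ β * R ^ β := by
    rw [← Real.rpow_natCast, ← Real.rpow_mul (by positivity), hnα,
      Real.mul_rpow (by norm_num) hR.le]
  calc ‖f w‖ ≤ S * R ^ (-β) * Q w ^ α := hmain
    _ ≤ S * R ^ (-β) * ((3 / 4 * R) ^ n) ^ α := by gcongr
    _ = S * (3 / 4) ^ β := by
      rw [hpow, Real.rpow_neg hR.le]
      field_simp
    _ = S * e ^ δ := by
      congr 1
      rw [Real.rpow_def_of_pos he, Real.rpow_def_of_pos (by norm_num)]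
      congr 1
      have : Real.log (3 / 4) = -Real.log (4 / 3) := by
        rw [← Real.log_inv]; norm_num
      rw [this, hδ, hβ]
      ring

theorem isCompact_closure_inter_infDist (hb : Bornology.IsBounded D) (r : ℝ) :
    IsCompact (closure D ∩ {x | r ≤ Metric.infDist x (frontier D)}) :=
  hb.isCompact_closure.inter_right (isClosed_le continuous_const (Metric.continuous_infDist_pt _))

theorem mem_of_mem_closure_of_infDist_pos {x : ℂ} (hx : x ∈ closure D)
    (h : 0 < Metric.infDist x (frontier D)) : x ∈ D := by
  by_contra hxD
  have : x ∈ frontier D := ⟨hx, fun h' => hxD (interior_subset h')⟩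
  rw [Metric.infDist_zero_of_mem this] at h
  exact lt_irrefl _ h

/-- Compactness, used once for the target point and once for the starting point, makes the exponents
of `exists_smallOn_chain` uniform; passing to the smaller exponent is harmless as `e ≤ 1`.
Uniformity in `z₀` is needed because the position of the interface is not known. -/
theorem exists_smallOn_uniform (hD : IsOpen D) (hb : Bornology.IsBounded D) (hc : IsPreconnected D)
    {R r : ℝ} (hR : 0 < R) (hr : 0 < r) :
    ∃ κ > 0, κ ≤ 1 ∧ ∀ (Ω : Set ℂ) (f : ℂ → ℂ) (S e : ℝ), TwoConstants D Ω f S e →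
      ∀ a, 0 ≤ a → a ≤ 1 → ∀ z₀ ∈ D, R ≤ Metric.infDist z₀ (frontier D) →
        SmallOn Ω f S e z₀ (R / 2) a →
        ∀ x ∈ closure Ω, r ≤ Metric.infDist x (frontier D) → ‖f x‖ ≤ S * e ^ (κ * a) := by
  have step : ∀ z ∈ D, ∃ κ > 0, κ ≤ 1 ∧ ∀ (Ω : Set ℂ) (f : ℂ → ℂ) (S e : ℝ),
      TwoConstants D Ω f S e → ∀ a, 0 ≤ a → a ≤ 1 → SmallOn Ω f S e z (R / 4) a →
      ∀ x ∈ closure D ∩ {x | r ≤ Metric.infDist x (frontier D)}, x ∈ closure Ω →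
        ‖f x‖ ≤ S * e ^ (κ * a) := by
    intro z hz
    refine (isCompact_closure_inter_infDist hb r).induction_on
      (p := fun s => ∃ κ > 0, κ ≤ 1 ∧ ∀ (Ω : Set ℂ) (f : ℂ → ℂ) (S e : ℝ),
      TwoConstants D Ω f S e → ∀ a, 0 ≤ a → a ≤ 1 → SmallOn Ω f S e z (R / 4) a →
      ∀ x ∈ s, x ∈ closure Ω → ‖f x‖ ≤ S * e ^ (κ * a)) ?_ ?_ ?_ ?_
    · exact ⟨1, one_pos, le_rfl, fun _ _ _ _ _ _ _ _ _ x hx => absurd hx (notMem_empty x)⟩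
    · rintro s s' hss' ⟨κ, hκ, hκ1, H⟩
      exact ⟨κ, hκ, hκ1, fun Ω f S e hf a ha ha' h x hx => H Ω f S e hf a ha ha' h x (hss' hx)⟩
    · rintro s s' ⟨κ, hκ, hκ1, H⟩ ⟨κ', hκ', hκ1', H'⟩
      refine ⟨min κ κ', lt_min hκ hκ', (min_le_left _ _).trans hκ1, ?_⟩
      intro Ω f S e hf a ha ha' h x hx hxΩ
      have hS := hf.bound_pos
      rcases hx with hx | hx
      · refine (H Ω f S e hf a ha ha' h x hx hxΩ).trans ?_
        gcongr 1
        refine Real.rpow_le_rpow_of_exponent_ge hf.pos hf.le_one ?_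
        gcongr
        exact min_le_left _ _
      · refine (H' Ω f S e hf a ha ha' h x hx hxΩ).trans ?_
        gcongr 1
        refine Real.rpow_le_rpow_of_exponent_ge hf.pos hf.le_one ?_
        gcongr
        exact min_le_right _ _
    · rintro y ⟨hycl, hy⟩
      have hyr : r ≤ Metric.infDist y (frontier D) := hy
      have hyD := mem_of_mem_closure_of_infDist_pos hycl (hr.trans_le hyr)
      obtain ⟨ρ, hρ, κ, hκ, hκ1, H⟩ := exists_smallOn_chain hD hb hc hz
        (show 0 < R / 4 by positivity) hyD
      refine ⟨Metric.ball y ρ, mem_nhdsWithin_of_mem_nhds (Metric.ball_mem_nhds y hρ), κ, hκ, hκ1, ?_⟩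
      intro Ω f S e hf a ha ha' h x hx hxΩ
      exact H Ω f S e hf a ha ha' h x hxΩ (Metric.mem_ball.1 hx).le
  have main := (isCompact_closure_inter_infDist hb R).induction_on
      (p := fun s => ∃ κ > 0, κ ≤ 1 ∧ ∀ (Ω : Set ℂ) (f : ℂ → ℂ) (S e : ℝ),
      TwoConstants D Ω f S e → ∀ a, 0 ≤ a → a ≤ 1 → ∀ z₀ ∈ s, SmallOn Ω f S e z₀ (R / 2) a →
      ∀ x ∈ closure D ∩ {x | r ≤ Metric.infDist x (frontier D)}, x ∈ closure Ω →
        ‖f x‖ ≤ S * e ^ (κ * a)) ?_ ?_ ?_ ?_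
  · obtain ⟨κ, hκ, hκ1, H⟩ := main
    refine ⟨κ, hκ, hκ1, ?_⟩
    intro Ω f S e hf a ha ha' z₀ hz₀ hz₀R h x hx hxr
    exact H Ω f S e hf a ha ha' z₀ ⟨subset_closure hz₀, hz₀R⟩ h x
      ⟨closure_mono hf.subset hx, hxr⟩ hx
  · exact ⟨1, one_pos, le_rfl, fun _ _ _ _ _ _ _ _ x hx => absurd hx (notMem_empty x)⟩
  · rintro s s' hss' ⟨κ, hκ, hκ1, H⟩
    exact ⟨κ, hκ, hκ1, fun Ω f S e hf a ha ha' z₀ hz₀ => H Ω f S e hf a ha ha' z₀ (hss' hz₀)⟩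
  · rintro s s' ⟨κ, hκ, hκ1, H⟩ ⟨κ', hκ', hκ1', H'⟩
    refine ⟨min κ κ', lt_min hκ hκ', (min_le_left _ _).trans hκ1, ?_⟩
    intro Ω f S e hf a ha ha' z₀ hz₀ h x hx hxΩ
    have hS := hf.bound_pos
    rcases hz₀ with hz₀ | hz₀
    · refine (H Ω f S e hf a ha ha' z₀ hz₀ h x hx hxΩ).trans ?_
      gcongr 1
      refine Real.rpow_le_rpow_of_exponent_ge hf.pos hf.le_one ?_
      gcongr
      exact min_le_left _ _
    · refine (H' Ω f S e hf a ha ha' z₀ hz₀ h x hx hxΩ).trans ?_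
      gcongr 1
      refine Real.rpow_le_rpow_of_exponent_ge hf.pos hf.le_one ?_
      gcongr
      exact min_le_right _ _
  · rintro z ⟨hzcl, hz⟩
    have hzR : R ≤ Metric.infDist z (frontier D) := hz
    have hzD := mem_of_mem_closure_of_infDist_pos hzcl (hR.trans_le hzR)
    obtain ⟨κ, hκ, hκ1, H⟩ := step z hzD
    refine ⟨Metric.ball z (R / 4),
      mem_nhdsWithin_of_mem_nhds (Metric.ball_mem_nhds z (by positivity)), κ, hκ, hκ1, ?_⟩
    intro Ω f S e hf a ha ha' z₀ hz₀ h x hx hxΩ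
    refine H Ω f S e hf a ha ha' (h.mono hf ?_ le_rfl) x hx hxΩ
    rw [dist_comm]
    have := Metric.mem_ball.1 hz₀
    linarith

/-- By the strict inequality the compact set `G` and the closed set where `‖f‖ ≥ c` are disjoint,
hence at positive distance. No control of `σ` is available, and none is needed. -/
theorem exists_dist_le_imp_norm_le {C G : Set ℂ} (hC : IsClosed C) (hf : ContinuousOn f C)
    (hG : IsCompact G) {c : ℝ} (hlt : ∀ z ∈ G, ‖f z‖ < c) :
    ∃ σ > 0, ∀ w ∈ C, ∀ z ∈ G, dist w z ≤ σ → ‖f w‖ ≤ c := by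
  set A := C ∩ (fun w => ‖f w‖) ⁻¹' Ici c with hA
  have hAc : IsClosed A := hf.norm.preimage_isClosed_of_isClosed hC isClosed_Ici
  have hdisj : Disjoint G A := by
    rw [Set.disjoint_left]
    rintro z hz ⟨_, hz'⟩
    exact absurd (hlt z hz) (not_lt.2 hz')
  obtain ⟨σ, hσ, h⟩ := hdisj.exists_cthickenings hG hAc
  refine ⟨σ, hσ, fun w hw z hz hwz => ?_⟩
  by_contra! hcon
  refine h.le_bot ⟨Metric.mem_cthickening_of_dist_le w z σ G hz hwz, ?_⟩
  exact Metric.self_subset_cthickening A ⟨hw, hcon.le⟩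

theorem IsPreconnected.exists_norm_sub_eq {G : Set ℂ} (hG : IsPreconnected G) {z₀ z₁ : ℂ}
    (h₀ : z₀ ∈ G) (h₁ : z₁ ∈ G) {r : ℝ} (hr : 0 ≤ r) (hr' : r ≤ ‖z₁ - z₀‖) :
    ∃ z ∈ G, ‖z - z₀‖ = r := by
  have := hG.intermediate_value h₀ h₁ (f := fun z => ‖z - z₀‖) (by fun_prop)
  exact this ⟨by simpa using hr, hr'⟩

end

/-! ### Control at the walls by the inner boundary values -/

section

variable {D : Set ℂ} {ι : Type*} {P t : ι → ℂ} {K d : ℝ}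

/-- The gradient estimate in a collar of the walls. -/
theorem WallData.exists_norm_deriv_le_collar (h : WallData D P t K) (hd : 0 < d) :
    ∃ C, 0 < C ∧ ∀ (S : ℝ) (Ω : Set ℂ) (f g : ℂ → ℂ), TangentField D P t d S Ω f g →
      ∀ x ∈ D, Metric.infDist x (frontier D) < d / 2 → ‖g x‖ ≤ C * S := by
  obtain ⟨C, hC, H⟩ := h.exists_norm_deriv_le hd
  refine ⟨max C (4 / d), lt_max_of_lt_left hC, ?_⟩
  intro S Ω f g hf x hx hxd
  have hS := hf.bound_pos
  set U := D ∩ {x | Metric.infDist x (frontier D) < d / 2} with hU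
  have hUo : IsOpen U :=
    h.isOpen.inter (isOpen_lt (Metric.continuous_infDist_pt _) continuous_const)
  have hUΩ : U ⊆ Ω := by
    rintro y ⟨hy, hy'⟩
    have hy2 : Metric.infDist y (frontier D) < d / 2 := hy'
    exact hf.collar y hy (by linarith)
  have hgd : ∀ y ∈ Ω, DifferentiableAt ℂ g y := by
    intro y hy
    have h1 : DifferentiableOn ℂ f Ω := fun w hw => (hf.hasDerivAt w hw).differentiableAt.differentiableWithinAt
    have h2 := (h1.deriv hf.isOpen).differentiableAt (hf.isOpen.mem_nhds hy)
    refine h2.congr_of_eventuallyEq ?_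
    filter_upwards [hf.isOpen.mem_nhds hy] with w hw using (hf.hasDerivAt w hw).deriv.symm
  refine le_of_forall_frontier_le (g := fun y => ‖g y‖) hUo (h.bounded.subset inter_subset_left)
    (hf.cont_g.mono (closure_mono hUΩ)).norm
    (fun y hy => LocallyNormHolo.of_differentiable hf.isOpen (hUΩ hy) hgd) ?_
    (subset_closure ⟨hx, hxd⟩)
  intro y hy
  rw [hUo.frontier_eq] at hy
  -- A frontier point of the collar is either at distance `d / 2` from the walls, where Cauchy's
  -- estimate applies on a disc inside `Ω`, or a wall point, where the previous estimate applies.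
  by_cases hyD : y ∈ D
  · have hle : Metric.infDist y (frontier D) ≤ d / 2 := by
      have hsub : U ⊆ {x | Metric.infDist x (frontier D) ≤ d / 2} := by
        rintro y ⟨_, hy'⟩
        have hy2 : Metric.infDist y (frontier D) < d / 2 := hy'
        exact hy2.le
      exact closure_minimal hsub
        (isClosed_le (Metric.continuous_infDist_pt _) continuous_const) hy.1
    have hge : d / 2 ≤ Metric.infDist y (frontier D) := by
      by_contra! hlt
      exact hy.2 ⟨hyD, hlt⟩
    have hball : Metric.ball y (d / 2) ⊆ Ω := by
      intro w hw
      refine hf.collar w (ball_subset_of_le_infDist h.isOpen hyD hge hw) ?_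
      have := Metric.infDist_le_infDist_add_dist (s := frontier D) (x := w) (y := y)
      have := Metric.mem_ball.1 hw
      linarith
    have hyΩ := hball (Metric.mem_ball_self (by positivity))
    have hsub : Metric.closedBall y (d / 4) ⊆ Ω :=
      (Metric.closedBall_subset_ball (by linarith)).trans hball
    rw [← (hf.hasDerivAt y hyΩ).deriv]
    have := Complex.norm_deriv_le_of_forall_mem_sphere_norm_le (c := y) (R := d / 4) (C := S)
      (f := f) (by positivity) ?_ ?_
    · refine this.trans ?_
      calc S / (d / 4) = 4 / d * S := by field_simp
        _ ≤ _ := by gcongr; exact le_max_right _ _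
    · refine DifferentiableOn.diffContOnCl fun w hw => ?_
      exact (hf.hasDerivAt w (hsub (Metric.closure_ball_subset_closedBall hw))).differentiableAt.differentiableWithinAt
    · intro w hw
      exact hf.bound w (subset_closure (hsub (Metric.sphere_subset_closedBall hw)))
  · have hyF : y ∈ frontier D :=
      ⟨closure_mono inter_subset_left hy.1, fun h' => hyD (interior_subset h')⟩
    rw [← h.range_eq] at hyF
    obtain ⟨j, rfl⟩ := hyF
    refine (H S Ω f g hf j).trans ?_
    gcongr
    exact le_max_left _ _

/-- A holomorphic function tangent to the walls is controlled, together with its derivative at the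
walls, by its values on the part of the boundary inside of the container. -/
theorem WallData.exists_bound_of_inner_bound (h : WallData D P t K) (hc : IsPreconnected D)
    (hd : 0 < d) {l : ℝ} (hl : 0 < l) :
    ∃ C, 0 < C ∧ ∀ (S : ℝ) (Ω : Set ℂ) (f g : ℂ → ℂ), TangentField D P t d S Ω f g →
      ∀ (G : Set ℂ) (k : ℝ), 0 < k → IsCompact G → IsPreconnected G → G ⊆ D →
        (∀ x ∈ frontier Ω, x ∈ D → x ∈ G) → (∀ z ∈ G, d ≤ Metric.infDist z (frontier D)) →
        (∃ z₀ ∈ G, ∃ z₁ ∈ G, l ≤ ‖z₁ - z₀‖) → (∀ z ∈ G, ‖f z‖ < k) →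
        ∀ j, ‖g (P j)‖ ≤ C * k := by
  have hK := h.pos
  obtain ⟨C₁, hC₁, H₁⟩ := h.exists_norm_deriv_le hd
  obtain ⟨C₂, hC₂, H₂⟩ := h.exists_norm_deriv_le_collar hd
  -- The depth `r` meets three demands: the touching disc lies in `D`, it stays in the collar where
  -- the derivative is bounded by `C₂ * S`, and over the length `r` this changes `f` by at most `S /
  -- 4`.
  set r := min (min (1 / (2 * K)) (d / 8)) (1 / (4 * C₂)) with hr
  have hr0 : 0 < r := by positivity
  have hr1 : r ≤ 1 / (2 * K) := (min_le_left _ _).trans (min_le_left _ _)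
  have hr2 : r ≤ d / 8 := (min_le_left _ _).trans (min_le_right _ _)
  have hr3 : C₂ * r ≤ 1 / 4 := by
    calc C₂ * r ≤ C₂ * (1 / (4 * C₂)) := by gcongr; exact min_le_right _ _
      _ = 1 / 4 := by field_simp
  obtain ⟨κ, hκ, hκ1, H₃⟩ := exists_smallOn_uniform h.isOpen h.bounded hc hd hr0
  set l' := min l (d / 4) with hl'
  have hl'0 : 0 < l' := by positivity
  set a := Real.log (4 / 3) / -Real.log (l' / (4 * Real.exp 2) / d) with ha
  have hq : l' / (4 * Real.exp 2) / d ≤ 1 / 16 := by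
    have hexp2 : 1 ≤ Real.exp 2 := Real.one_le_exp (by norm_num)
    have : l' ≤ d / 4 := min_le_right _ _
    rw [div_le_iff₀ hd, div_le_iff₀ (by positivity)]
    nlinarith
  have hlb : Real.log (4 / 3) ≤ -Real.log (l' / (4 * Real.exp 2) / d) := by
    rw [← Real.log_inv]
    refine Real.log_le_log (by norm_num) ?_
    rw [le_inv_comm₀ (by norm_num) (by positivity)]
    linarith
  have hlog43 : 0 < Real.log (4 / 3) := Real.log_pos (by norm_num)
  have ha0 : 0 < a := div_pos hlog43 (hlog43.trans_le hlb)
  have ha1 : a ≤ 1 := by rw [ha, div_le_one (hlog43.trans_le hlb)]; exact hlb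
  set δ := κ * a with hδ
  have hδ0 : 0 < δ := by positivity
  have hδ1 : δ ≤ 1 := mul_le_one₀ hκ1 ha0.le ha1
  set B : ℝ := (4 / 3) ^ (1 / δ) with hB
  have hB1 : 1 ≤ B := Real.one_le_rpow (by norm_num) (by positivity)
  refine ⟨C₁ * B, by positivity, ?_⟩
  intro S₀ Ω f g hf₀ G k hk hGc hGp hGD hfr hGd hGl hGf j
  -- The wall estimate holds with any bound for `f` in place of the given `S₀`; it remains to find
  -- one comparable to `k`.
  suffices hS : ∃ S, 0 < S ∧ S ≤ B * k ∧ ∀ x ∈ closure Ω, ‖f x‖ ≤ S by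
    obtain ⟨S, hS0, hSk, hS⟩ := hS
    have hf : TangentField D P t d S Ω f g := { hf₀ with bound_pos := hS0, bound := hS }
    refine (H₁ S Ω f g hf j).trans ?_
    rw [mul_assoc]
    gcongr
  have hcomp : IsCompact (closure Ω) := (h.bounded.subset hf₀.subset).isCompact_closure
  have hne : (closure Ω).Nonempty := ⟨P j, hf₀.mem_closure h hd j⟩
  obtain ⟨x₀, hx₀, hmax⟩ := hcomp.exists_isMaxOn hne hf₀.cont_f.norm
  have hmax' : ∀ x ∈ closure Ω, ‖f x‖ ≤ ‖f x₀‖ := fun x hx => hmax hx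
  rcases le_or_gt ‖f x₀‖ k with hcase | hcase
  · refine ⟨k, hk, ?_, fun x hx => (hmax' x hx).trans hcase⟩
    nlinarith
  set S := ‖f x₀‖ with hSdef
  have hS0 : 0 < S := hk.trans hcase
  refine ⟨S, hS0, ?_, hmax'⟩
  have hf : TangentField D P t d S Ω f g := { hf₀ with bound_pos := hS0, bound := hmax' }
  set e := k / S with he
  have he0 : 0 < e := by positivity
  have heS : S * e = k := by rw [he]; field_simp
  have hT : TwoConstants D Ω f S e :=
    { isOpen := hf.isOpen
      subset := hf.subset
      cont := hf.cont_f
      diff := fun x hx => (hf.hasDerivAt x hx).differentiableAt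
      bound_pos := hS0
      pos := he0
      le_one := by rw [he, div_le_one hS0]; exact hcase.le
      bound := hmax'
      inner_bound := fun x hx hxD => by rw [heS]; exact (hGf x (hfr x hx hxD)).le }
  obtain ⟨z₀, hz₀, z₁, hz₁, hzl⟩ := hGl
  obtain ⟨σ, hσ, hnear⟩ := exists_dist_le_imp_norm_le isClosed_closure hf.cont_f hGc hGf
  have hsm := hT.smallOn_of_spread h.bounded (z₀ := z₀) hl'0
    (by have : l' ≤ d / 4 := min_le_right _ _
        linarith : 4 * l' ≤ d) hGd hσ
    (fun w hw z hz hwz => by rw [heS]; exact hnear w hw z hz hwz)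
    (fun r hr hrl => hGp.exists_norm_sub_eq hz₀ hz₁ hr
      (hrl.trans ((min_le_left _ _).trans hzl)))
  have hsmall := H₃ Ω f S e hT a ha0.le ha1 z₀ (hGD hz₀) (hGd z₀ hz₀) hsm
  -- At depth `r` the two-constants theorem gives the fraction `e ^ δ` of the maximum; returning to
  -- the wall costs at most `S / 4`.
  have hwall : ∀ i, ‖f (P i)‖ ≤ S * (e ^ δ + 1 / 4) := by
    intro i
    set c := P i - (r : ℂ) * (Complex.I * t i) with hcdef
    have hball := hf.ball_subset h i hr0 hr1 (by linarith)
    have hballD := h.ball_subset i hr1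
    have hcΩ : c ∈ Ω := hball (Metric.mem_ball_self hr0)
    have hfc : ‖f c‖ ≤ S * e ^ δ := by
      refine hsmall c (subset_closure hcΩ) ?_
      by_contra! hlt
      obtain ⟨y, hyF, hy⟩ := (Metric.infDist_lt_iff ⟨P i, h.mem_frontier i⟩).1 hlt
      rw [dist_comm] at hy
      have hyD := hballD (Metric.mem_ball.2 hy)
      exact (h.isOpen.frontier_eq ▸ hyF).2 hyD
    have hgb : ∀ y ∈ Metric.ball c r, ‖g y‖ ≤ C₂ * S := by
      intro y hy
      refine H₂ S Ω f g hf y (hballD hy) ?_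
      refine (h.infDist_le i y).trans_lt ?_
      have h1 : ‖y - P i‖ ≤ ‖y - c‖ + ‖c - P i‖ := norm_sub_le_norm_sub_add_norm_sub _ _ _
      rw [h.dist_center i hr0.le] at h1
      have := Metric.mem_ball.1 hy
      rw [dist_eq_norm] at this
      linarith
    have hlim : ‖f (P i) - f c‖ ≤ C₂ * S * r := by
      have htend := hf.tendsto_center h hd i
      have hcl := hf.mem_closure h hd i
      have hfl : Tendsto (fun r : ℝ => f (P i - (r : ℂ) * (Complex.I * t i))) (𝓝[>] 0) (𝓝 (f (P i))) :=
        (hf.cont_f (P i) hcl).tendsto.comp (htend.mono_right (nhdsWithin_mono _ subset_closure))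
      refine le_of_tendsto (hfl.sub_const (f c)).norm ?_
      filter_upwards [Ioo_mem_nhdsGT hr0] with s hs
      have hsd : ‖P i - (s : ℂ) * (Complex.I * t i) - c‖ = r - s := by
        have h1 : P i - (s : ℂ) * (Complex.I * t i) - c = ((r - s : ℝ) : ℂ) * (Complex.I * t i) := by
          rw [hcdef, Complex.ofReal_sub]; ring
        rw [h1, norm_mul, h.norm_normal, Complex.norm_real, Real.norm_eq_abs,
          abs_of_pos (by linarith [hs.2]), mul_one]
      refine ((convex_ball c r).norm_image_sub_le_of_norm_hasDerivWithin_le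
        (fun y hy => (hf.hasDerivAt y (hball hy)).hasDerivWithinAt) hgb
        (Metric.mem_ball_self hr0) ?_).trans ?_
      · rw [Metric.mem_ball, dist_eq_norm, hsd]; linarith [hs.1]
      · rw [hsd]
        gcongr
        linarith [hs.1]
    calc ‖f (P i)‖ = ‖f c + (f (P i) - f c)‖ := by congr 1; ring
      _ ≤ ‖f c‖ + ‖f (P i) - f c‖ := norm_add_le _ _
      _ ≤ S * e ^ δ + C₂ * S * r := add_le_add hfc hlim
      _ = S * (e ^ δ + C₂ * r) := by ring
      _ ≤ _ := by gcongr
  have he1 : e ≤ 1 := hT.le_one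
  -- The maximum is controlled by the frontier, where this bound holds throughout. It forces `e ^ δ
  -- ≥ 3 / 4`, which says that `S` is at most `(4 / 3) ^ (1 / δ)` times `k`.
  have hSS : S ≤ S * (e ^ δ + 1 / 4) := by
    refine le_of_forall_frontier_le (g := fun y => ‖f y‖) hf.isOpen (h.bounded.subset hf.subset)
      hf.cont_f.norm (fun y hy => LocallyNormHolo.of_differentiable hf.isOpen hy hT.diff) ?_ hx₀
    intro y hy
    rcases hf.frontier_subset hy with hyF | ⟨hyD, _⟩
    · rw [← h.range_eq] at hyF
      obtain ⟨i, rfl⟩ := hyF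
      exact hwall i
    · refine (hT.inner_bound y hy hyD).trans ?_
      gcongr 1
      have : e ≤ e ^ δ := by
        conv_lhs => rw [← Real.rpow_one e]
        exact Real.rpow_le_rpow_of_exponent_ge he0 he1 hδ1
      linarith
  have h34 : 3 / 4 ≤ e ^ δ := by
    have : 1 ≤ e ^ δ + 1 / 4 := le_of_mul_le_mul_left (by linarith) hS0
    linarith
  have hBe : 1 ≤ B * e := by
    have h1 : (4 / 3 : ℝ) ^ (1 / δ) * (3 / 4) ^ (1 / δ) = 1 := by
      rw [← Real.mul_rpow (by norm_num) (by norm_num)]; norm_num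
    rw [← h1]
    gcongr 1
    calc (3 / 4 : ℝ) ^ (1 / δ) ≤ (e ^ δ) ^ (1 / δ) := by gcongr
      _ = e := by rw [← Real.rpow_mul he0.le, mul_one_div_cancel hδ0.ne', Real.rpow_one]
  calc S = S * 1 := (mul_one S).symm
    _ ≤ S * (B * e) := by gcongr
    _ = B * (S * e) := by ring
    _ = B * k := by rw [heS]

end

/-! ### The plane -/

theorem plane_inner (x y : Plane) : inner ℝ x y = x 0 * y 0 + x 1 * y 1 := by
  rw [PiLp.inner_apply, Fin.sum_univ_two]
  simp [mul_comm]

theorem plane_norm_sq (x : Plane) : ‖x‖ ^ 2 = x 0 ^ 2 + x 1 ^ 2 := by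
  rw [← real_inner_self_eq_norm_sq, plane_inner]; ring

@[simp] theorem perp_zero (x : Plane) : perp x 0 = -(x 1) := rfl

@[simp] theorem perp_one (x : Plane) : perp x 1 = x 0 := rfl

/-- Rotation by a right angle as a linear map. -/
noncomputable def perpL : Plane →L[ℝ] Plane :=
  LinearMap.toContinuousLinearMap
    { toFun := perp
      map_add' := fun x y => by
        ext i; fin_cases i <;> simp [add_comm]
      map_smul' := fun c x => by
        ext i; fin_cases i <;> simp }

theorem norm_perp (x : Plane) : ‖perp x‖ = ‖x‖ := by
  rw [← sq_eq_sq₀ (norm_nonneg _) (norm_nonneg _), plane_norm_sq, plane_norm_sq, perp_zero,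
    perp_one]
  ring

theorem inner_perp_self (x : Plane) : inner ℝ x (perp x) = 0 := by
  rw [plane_inner, perp_zero, perp_one]; ring

theorem inner_perp_left (x y : Plane) : inner ℝ (perp x) y = -inner ℝ x (perp y) := by
  rw [plane_inner, plane_inner, perp_zero, perp_one, perp_zero, perp_one]; ring

theorem eq_of_inner_perp (v : Plane) {τ : Plane} (hτ : ‖τ‖ = 1) :
    v = (inner ℝ v τ : ℝ) • τ + (inner ℝ v (perp τ) : ℝ) • perp τ := by
  have h : τ 0 ^ 2 + τ 1 ^ 2 = 1 := by rw [← plane_norm_sq, hτ]; norm_num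
  rw [plane_inner, plane_inner]
  ext i
  fin_cases i
  · simp; linear_combination (-(v 0)) * h
  · simp; linear_combination (-(v 1)) * h

theorem eq_smul_of_inner_perp_eq_zero {v τ : Plane} (hτ : ‖τ‖ = 1) (h : inner ℝ v (perp τ) = 0) :
    v = (inner ℝ v τ : ℝ) • τ := by
  conv_lhs => rw [eq_of_inner_perp v hτ, h, zero_smul, add_zero]

theorem norm_tangent {z : ℝ → Plane} (h : IsClosedCurve z) (s : ℝ) : ‖tangent z s‖ = 1 := by
  rw [tangent, norm_smul, norm_inv, norm_norm, inv_mul_cancel₀ (norm_ne_zero_iff.2 (h.regular s))]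

theorem norm_normal {z : ℝ → Plane} (h : IsClosedCurve z) (s : ℝ) : ‖normal z s‖ = 1 := by
  rw [normal, norm_perp, norm_tangent h]

theorem deriv_eq_smul_tangent {z : ℝ → Plane} (h : IsClosedCurve z) (s : ℝ) :
    deriv z s = ‖deriv z s‖ • tangent z s := by
  rw [tangent, smul_inv_smul₀ (norm_ne_zero_iff.2 (h.regular s))]

theorem VortexSheet.IsClosedCurve.differentiable {z : ℝ → Plane} (h : IsClosedCurve z) :
    Differentiable ℝ z :=
  h.contDiff.differentiable one_ne_zero

theorem VortexSheet.IsClosedCurve.eq_of_abs_sub_lt {z : ℝ → Plane} (h : IsClosedCurve z) {s s' : ℝ}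
    (hs : |s' - s| < 1) (hz : z s = z s') : s = s' := by
  have h1 : z (Int.fract s) = z (Int.fract s') := by
    rw [Int.fract, Int.fract]
    have h2 := h.periodic.sub_int_mul_eq (x := s) ⌊s⌋
    have h3 := h.periodic.sub_int_mul_eq (x := s') ⌊s'⌋
    rw [mul_one] at h2 h3
    rw [h2, h3, hz]
  have h2 := h.simple ⟨Int.fract_nonneg s, Int.fract_lt_one s⟩
    ⟨Int.fract_nonneg s', Int.fract_lt_one s'⟩ h1
  have h3 : ((⌊s'⌋ - ⌊s⌋ : ℤ) : ℝ) = s' - s := by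
    push_cast
    have := Int.self_sub_floor s
    have := Int.self_sub_floor s'
    linarith
  rw [← h3] at hs
  have h4 : ⌊s'⌋ - ⌊s⌋ = 0 := by
    rw [← Int.abs_lt_one_iff]
    exact_mod_cast hs
  rw [h4, Int.cast_zero] at h3
  linarith

theorem Function.Periodic.exists_abs_sub_le {α : Type*} {f : ℝ → α} (h : Function.Periodic f 1)
    (s s' : ℝ) : ∃ s'' : ℝ, f s'' = f s' ∧ |s'' - s| ≤ 1 / 2 := by
  refine ⟨s' - round (s' - s), ?_, ?_⟩
  · have := h.sub_int_mul_eq (x := s') (round (s' - s))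
    rwa [mul_one] at this
  · have := abs_sub_round (s' - s)
    rwa [show s' - (round (s' - s) : ℝ) - s = s' - s - round (s' - s) by ring]

theorem Function.Periodic.deriv' {E : Type*} [NormedAddCommGroup E] [NormedSpace ℝ E] {f : ℝ → E}
    {c : ℝ} (h : Function.Periodic f c) : Function.Periodic (deriv f) c := by
  intro x
  rw [← deriv_comp_add_const]
  congr 1
  ext y
  exact h y

/-! ### Families of periodic functions -/

section Family

variable {E : Type*} [NormedAddCommGroup E] {J : Set ℝ} {F : ℝ → ℝ → E}

/-- Periodicity moves `s` into `[0, 1)`; its neighbours at distance less than `1` then lie in `[-1,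
2]`, a compact interval. -/
theorem exists_uniform_modulus (hJ : IsCompact J)
    (hF : ContinuousOn (Function.uncurry F) (J ×ˢ univ))
    (hp : ∀ t ∈ J, Function.Periodic (F t) 1) {ε : ℝ} (hε : 0 < ε) :
    ∃ δ > 0, ∀ t ∈ J, ∀ s s', |s' - s| < δ → ‖F t s' - F t s‖ < ε := by
  have hK : IsCompact (J ×ˢ Icc (-1 : ℝ) 2) := hJ.prod isCompact_Icc
  have hu := hK.uniformContinuousOn_of_continuous (hF.mono (prod_mono_right (subset_univ _)))
  rw [Metric.uniformContinuousOn_iff] at hu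
  obtain ⟨δ, hδ, H⟩ := hu ε hε
  refine ⟨min δ 1, by positivity, ?_⟩
  intro t ht s s' hss'
  obtain ⟨h1, h2⟩ := lt_min_iff.1 hss'
  rw [abs_lt] at h2
  have hp1 := (hp t ht).sub_int_mul_eq (x := s) ⌊s⌋
  have hp2 := (hp t ht).sub_int_mul_eq (x := s') ⌊s⌋
  rw [mul_one] at hp1 hp2
  rw [← hp1, ← hp2, ← dist_eq_norm]
  have ha := Int.floor_le s
  have hb := Int.lt_floor_add_one s
  refine H (t, s' - ⌊s⌋) ⟨ht, ?_, ?_⟩ (t, s - ⌊s⌋) ⟨ht, ?_, ?_⟩ ?_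
  any_goals simp only; linarith
  rw [Prod.dist_eq, dist_self, Real.dist_eq, sub_sub_sub_cancel_right]
  exact max_lt hδ h1

theorem exists_uniform_bound (hJ : IsCompact J)
    (hF : ContinuousOn (Function.uncurry F) (J ×ˢ univ))
    (hp : ∀ t ∈ J, Function.Periodic (F t) 1) :
    ∃ B > 0, ∀ t ∈ J, ∀ s, ‖F t s‖ ≤ B := by
  have hK : IsCompact (J ×ˢ Icc (0 : ℝ) 1) := hJ.prod isCompact_Icc
  obtain ⟨B, hB⟩ := hK.exists_bound_of_continuousOn (hF.mono (prod_mono_right (subset_univ _)))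
  refine ⟨max B 1, by positivity, fun t ht s => ?_⟩
  have hp1 := (hp t ht).sub_int_mul_eq (x := s) ⌊s⌋
  rw [mul_one] at hp1
  rw [← hp1]
  refine (hB (t, s - ⌊s⌋) ⟨ht, Int.fract_nonneg s, (Int.fract_lt_one s).le⟩).trans (le_max_left _ _)

theorem exists_uniform_lower_bound (hJ : IsCompact J)
    (hF : ContinuousOn (Function.uncurry F) (J ×ˢ univ))
    (hp : ∀ t ∈ J, Function.Periodic (F t) 1) (h0 : ∀ t ∈ J, ∀ s, F t s ≠ 0) :
    ∃ b > 0, ∀ t ∈ J, ∀ s, b ≤ ‖F t s‖ := by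
  have hK : IsCompact (J ×ˢ Icc (0 : ℝ) 1) := hJ.prod isCompact_Icc
  have hc := hF.norm.mono (prod_mono_right (s := J) (subset_univ (Icc (0 : ℝ) 1)))
  obtain ⟨b, hb, H⟩ := hK.exists_forall_le' hc (a := 0)
    (fun q hq => norm_pos_iff.2 (h0 q.1 hq.1 q.2))
  refine ⟨b, hb, fun t ht s => ?_⟩
  have hp1 := (hp t ht).sub_int_mul_eq (x := s) ⌊s⌋
  rw [mul_one] at hp1
  rw [← hp1]
  exact H (t, s - ⌊s⌋) ⟨ht, Int.fract_nonneg s, (Int.fract_lt_one s).le⟩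

end Family

/-- The derivative of `g` being close to `g' s` gives a first order expansion. -/
theorem norm_sub_sub_smul_le {E : Type*} [NormedAddCommGroup E] [NormedSpace ℝ E] {g g' : ℝ → E}
    (hg : ∀ s, HasDerivAt g (g' s) s) {s s' c : ℝ}
    (h : ∀ σ, |σ - s| ≤ |s' - s| → ‖g' σ - g' s‖ ≤ c) :
    ‖g s' - g s - (s' - s) • g' s‖ ≤ c * |s' - s| := by
  have hd : ∀ σ ∈ uIcc s s', HasDerivWithinAt (fun σ => g σ - σ • g' s) (g' σ - g' s) (uIcc s s') σ := by
    intro σ _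
    simpa using ((hg σ).fun_sub ((hasDerivAt_id σ).smul_const (g' s))).hasDerivWithinAt
  have hb : ∀ σ ∈ uIcc s s', ‖g' σ - g' s‖ ≤ c := fun σ hσ => h σ (by
    rw [abs_sub_comm s' s]
    have := abs_sub_left_of_mem_uIcc hσ
    rwa [abs_sub_comm s s'])
  have := (convex_uIcc s s').norm_image_sub_le_of_norm_hasDerivWithin_le hd hb
    left_mem_uIcc right_mem_uIcc
  rw [Real.norm_eq_abs] at this
  convert! this using 2
  rw [sub_smul]
  abel

/-! ### Compact families of closed curves -/

section Curves

variable {J : Set ℝ} {z : ℝ → ℝ → Plane}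

/-- A continuous family of closed curves over the compact set `J`. -/
structure CurveFamily (J : Set ℝ) (z : ℝ → ℝ → Plane) : Prop where
  isCompact : IsCompact J
  curve : ∀ t ∈ J, IsClosedCurve (z t)
  cont : ContinuousOn (Function.uncurry z) (J ×ˢ univ)
  cont_deriv : ContinuousOn (Function.uncurry fun t => deriv (z t)) (J ×ˢ univ)

theorem CurveFamily.hasDerivAt (h : CurveFamily J z) {t : ℝ} (ht : t ∈ J) (s : ℝ) :
    HasDerivAt (z t) (deriv (z t) s) s :=
  ((h.curve t ht).differentiable s).hasDerivAt

theorem CurveFamily.exists_expansion (h : CurveFamily J z) {ε : ℝ} (hε : 0 < ε) :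
    ∃ δ > 0, ∀ t ∈ J, ∀ s s', |s' - s| < δ →
      ‖z t s' - z t s - (s' - s) • deriv (z t) s‖ ≤ ε * |s' - s| := by
  obtain ⟨δ, hδ, H⟩ := exists_uniform_modulus h.isCompact h.cont_deriv
    (fun t ht => (h.curve t ht).periodic.deriv') hε
  refine ⟨δ, hδ, fun t ht s s' hs => ?_⟩
  exact norm_sub_sub_smul_le (h.hasDerivAt ht) fun σ hσ => (H t ht s σ (hσ.trans_lt hs)).le

theorem CurveFamily.exists_speed_bounds (h : CurveFamily J z) :
    ∃ b > 0, ∃ B > 0, ∀ t ∈ J, ∀ s, b ≤ ‖deriv (z t) s‖ ∧ ‖deriv (z t) s‖ ≤ B := by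
  obtain ⟨b, hb, H⟩ := exists_uniform_lower_bound h.isCompact h.cont_deriv
    (fun t ht => (h.curve t ht).periodic.deriv') fun t ht s => (h.curve t ht).regular s
  obtain ⟨B, hB, H'⟩ := exists_uniform_bound h.isCompact h.cont_deriv
    (fun t ht => (h.curve t ht).periodic.deriv')
  exact ⟨b, hb, B, hB, fun t ht s => ⟨H t ht s, H' t ht s⟩⟩

/-- Near the diagonal the first-order expansion with half the minimal speed suffices; away from it
injectivity and compactness do. The condition `|s' - s| ≤ 1 / 2` selects the nearest parameter
modulo the period. -/
theorem CurveFamily.exists_chord_arc (h : CurveFamily J z) :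
    ∃ k > 0, ∀ t ∈ J, ∀ s s', |s' - s| ≤ 1 / 2 → k * |s' - s| ≤ ‖z t s' - z t s‖ := by
  obtain ⟨b, hb, B, hB, hbB⟩ := h.exists_speed_bounds
  obtain ⟨δ, hδ, hexp⟩ := h.exists_expansion (half_pos hb)
  have hK : IsCompact (J ×ˢ (Icc (0 : ℝ) 1 ×ˢ {r : ℝ | δ ≤ |r| ∧ |r| ≤ 1 / 2})) := by
    refine h.isCompact.prod (isCompact_Icc.prod ?_)
    refine Metric.isCompact_of_isClosed_isBounded ?_ ?_
    · exact (isClosed_le continuous_const continuous_abs).and (isClosed_le continuous_abs continuous_const)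
    · refine (Metric.isBounded_closedBall (x := (0 : ℝ)) (r := 1 / 2)).subset ?_
      intro r hr
      rw [Metric.mem_closedBall, Real.dist_eq, sub_zero]
      exact hr.2
  have hcont : ContinuousOn (fun q : ℝ × ℝ × ℝ => ‖z q.1 (q.2.1 + q.2.2) - z q.1 q.2.1‖)
      (J ×ˢ (Icc (0 : ℝ) 1 ×ˢ {r : ℝ | δ ≤ |r| ∧ |r| ≤ 1 / 2})) := by
    refine ContinuousOn.norm (ContinuousOn.sub ?_ ?_)
    · exact h.cont.comp (f := fun q : ℝ × ℝ × ℝ => (q.1, q.2.1 + q.2.2)) (by fun_prop)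
        fun q hq => ⟨hq.1, mem_univ _⟩
    · exact h.cont.comp (f := fun q : ℝ × ℝ × ℝ => (q.1, q.2.1)) (by fun_prop)
        fun q hq => ⟨hq.1, mem_univ _⟩
  obtain ⟨c, hc, H⟩ := hK.exists_forall_le' hcont (a := 0) (by
    rintro ⟨t, s, r⟩ ⟨ht, _, hr⟩
    have hr1 : δ ≤ |r| := hr.1
    have hr2 : |r| ≤ 1 / 2 := hr.2
    refine norm_pos_iff.2 fun h0 => ?_
    have h1 := (h.curve t ht).eq_of_abs_sub_lt (s := s) (s' := s + r)
      (by rw [add_sub_cancel_left]; linarith) (sub_eq_zero.1 h0).symm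
    have : r = 0 := by linarith
    rw [this, abs_zero] at hr1
    linarith)
  refine ⟨min (b / 2) (2 * c), by positivity, fun t ht s s' hs => ?_⟩
  rcases lt_or_ge |s' - s| δ with hlt | hge
  · have h1 := hexp t ht s s' hlt
    have h2 : ‖(s' - s) • deriv (z t) s‖ ≤ ‖z t s' - z t s‖ + b / 2 * |s' - s| := by
      calc ‖(s' - s) • deriv (z t) s‖
          = ‖(z t s' - z t s) - (z t s' - z t s - (s' - s) • deriv (z t) s)‖ := by congr 1; abel
        _ ≤ _ := (norm_sub_le _ _).trans (by gcongr)
    rw [norm_smul, Real.norm_eq_abs] at h2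
    have h3 := (hbB t ht s).1
    calc min (b / 2) (2 * c) * |s' - s| ≤ b / 2 * |s' - s| := by gcongr; exact min_le_left _ _
      _ = |s' - s| * b - b / 2 * |s' - s| := by ring
      _ ≤ |s' - s| * ‖deriv (z t) s‖ - b / 2 * |s' - s| := by gcongr
      _ ≤ _ := by linarith
  · have h1 : c ≤ ‖z t (Int.fract s + (s' - s)) - z t (Int.fract s)‖ := H (t, Int.fract s, s' - s)
      ⟨ht, ⟨Int.fract_nonneg s, (Int.fract_lt_one s).le⟩, hge, hs⟩
    have hp1 := (h.curve t ht).periodic.sub_int_mul_eq (x := s) ⌊s⌋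
    have hp2 := (h.curve t ht).periodic.sub_int_mul_eq (x := s') ⌊s⌋
    rw [mul_one] at hp1 hp2
    have h2 : Int.fract s + (s' - s) = s' - ⌊s⌋ := by rw [Int.fract]; ring
    have h3 : Int.fract s = s - ⌊s⌋ := rfl
    rw [h2, hp2, h3, hp1] at h1
    calc min (b / 2) (2 * c) * |s' - s| ≤ 2 * c * (1 / 2) := by
          gcongr
          exact min_le_right _ _
      _ = c := by ring
      _ ≤ _ := h1

/-- If the tangent is Lipschitz, the curve has uniform tangent discs. -/
theorem CurveFamily.exists_normal_bound (h : CurveFamily J z) {L : ℝ} (hL : 0 ≤ L)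
    (hlip : ∀ t ∈ J, ∀ s s', ‖tangent (z t) s' - tangent (z t) s‖ ≤ L * |s' - s|) :
    ∃ C > 0, ∀ t ∈ J, ∀ s s',
      |inner ℝ (z t s' - z t s) (normal (z t) s)| ≤ C * ‖z t s' - z t s‖ ^ 2 := by
  obtain ⟨b, hb, B, hB, hbB⟩ := h.exists_speed_bounds
  obtain ⟨k, hk, hchord⟩ := h.exists_chord_arc
  refine ⟨B * L / k ^ 2 + 1, by positivity, fun t ht s s'' => ?_⟩
  have hcv := h.curve t ht
  obtain ⟨s', hs', hs⟩ := hcv.periodic.exists_abs_sub_le s s''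
  rw [← hs']
  have hder : ∀ σ, HasDerivAt (fun σ => inner ℝ (z t σ) (normal (z t) s))
      (inner ℝ (deriv (z t) σ) (normal (z t) s)) σ := fun σ => by
    simpa using (h.hasDerivAt ht σ).inner ℝ (hasDerivAt_const σ (normal (z t) s))
  -- The tangent at `s` is orthogonal to the normal, so only the variation of the tangent
  -- contributes; this gives the second factor `|s' - s|`.
  have h0 : ∀ σ, inner ℝ (deriv (z t) σ) (normal (z t) s) =
      ‖deriv (z t) σ‖ * inner ℝ (tangent (z t) σ - tangent (z t) s) (normal (z t) s) := by
    intro σ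
    rw [inner_sub_left, normal, inner_perp_self, sub_zero]
    conv_lhs => rw [deriv_eq_smul_tangent hcv σ]
    rw [inner_smul_left]
    rfl
  have h1 := norm_sub_sub_smul_le (s := s) (s' := s') (c := B * (L * |s' - s|)) hder (by
    intro σ hσ
    rw [h0 s, sub_self, inner_zero_left, mul_zero, sub_zero, h0 σ, norm_mul, norm_norm]
    refine mul_le_mul (hbB t ht σ).2 ?_ (norm_nonneg _) hB.le
    refine (norm_inner_le_norm _ _).trans ?_
    rw [norm_normal hcv, mul_one]
    refine (hlip t ht s σ).trans ?_
    gcongr)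
  rw [h0 s, sub_self, inner_zero_left, mul_zero, smul_zero, sub_zero, ← inner_sub_left,
    Real.norm_eq_abs] at h1
  refine h1.trans ?_
  have h2 := hchord t ht s s' hs
  have h3 : |s' - s| ≤ ‖z t s' - z t s‖ / k := by rw [le_div_iff₀ hk]; linarith
  calc B * (L * |s' - s|) * |s' - s| = B * L * |s' - s| ^ 2 := by ring
    _ ≤ B * L * (‖z t s' - z t s‖ / k) ^ 2 := by gcongr
    _ = B * L / k ^ 2 * ‖z t s' - z t s‖ ^ 2 := by rw [div_pow]; ring
    _ ≤ _ := by gcongr; linarith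

end Curves

/-! ### The walls -/

/-- A point `w` of `F` in the ball would satisfy `‖w - p‖ ^ 2 < 2 c ⟪w - p, n⟫ ≤ 2 |c| K ‖w - p‖ ^
2`, which the size of `c` excludes. -/
theorem disjoint_ball_of_normal_bound {E : Type*} [NormedAddCommGroup E] [InnerProductSpace ℝ E]
    {F : Set E} {p n : E} (hn : ‖n‖ = 1) {K c : ℝ} (hc : |c| * (2 * K) ≤ 1)
    (hF : ∀ w ∈ F, |inner ℝ (w - p) n| ≤ K * ‖w - p‖ ^ 2) :
    Disjoint (Metric.ball (p + c • n) |c|) F := by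
  rw [Set.disjoint_left]
  intro w hw hwF
  rw [Metric.mem_ball, dist_eq_norm] at hw
  have h1 : ‖w - (p + c • n)‖ ^ 2 < |c| ^ 2 := by gcongr
  rw [show w - (p + c • n) = (w - p) - c • n by abel, norm_sub_sq_real (w - p), inner_smul_right,
    norm_smul, hn, Real.norm_eq_abs, mul_one] at h1
  have h2 : c * inner ℝ (w - p) n ≤ |c| * (K * ‖w - p‖ ^ 2) := by
    refine (le_abs_self _).trans ?_
    rw [abs_mul]
    gcongr
    exact hF w hwF
  nlinarith [sq_nonneg ‖w - p‖]

theorem contDiff_tangent {z : ℝ → Plane} (h : IsClosedCurve z) {n : ℕ}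
    (hz : ContDiff ℝ (n + 1) z) : ContDiff ℝ n (tangent z) := by
  have h1 : ContDiff ℝ n (deriv z) := ((contDiff_succ_iff_deriv).1 hz).2.2
  exact ((h1.norm ℝ h.regular).inv fun s => norm_ne_zero_iff.2 (h.regular s)).smul h1

theorem periodic_tangent {z : ℝ → Plane} (h : IsClosedCurve z) : Function.Periodic (tangent z) 1 := by
  intro s
  rw [tangent, tangent, h.periodic.deriv' s]

theorem Function.Periodic.exists_lipschitz {E : Type*} [NormedAddCommGroup E] [NormedSpace ℝ E]
    {f : ℝ → E} (hp : Function.Periodic f 1) (hf : ContDiff ℝ 1 f) :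
    ∃ L > 0, ∀ s s', ‖f s' - f s‖ ≤ L * |s' - s| := by
  obtain ⟨L, hL, H⟩ := exists_uniform_bound (J := {(0 : ℝ)}) (F := fun _ => deriv f)
    isCompact_singleton
    (((hf.continuous_deriv le_rfl).comp continuous_snd).continuousOn) fun _ _ => hp.deriv'
  refine ⟨L, hL, fun s s' => ?_⟩
  have := convex_univ.norm_image_sub_le_of_norm_deriv_le (𝕜 := ℝ) (f := f) (C := L) (x := s) (y := s')
    (fun x _ => hf.differentiable one_ne_zero x) (fun x _ => H 0 rfl x) (mem_univ _) (mem_univ _)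
  rwa [Real.norm_eq_abs] at this

theorem curveFamily_const {z : ℝ → Plane} (h : IsClosedCurve z) :
    CurveFamily {(0 : ℝ)} fun _ => z where
  isCompact := isCompact_singleton
  curve := fun _ _ => h
  cont := (h.contDiff.continuous.comp continuous_snd).continuousOn
  cont_deriv := ((h.contDiff.continuous_deriv le_rfl).comp continuous_snd).continuousOn

theorem exists_normal_bound {z : ℝ → Plane} (h : IsClosedCurve z) (hz : ContDiff ℝ 2 z) :
    ∃ C > 0, ∀ s s', |inner ℝ (z s' - z s) (normal z s)| ≤ C * ‖z s' - z s‖ ^ 2 := by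
  obtain ⟨L, hL, H⟩ := (periodic_tangent h).exists_lipschitz
    (contDiff_tangent (n := 1) h (by exact_mod_cast hz))
  obtain ⟨C, hC, H'⟩ := (curveFamily_const h).exists_normal_bound hL.le fun _ _ => H
  exact ⟨C, hC, H' 0 rfl⟩

/-- The isometry between the Euclidean plane and the complex plane. -/
noncomputable def toComplex : Plane ≃ₗᵢ[ℝ] ℂ := Complex.orthonormalBasisOneI.repr.symm

theorem toComplex_apply (x : Plane) : toComplex x = x 0 + x 1 * Complex.I := by
  rw [toComplex, Complex.orthonormalBasisOneI_repr_symm_apply]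

theorem toComplex_perp (x : Plane) : toComplex (perp x) = Complex.I * toComplex x := by
  rw [toComplex_apply, toComplex_apply, perp_zero, perp_one]
  push_cast
  linear_combination (-(x 1 : ℂ)) * Complex.I_mul_I

/-- In complex notation `z'(s') ≈ z' + (s' - s) z''` and `s' - s ≈ (z(s') - z(s)) / z'`, whence `κ =
z'' / (z' |z'|)` and `l = |z'(s')| / |z'(s)|`. Being affine in the complex position, the model
extends holomorphically off the curve. The third derivative pays for the quadratic error. -/
theorem exists_tangent_expansion {z : ℝ → Plane} (h : IsClosedCurve z) (hz : ContDiff ℝ 3 z) :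
    ∃ K > 0, ∀ s, ∃ κ : ℂ, ‖κ‖ ≤ K ∧ ∀ s', ∃ l : ℝ,
      ‖toComplex (tangent z s) + κ * (toComplex (z s') - toComplex (z s))
        - l * toComplex (tangent z s')‖ ≤ K * ‖z s' - z s‖ ^ 2 := by
  obtain ⟨b, hb, B, hB, hbB⟩ := (curveFamily_const h).exists_speed_bounds
  obtain ⟨k, hk, hchord⟩ := (curveFamily_const h).exists_chord_arc
  replace hbB := hbB 0 rfl
  replace hchord := hchord 0 rfl
  have hz1 : ContDiff ℝ 2 (deriv z) := ((contDiff_succ_iff_deriv (n := 2)).1 (by exact_mod_cast hz)).2.2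
  have hz2 : ContDiff ℝ 1 (deriv (deriv z)) :=
    ((contDiff_succ_iff_deriv (n := 1)).1 (by exact_mod_cast hz1)).2.2
  have hd1 : ∀ s, HasDerivAt z (deriv z s) s := fun s => (h.differentiable s).hasDerivAt
  have hd2 : ∀ s, HasDerivAt (deriv z) (deriv (deriv z) s) s := fun s =>
    (hz1.differentiable two_ne_zero s).hasDerivAt
  have hp1 := h.periodic.deriv'
  have hp2 := hp1.deriv'
  obtain ⟨L₁, hL₁, HL₁⟩ := hp1.exists_lipschitz (hz1.of_le one_le_two)
  obtain ⟨L₂, hL₂, HL₂⟩ := hp2.exists_lipschitz hz2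
  obtain ⟨B₂, hB₂, HB₂⟩ := exists_uniform_bound (J := {(0 : ℝ)}) (F := fun _ => deriv (deriv z))
    isCompact_singleton ((hz2.continuous.comp continuous_snd).continuousOn) fun _ _ => hp2
  replace HB₂ := HB₂ 0 rfl
  refine ⟨B₂ / b ^ 2 + (B₂ / b * L₁ + L₂) / b / k ^ 2, by positivity, fun s => ?_⟩
  set τ := toComplex (deriv z s) with hτ
  set q := ‖deriv z s‖ with hq
  have hq0 : 0 < q := hb.trans_le (hbB s).1
  have hqC : (q : ℂ) ≠ 0 := by exact_mod_cast hq0.ne'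
  have hτn : ‖τ‖ = q := by rw [hτ, LinearIsometryEquiv.norm_map]
  have hτ0 : τ ≠ 0 := norm_pos_iff.1 (hτn ▸ hq0)
  have htan : ∀ s, toComplex (tangent z s) = (‖deriv z s‖ : ℂ)⁻¹ * toComplex (deriv z s) := by
    intro s
    rw [tangent, map_smul, Complex.real_smul, Complex.ofReal_inv]
  have hcomm : ∀ x : Plane, ∀ c : ℝ, toComplex (c • x) = c * toComplex x := fun x c => by
    rw [map_smul, Complex.real_smul]
  refine ⟨toComplex (deriv (deriv z) s) / (τ * q), ?_, fun s'' => ?_⟩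
  · rw [norm_div, norm_mul, LinearIsometryEquiv.norm_map, hτn, Complex.norm_real, Real.norm_eq_abs,
      abs_of_pos hq0]
    have h1 : ‖deriv (deriv z) s‖ / (q * q) ≤ B₂ / b ^ 2 := by
      rw [← sq]
      gcongr
      · exact HB₂ s
      · exact (hbB s).1
    have h2 : 0 ≤ (B₂ / b * L₁ + L₂) / b / k ^ 2 := by positivity
    linarith
  obtain ⟨s', hs', hss'⟩ := h.periodic.exists_abs_sub_le s s''
  have hs2 : deriv z s' = deriv z s'' := by
    obtain ⟨m, hm⟩ : ∃ m : ℤ, s' = s'' - m * 1 := by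
      have hf : Int.fract s' = Int.fract s'' := by
        refine h.simple ⟨Int.fract_nonneg _, Int.fract_lt_one _⟩
          ⟨Int.fract_nonneg _, Int.fract_lt_one _⟩ ?_
        have h2 := h.periodic.sub_int_mul_eq (x := s') ⌊s'⌋
        have h3 := h.periodic.sub_int_mul_eq (x := s'') ⌊s''⌋
        rw [mul_one] at h2 h3
        rw [Int.fract, Int.fract, h2, h3, hs']
      obtain ⟨m, hm⟩ := Int.fract_eq_fract.1 hf
      exact ⟨-m, by push_cast; linarith⟩
    rw [hm]
    exact hp1.sub_int_mul_eq m
  refine ⟨‖deriv z s''‖ / q, ?_⟩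
  rw [htan, htan, ← hs', ← hs2]
  have hr0 : (‖deriv z s'‖ : ℂ) ≠ 0 := by exact_mod_cast (hb.trans_le (hbB s').1).ne'
  set e₁ := z s' - z s - (s' - s) • deriv z s with he₁
  set e₂ := deriv z s' - deriv z s - (s' - s) • deriv (deriv z) s with he₂
  have hn₁ : ‖e₁‖ ≤ L₁ * |s' - s| * |s' - s| :=
    norm_sub_sub_smul_le hd1 fun σ hσ => (HL₁ s σ).trans (by gcongr)
  have hn₂ : ‖e₂‖ ≤ L₂ * |s' - s| * |s' - s| :=
    norm_sub_sub_smul_le hd2 fun σ hσ => (HL₂ s σ).trans (by gcongr)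
  have hexpr : (q : ℂ)⁻¹ * τ + toComplex (deriv (deriv z) s) / (τ * q) *
        (toComplex (z s') - toComplex (z s))
      - ((‖deriv z s'‖ / q : ℝ) : ℂ) * ((‖deriv z s'‖ : ℂ)⁻¹ * toComplex (deriv z s'))
      = (q : ℂ)⁻¹ * (toComplex (deriv (deriv z) s) / τ * toComplex e₁ - toComplex e₂) := by
    rw [he₁, he₂]
    simp only [map_sub, hcomm]
    rw [← hτ]
    push_cast
    field_simp
    ring
  rw [hexpr, norm_mul, norm_inv, Complex.norm_real, Real.norm_eq_abs, abs_of_pos hq0]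
  have h1 : ‖toComplex (deriv (deriv z) s) / τ * toComplex e₁ - toComplex e₂‖ ≤
      (B₂ / b * L₁ + L₂) * |s' - s| ^ 2 := by
    refine (norm_sub_le _ _).trans ?_
    rw [norm_mul, norm_div, hτn]
    simp only [LinearIsometryEquiv.norm_map]
    calc ‖deriv (deriv z) s‖ / q * ‖e₁‖ + ‖e₂‖
        ≤ B₂ / b * (L₁ * |s' - s| * |s' - s|) + L₂ * |s' - s| * |s' - s| := by
          gcongr
          · exact HB₂ s
          · exact (hbB s).1
      _ = _ := by ring
  have h2 := hchord s s' hss'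
  have h3 : |s' - s| ≤ ‖z s' - z s‖ / k := by rw [le_div_iff₀ hk]; linarith
  calc q⁻¹ * ‖toComplex (deriv (deriv z) s) / τ * toComplex e₁ - toComplex e₂‖
      ≤ b⁻¹ * ((B₂ / b * L₁ + L₂) * (‖z s' - z s‖ / k) ^ 2) := by
        gcongr
        · exact (hbB s).1
        · refine h1.trans ?_
          gcongr
    _ = (B₂ / b * L₁ + L₂) / b / k ^ 2 * ‖z s' - z s‖ ^ 2 := by rw [div_pow]; field_simp
    _ ≤ _ := by
        gcongr
        have : 0 ≤ B₂ / b ^ 2 := by positivity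
        linarith

theorem VortexSheet.IsClosedCurve.isCompact_range {z : ℝ → Plane} (h : IsClosedCurve z) :
    IsCompact (range z) :=
  h.periodic.compact_of_continuous one_ne_zero h.contDiff.continuous

theorem VortexSheet.H4Domain.exists_wall_separation (D : H4Domain) (i : Fin D.numWalls) :
    ∃ ρ > 0, ∀ s, ∀ w ∈ frontier D.carrier, w ∉ range (D.wall i) → ρ ≤ ‖w - D.wall i s‖ := by
  have h1 : IsCompact (⋃ j ∈ {j | j ≠ i}, range (D.wall j)) :=
    (toFinite _).isCompact_biUnion fun j _ => (D.wall_curve j).isCompact_range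
  have hdisj : Disjoint (range (D.wall i)) (⋃ j ∈ {j | j ≠ i}, range (D.wall j)) := by
    rw [disjoint_iUnion₂_right]
    intro j hj
    exact D.wall_disjoint (Ne.symm hj)
  obtain ⟨ρ, hρ, H⟩ := hdisj.exists_thickenings (D.wall_curve i).isCompact_range
    h1.isClosed
  refine ⟨ρ, hρ, fun s w hw hwi => ?_⟩
  by_contra! hlt
  rw [D.frontier_eq, mem_iUnion] at hw
  obtain ⟨j, hj⟩ := hw
  have hji : j ≠ i := by rintro rfl; exact hwi hj
  refine absurd ?_ (Set.disjoint_left.1 H (?_ : w ∈ _))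
  · exact Metric.self_subset_thickening hρ _ (mem_biUnion hji hj)
  · exact Metric.mem_thickening_iff.2 ⟨D.wall i s, mem_range_self s, by rwa [dist_eq_norm]⟩

/-- On the same wall these are the curve estimates. Other walls stay at distance at least `ρ`, where
any bounded quantity is quadratic; there `l = 0` will do. -/
theorem VortexSheet.H4Domain.exists_wall_bounds (D : H4Domain) (i : Fin D.numWalls) :
    ∃ K > 0, ∀ s, (∀ w ∈ frontier D.carrier,
        |inner ℝ (w - D.wall i s) (normal (D.wall i) s)| ≤ K * ‖w - D.wall i s‖ ^ 2) ∧
      ∃ κ : ℂ, ‖κ‖ ≤ K ∧ ∀ j s', ∃ l : ℝ,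
        ‖toComplex (tangent (D.wall i) s) + κ * (toComplex (D.wall j s') - toComplex (D.wall i s))
          - l * toComplex (tangent (D.wall j) s')‖ ≤ K * ‖D.wall j s' - D.wall i s‖ ^ 2 := by
  have hcv := D.wall_curve i
  have h3 : ContDiff ℝ 3 (D.wall i) := (D.wall_class i).1
  obtain ⟨ρ, hρ, Hρ⟩ := D.exists_wall_separation i
  obtain ⟨C, hC, HC⟩ := exists_normal_bound hcv (h3.of_le (by norm_num))
  obtain ⟨K, hK, HK⟩ := exists_tangent_expansion hcv h3
  obtain ⟨Λ, hΛ⟩ := D.isBounded.closure.exists_norm_le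
  have hmem : ∀ j s, D.wall j s ∈ closure D.carrier := fun j s => by
    refine frontier_subset_closure ?_
    rw [D.frontier_eq]
    exact mem_iUnion.2 ⟨j, mem_range_self s⟩
  have hΛ0 : 0 ≤ Λ := (norm_nonneg _).trans (hΛ _ (hmem i 0))
  have hfar : ∀ x : ℝ, ρ ≤ x → ∀ a, 0 ≤ a → a ≤ a / ρ ^ 2 * x ^ 2 := by
    intro x hx a ha
    rw [div_mul_eq_mul_div, le_div_iff₀ (by positivity)]
    gcongr
  refine ⟨C + 1 / ρ + K + (1 + K * (2 * Λ)) / ρ ^ 2, by positivity, fun s => ⟨fun w hw => ?_, ?_⟩⟩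
  · by_cases hwi : w ∈ range (D.wall i)
    · obtain ⟨s', rfl⟩ := hwi
      refine (HC s s').trans ?_
      gcongr
      have : 0 ≤ 1 / ρ + K + (1 + K * (2 * Λ)) / ρ ^ 2 := by positivity
      linarith
    · have h1 := Hρ s w hw hwi
      calc |inner ℝ (w - D.wall i s) (normal (D.wall i) s)| ≤ ‖w - D.wall i s‖ := by
            refine (abs_real_inner_le_norm _ _).trans ?_
            rw [norm_normal hcv, mul_one]
        _ ≤ 1 / ρ * ‖w - D.wall i s‖ ^ 2 := by
            rw [one_div, inv_mul_eq_div, le_div_iff₀ hρ, sq]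
            gcongr
        _ ≤ _ := by
            gcongr
            have : 0 ≤ C + K + (1 + K * (2 * Λ)) / ρ ^ 2 := by positivity
            linarith
  · obtain ⟨κ, hκ, Hκ⟩ := HK s
    refine ⟨κ, ?_, fun j s' => ?_⟩
    · have : 0 ≤ C + 1 / ρ + (1 + K * (2 * Λ)) / ρ ^ 2 := by positivity
      linarith
    · by_cases hji : j = i
      · subst hji
        obtain ⟨l, hl⟩ := Hκ s'
        refine ⟨l, hl.trans ?_⟩
        gcongr
        have : 0 ≤ C + 1 / ρ + (1 + K * (2 * Λ)) / ρ ^ 2 := by positivity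
        linarith
      · have h1 : ρ ≤ ‖D.wall j s' - D.wall i s‖ := by
          refine Hρ s _ ?_ ?_
          · rw [D.frontier_eq]
            exact mem_iUnion.2 ⟨j, mem_range_self s'⟩
          · intro hmem'
            exact (D.wall_disjoint hji).le_bot ⟨mem_range_self s', hmem'⟩
        refine ⟨0, ?_⟩
        rw [Complex.ofReal_zero, zero_mul, sub_zero]
        refine (norm_add_le _ _).trans ?_
        rw [LinearIsometryEquiv.norm_map, norm_tangent hcv, norm_mul, ← map_sub,
          LinearIsometryEquiv.norm_map]
        calc 1 + ‖κ‖ * ‖D.wall j s' - D.wall i s‖ ≤ 1 + K * (2 * Λ) := by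
              gcongr
              refine (norm_sub_le _ _).trans ?_
              have := hΛ _ (hmem j s')
              have := hΛ _ (hmem i s)
              linarith
          _ ≤ (1 + K * (2 * Λ)) / ρ ^ 2 * ‖D.wall j s' - D.wall i s‖ ^ 2 :=
              hfar _ h1 _ (by positivity)
          _ ≤ _ := by
              gcongr
              have : 0 ≤ C + 1 / ρ + K := by positivity
              linarith

theorem toComplex_image_frontier (s : Set Plane) :
    frontier (toComplex '' s) = toComplex '' frontier s :=
  (toComplex.toHomeomorph.image_frontier s).symm

theorem toComplex_image_closure (s : Set Plane) :
    closure (toComplex '' s) = toComplex '' closure s :=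
  (toComplex.toHomeomorph.image_closure s).symm

/-- Both touching discs of radius `1 / (2K)` miss the frontier, so connectedness puts each of them
entirely inside or entirely outside of the domain. The points near the wall supplied by
`wall_outward` decide which. -/
theorem VortexSheet.H4Domain.exists_wallData (D : H4Domain) :
    ∃ K, WallData (toComplex '' D.carrier)
      (fun q : Fin D.numWalls × ℝ => toComplex (D.wall q.1 q.2))
      (fun q => toComplex (tangent (D.wall q.1) q.2)) K := by
  choose K' hK' H' using D.exists_wall_bounds
  set K := 1 + ∑ i, K' i with hK
  have hsum : 0 ≤ ∑ i, K' i := Finset.sum_nonneg fun i _ => (hK' i).le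
  have hle : ∀ i, K' i ≤ K := fun i => by
    have := Finset.single_le_sum (f := K') (fun i _ => (hK' i).le) (Finset.mem_univ i)
    linarith
  have hK0 : 0 < K := by linarith
  have hN : ∀ i s, ∀ w ∈ frontier D.carrier,
      |inner ℝ (w - D.wall i s) (normal (D.wall i) s)| ≤ K * ‖w - D.wall i s‖ ^ 2 := by
    intro i s w hw
    refine ((H' i s).1 w hw).trans ?_
    gcongr
    exact hle i
  have hc : |1 / (2 * K)| * (2 * K) ≤ 1 := by
    rw [abs_of_pos (by positivity)]
    field_simp
    rfl
  have hc' : |-(1 / (2 * K))| * (2 * K) ≤ 1 := by rwa [abs_neg]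
  have habs : |1 / (2 * K)| = 1 / (2 * K) := abs_of_pos (by positivity)
  have hpos : 0 < 1 / (2 * K) := by positivity
  have hnear : ∀ i s, ∃ ε : ℝ, 0 < ε ∧ ε < 1 / (2 * K) ∧
      D.wall i s - ε • normal (D.wall i) s ∈ D.carrier ∧
      D.wall i s + ε • normal (D.wall i) s ∉ closure D.carrier := by
    intro i s
    obtain ⟨ε, h1, h2⟩ := ((D.wall_outward i s).and (Ioo_mem_nhdsGT hpos)).exists
    exact ⟨ε, h2.1, h2.2, h1.1, h1.2⟩
  refine ⟨K, ?_⟩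
  refine ⟨hK0, toComplex.toHomeomorph.isOpen_image.2 D.isOpen, ?_, ?_, ?_, ?_, ?_, ?_⟩
  · exact toComplex.lipschitz.isBounded_image D.isBounded
  · rw [toComplex_image_frontier, D.frontier_eq, image_iUnion]
    ext w
    simp only [mem_range, Prod.exists, mem_iUnion, mem_image, exists_exists_eq_and]
  · rintro ⟨i, s⟩
    rw [LinearIsometryEquiv.norm_map]
    exact norm_tangent (D.wall_curve i) s
  · rintro ⟨i, s⟩ w' hw'
    rw [toComplex_image_closure] at hw'
    obtain ⟨w, hw, rfl⟩ := hw'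
    rw [← toComplex_perp, ← map_sub, LinearIsometryEquiv.inner_map_map,
      LinearIsometryEquiv.norm_map]
    change inner ℝ (w - D.wall i s) (normal (D.wall i) s) ≤ K * ‖w - D.wall i s‖ ^ 2
    by_contra! hlt
    have hn := norm_normal (D.wall_curve i) s
    have hdisj := disjoint_ball_of_normal_bound hn hc (hN i s)
    rw [habs] at hdisj
    obtain ⟨ε, hε, hε', _, hout⟩ := hnear i s
    have hwb : w ∈ Metric.ball (D.wall i s + (1 / (2 * K)) • normal (D.wall i) s) (1 / (2 * K)) := by
      rw [Metric.mem_ball, dist_eq_norm]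
      refine lt_of_pow_lt_pow_left₀ 2 hpos.le ?_
      rw [show w - (D.wall i s + (1 / (2 * K)) • normal (D.wall i) s)
        = (w - D.wall i s) - (1 / (2 * K)) • normal (D.wall i) s by abel,
        norm_sub_sq_real (w - D.wall i s), inner_smul_right, norm_smul, hn, Real.norm_eq_abs, habs,
        mul_one]
      have h1 : ‖w - D.wall i s‖ ^ 2 < 2 * (1 / (2 * K) *
          inner ℝ (w - D.wall i s) (normal (D.wall i) s)) := by
        calc ‖w - D.wall i s‖ ^ 2 = (1 / K) * (K * ‖w - D.wall i s‖ ^ 2) := by field_simp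
          _ < (1 / K) * inner ℝ (w - D.wall i s) (normal (D.wall i) s) := by gcongr
          _ = _ := by field_simp
      linarith
    have hwD : w ∈ D.carrier := by
      by_contra hwD
      exact hdisj.le_bot ⟨hwb, hw, fun h' => hwD (interior_subset h')⟩
    have hsub := (convex_ball (D.wall i s + (1 / (2 * K)) • normal (D.wall i) s)
      (1 / (2 * K))).isPreconnected.subset_of_disjoint_frontier D.isOpen ⟨w, hwb, hwD⟩ hdisj
    refine hout (subset_closure (hsub ?_))
    rw [Metric.mem_ball, dist_eq_norm, add_sub_add_left_eq_sub, ← sub_smul, norm_smul, hn, mul_one,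
      Real.norm_eq_abs, abs_sub_comm, abs_of_pos (by linarith)]
    linarith
  · rintro ⟨i, s⟩
    have hn := norm_normal (D.wall_curve i) s
    have hdisj := disjoint_ball_of_normal_bound hn hc' (hN i s)
    rw [abs_neg, habs, neg_smul, ← sub_eq_add_neg] at hdisj
    obtain ⟨ε, hε, hε', hin, _⟩ := hnear i s
    have hsub := (convex_ball (D.wall i s - (1 / (2 * K)) • normal (D.wall i) s)
      (1 / (2 * K))).isPreconnected.subset_of_disjoint_frontier D.isOpen
      ⟨D.wall i s - ε • normal (D.wall i) s, ?_, hin⟩ hdisj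
    · intro w hw
      refine ⟨toComplex.symm w, hsub ?_, by simp⟩
      rw [Metric.mem_ball] at hw ⊢
      rw [← toComplex.dist_map, LinearIsometryEquiv.apply_symm_apply]
      convert! hw using 2
      rw [map_sub, map_smul, Complex.real_smul, ← toComplex_perp]
      rfl
    · rw [Metric.mem_ball, dist_eq_norm, sub_sub_sub_cancel_left, ← sub_smul, norm_smul, hn, mul_one,
        Real.norm_eq_abs, abs_of_pos (by linarith)]
      linarith
  · rintro ⟨i, s⟩
    obtain ⟨κ, hκ, Hκ⟩ := (H' i s).2
    refine ⟨κ, hκ.trans (hle i), ?_⟩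
    rintro ⟨j, s'⟩
    obtain ⟨l, hl⟩ := Hκ j s'
    refine ⟨l, hl.trans ?_⟩
    rw [← map_sub, LinearIsometryEquiv.norm_map]
    gcongr
    exact hle i

/-! ### Bounds in Sobolev spaces of a curve -/

/-- The length of the arc of `z` between two parameters. -/
noncomputable def arcLength (z : ℝ → Plane) (s s' : ℝ) : ℝ := |∫ σ in s..s', ‖deriv z σ‖|

theorem arcLength_nonneg (z : ℝ → Plane) (s s' : ℝ) : 0 ≤ arcLength z s s' := abs_nonneg _

/-- Pairing `f` with the fixed vector `v = f s' - f s` gives a scalar Lipschitz function, which is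
the integral of its derivative; one factor `‖v‖` then cancels. -/
theorem norm_sub_le_mul_arcLength {F : Type*} [NormedAddCommGroup F] [InnerProductSpace ℝ F]
    [FiniteDimensional ℝ F] {z : ℝ → Plane} (hz : Continuous (deriv z)) {f : ℝ → F} {K : NNReal}
    (hf : LipschitzWith K f) {M : ℝ} (hM : ∀ᵐ σ, ‖deriv f σ‖ ≤ M * ‖deriv z σ‖) (hM0 : 0 ≤ M)
    (s s' : ℝ) : ‖f s' - f s‖ ≤ M * arcLength z s s' := by
  set v := f s' - f s with hv
  rcases eq_or_ne v 0 with h0 | h0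
  · rw [h0, norm_zero]
    exact mul_nonneg hM0 (arcLength_nonneg _ _ _)
  have hvpos : 0 < ‖v‖ := norm_pos_iff.2 h0
  have hLip : LipschitzWith (‖innerSL ℝ v‖₊ * K) (fun σ => inner ℝ v (f σ)) :=
    (innerSL ℝ v).lipschitz.comp hf
  have hac := (hLip.lipschitzOnWith (s := uIcc s s')).absolutelyContinuousOnInterval
  have hint := hac.integral_deriv_eq_sub
  have hsq : inner ℝ v (f s') - inner ℝ v (f s) = ‖v‖ ^ 2 := by
    rw [← inner_sub_right, ← hv, real_inner_self_eq_norm_sq]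
  rw [hsq] at hint
  have hbound : ∀ᵐ σ, ‖deriv (fun σ => inner ℝ v (f σ)) σ‖ ≤ ‖v‖ * M * ‖deriv z σ‖ := by
    filter_upwards [hM, hf.ae_differentiableAt_real] with σ h1 h2
    have h3 : HasDerivAt (fun σ => inner ℝ v (f σ)) (inner ℝ v (deriv f σ)) σ := by
      simpa using (hasDerivAt_const σ v).inner ℝ h2.hasDerivAt
    rw [h3.deriv, mul_assoc]
    refine (norm_inner_le_norm _ _).trans ?_
    gcongr
  have h1 := intervalIntegral.norm_integral_le_abs_of_norm_le (a := s) (b := s')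
    (ae_restrict_of_ae hbound) ((continuous_const.mul hz.norm).intervalIntegrable s s')
  rw [hint, intervalIntegral.integral_const_mul, abs_mul, abs_of_nonneg (by positivity),
    Real.norm_eq_abs, abs_of_nonneg (by positivity)] at h1
  have h2 : ‖v‖ * ‖v‖ ≤ ‖v‖ * (M * arcLength z s s') := by
    rw [arcLength]
    nlinarith
  exact le_of_mul_le_mul_left h2 hvpos

/-- Pointwise and Lipschitz bounds for a function on a curve and for its tangential derivative. -/
structure CurveBounds {F : Type*} [NormedAddCommGroup F] [NormedSpace ℝ F] (M : ℝ) (z : ℝ → Plane)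
    (f : ℝ → F) : Prop where
  bound : ∀ s, ‖f s‖ ≤ M
  grad_bound : ∀ s, ‖tangentialDeriv z f s‖ ≤ M
  lip : ∀ s s', ‖f s' - f s‖ ≤ M * arcLength z s s'
  grad_lip : ∀ s s', ‖tangentialDeriv z f s' - tangentialDeriv z f s‖ ≤ M * arcLength z s s'

theorem norm_le_of_ae_norm_le {F : Type*} [NormedAddCommGroup F] {f : ℝ → F} (hf : Continuous f)
    {M : ℝ} (h : ∀ᵐ s, ‖f s‖ ≤ M) (s : ℝ) : ‖f s‖ ≤ M := by
  by_contra! hlt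
  have hopen : IsOpen {s | M < ‖f s‖} := isOpen_lt continuous_const hf.norm
  have hpos := hopen.measure_pos volume ⟨s, hlt⟩
  rw [ae_iff] at h
  simp only [not_le] at h
  exact hpos.ne' h

/-- The essential bounds of orders zero and one hold everywhere by continuity. The second derivative
exists only almost everywhere and enters through its integral, as a Lipschitz bound for the first.
-/
theorem CurveBounds.of_wInfNorm {F : Type*} [NormedAddCommGroup F] [InnerProductSpace ℝ F]
    [FiniteDimensional ℝ F] {z : ℝ → Plane} (hz : IsClosedCurve z) {f : ℝ → F} {M : ℝ} (hM : 0 ≤ M)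
    (hmem : MemWInf 2 z f) (hnorm : wInfNorm 2 z f ≤ ENNReal.ofReal M) : CurveBounds M z f := by
  have hz' : Continuous (deriv z) := hz.contDiff.continuous_deriv le_rfl
  have hae : ∀ i < 3, ∀ᵐ s, ‖(tangentialDeriv z)^[i] f s‖ ≤ M := by
    intro i hi
    have h1 : eLpNorm ((tangentialDeriv z)^[i] f) ∞ volume ≤ ENNReal.ofReal M :=
      (Finset.single_le_sum (f := fun i => eLpNorm ((tangentialDeriv z)^[i] f) ∞ volume)
        (fun _ _ => zero_le) (Finset.mem_range.2 hi)).trans hnorm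
    rw [eLpNorm_exponent_top] at h1
    filter_upwards [ae_le_eLpNormEssSup (f := (tangentialDeriv z)^[i] f) (μ := volume)] with s hs
    have h2 := hs.trans h1
    rwa [← ofReal_norm, ENNReal.ofReal_le_ofReal_iff hM] at h2
  have hstep : ∀ g : ℝ → F, (∀ᵐ s, ‖tangentialDeriv z g s‖ ≤ M) →
      ∀ᵐ s, ‖deriv g s‖ ≤ M * ‖deriv z s‖ := by
    intro g hg
    filter_upwards [hg] with s hs
    have hpos := norm_pos_iff.2 (hz.regular s)
    rw [tangentialDeriv, norm_smul, norm_inv, norm_norm, inv_mul_le_iff₀ hpos] at hs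
    linarith
  obtain ⟨K₀, hK₀⟩ := hmem 0 (by norm_num)
  obtain ⟨K₁, hK₁⟩ := hmem 1 (by norm_num)
  have h0 := hae 0 (by norm_num)
  have h1 := hae 1 (by norm_num)
  have h2 := hae 2 (by norm_num)
  exact ⟨norm_le_of_ae_norm_le hK₀.continuous h0, norm_le_of_ae_norm_le hK₁.continuous h1,
    norm_sub_le_mul_arcLength hz' hK₀ (hstep f h1) hM,
    norm_sub_le_mul_arcLength hz' hK₁ (hstep _ h2) hM⟩

/-- Frenet's formula: unit length leaves only the normal component, and the sign comes from moving
`perp` to the other side of the inner product. -/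
theorem hasDerivAt_tangent {z : ℝ → Plane} (h : IsClosedCurve z) (hz : ContDiff ℝ 3 z) (s : ℝ) :
    HasDerivAt (tangent z) (-(‖deriv z s‖ * curvature z s) • normal z s) s := by
  have hC : ContDiff ℝ 2 (tangent z) := contDiff_tangent (n := 2) h (by exact_mod_cast hz)
  have hd := (hC.differentiable two_ne_zero s).hasDerivAt
  have hN : HasDerivAt (normal z) (perp (deriv (tangent z) s)) s := by
    have := perpL.hasFDerivAt.comp_hasDerivAt s hd
    exact this
  have hτ := norm_tangent h
  have horth : inner ℝ (deriv (tangent z) s) (tangent z s) = 0 := by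
    have h1 : HasDerivAt (fun σ => inner ℝ (tangent z σ) (tangent z σ))
        (inner ℝ (tangent z s) (deriv (tangent z) s) + inner ℝ (deriv (tangent z) s) (tangent z s))
        s := hd.inner ℝ hd
    have h2 : (fun σ => inner ℝ (tangent z σ) (tangent z σ)) = fun _ => (1 : ℝ) := by
      ext σ
      rw [real_inner_self_eq_norm_sq, hτ]; norm_num
    rw [h2] at h1
    have h3 := h1.unique (hasDerivAt_const s (1 : ℝ))
    rw [real_inner_comm] at h3
    linarith
  have hpos := norm_pos_iff.2 (h.regular s)
  have hcurv : ‖deriv z s‖ * curvature z s = -inner ℝ (deriv (tangent z) s) (normal z s) := by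
    rw [curvature, tangentialDeriv, hN.deriv, inner_smul_left, inner_perp_left]
    simp only [conj_trivial]
    rw [mul_inv_cancel_left₀ hpos.ne']
    rfl
  have h4 := eq_of_inner_perp (deriv (tangent z) s) (hτ s)
  rw [horth, zero_smul, zero_add] at h4
  rw [hcurv, neg_neg]
  convert! hd using 1
  exact h4.symm

theorem norm_tangent_sub_le {z : ℝ → Plane} (h : IsClosedCurve z) (hz : ContDiff ℝ 3 z) {M : ℝ}
    (hM : ∀ s, ‖curvature z s‖ ≤ M) (s s' : ℝ) :
    ‖tangent z s' - tangent z s‖ ≤ M * arcLength z s s' := by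
  obtain ⟨L, hL, HL⟩ := (periodic_tangent h).exists_lipschitz
    ((contDiff_tangent (n := 2) h (by exact_mod_cast hz)).of_le one_le_two)
  have hlip : LipschitzWith L.toNNReal (tangent z) := by
    refine LipschitzWith.of_dist_le_mul fun x y => ?_
    rw [dist_eq_norm, Real.dist_eq, Real.coe_toNNReal _ hL.le]
    exact HL y x
  refine norm_sub_le_mul_arcLength (h.contDiff.continuous_deriv le_rfl) hlip
    (Eventually.of_forall fun σ => ?_) ((norm_nonneg _).trans (hM 0)) s s'
  rw [(hasDerivAt_tangent h hz σ).deriv, norm_smul, norm_neg, norm_mul, norm_norm, norm_normal h,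
    mul_one, mul_comm]
  gcongr
  exact hM σ

theorem CurveFamily.exists_arcLength_le {J : Set ℝ} {z : ℝ → ℝ → Plane} (h : CurveFamily J z) :
    ∃ B > 0, ∀ t ∈ J, ∀ s s', arcLength (z t) s s' ≤ B * |s' - s| := by
  obtain ⟨b, hb, B, hB, hbB⟩ := h.exists_speed_bounds
  refine ⟨B, hB, fun t ht s s' => ?_⟩
  rw [arcLength, ← Real.norm_eq_abs]
  exact intervalIntegral.norm_integral_le_of_norm_le_const fun σ _ => by
    rw [norm_norm]; exact (hbB t ht σ).2

/-- The factor `2` is universal and only `δ` depends on the family. This keeps the later growth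
constants independent of the time interval. -/
theorem CurveFamily.exists_arcLength_le_chord {J : Set ℝ} {z : ℝ → ℝ → Plane}
    (h : CurveFamily J z) :
    ∃ δ > 0, ∀ t ∈ J, ∀ s s', |s' - s| < δ → arcLength (z t) s s' ≤ 2 * ‖z t s' - z t s‖ := by
  obtain ⟨b, hb, B, hB, hbB⟩ := h.exists_speed_bounds
  obtain ⟨δ₁, hδ₁, H₁⟩ := h.exists_expansion (show 0 < b / 4 by positivity)
  obtain ⟨δ₂, hδ₂, H₂⟩ := exists_uniform_modulus h.isCompact h.cont_deriv
    (fun t ht => (h.curve t ht).periodic.deriv') (show 0 < b / 4 by positivity)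
  refine ⟨min δ₁ δ₂, by positivity, fun t ht s s' hs => ?_⟩
  obtain ⟨hs1, hs2⟩ := lt_min_iff.1 hs
  have h1 : arcLength (z t) s s' ≤ (‖deriv (z t) s‖ + b / 4) * |s' - s| := by
    rw [arcLength, ← Real.norm_eq_abs]
    refine intervalIntegral.norm_integral_le_of_norm_le_const fun σ hσ => ?_
    rw [norm_norm]
    have h2 : |σ - s| < δ₂ := by
      have := abs_sub_left_of_mem_uIcc (uIoc_subset_uIcc hσ)
      exact this.trans_lt hs2
    have h3 := (H₂ t ht s σ h2).le
    have h4 := norm_sub_norm_le (deriv (z t) σ) (deriv (z t) s)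
    linarith
  have h2 := H₁ t ht s s' hs1
  have h3 : ‖(s' - s) • deriv (z t) s‖ ≤ ‖z t s' - z t s‖ + b / 4 * |s' - s| := by
    calc ‖(s' - s) • deriv (z t) s‖
        = ‖(z t s' - z t s) - (z t s' - z t s - (s' - s) • deriv (z t) s)‖ := by congr 1; abel
      _ ≤ _ := (norm_sub_le _ _).trans (by gcongr)
  rw [norm_smul, Real.norm_eq_abs] at h3
  have h4 := mul_le_mul_of_nonneg_right (hbB t ht s).1 (abs_nonneg (s' - s))
  have h5 := norm_nonneg (z t s' - z t s)
  rw [add_mul] at h1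
  rw [mul_comm] at h3
  linarith

/-! ### Differentiation along curves in the boundary -/

/-- The path runs in the boundary of `O`, where `Φ` need not be differentiable. Push it inwards by
`ε • n`, apply the mean value inequality to `Φ` minus its linear candidate, whose derivative is
small uniformly in `ε`, and let `ε → 0`. -/
theorem hasDerivAt_of_interior {E F : Type*} [NormedAddCommGroup E] [NormedSpace ℝ E]
    [NormedAddCommGroup F] [NormedSpace ℝ F] {O : Set E} {Φ : E → F} {G : E → E →L[ℝ] F}
    {G₀ : E →L[ℝ] F} {c c' : ℝ → E} {r₀ B : ℝ} {n : E}
    (hc : ∀ᶠ r in 𝓝 r₀, HasDerivAt c (c' r) r) (hB : ∀ᶠ r in 𝓝 r₀, ‖c' r‖ ≤ B)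
    (hO : ∀ᶠ q : ℝ × ℝ in 𝓝 r₀ ×ˢ 𝓝[>] 0, c q.1 + q.2 • n ∈ O)
    (hΦ : ∀ y ∈ O, HasFDerivAt Φ (G y) y)
    (hΦc : ∀ᶠ r in 𝓝 r₀, Tendsto Φ (𝓝[O] (c r)) (𝓝 (Φ (c r))))
    (hG : Tendsto G (𝓝[O] (c r₀)) (𝓝 G₀)) :
    HasDerivAt (fun r => Φ (c r)) (G₀ (c' r₀)) r₀ := by
  have hB0 : 0 ≤ B := (norm_nonneg _).trans hB.self_of_nhds
  have hc0 := hc.self_of_nhds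
  suffices h : HasDerivAt (fun r => Φ (c r) - G₀ (c r)) 0 r₀ by
    have h2 := h.add (G₀.hasFDerivAt.comp_hasDerivAt r₀ hc0)
    rw [zero_add] at h2
    refine h2.congr_of_eventuallyEq (Eventually.of_forall fun r => ?_)
    simp
  rw [hasDerivAt_iff_isLittleO, Asymptotics.isLittleO_iff]
  intro η hη
  have hη' : 0 < η / (B + 1) := by positivity
  obtain ⟨ρ, hρ, Hρ⟩ : ∃ ρ > 0, ∀ y ∈ O, ‖y - c r₀‖ < ρ → ‖G y - G₀‖ ≤ η / (B + 1) := by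
    obtain ⟨ρ, hρ, H⟩ := Metric.tendsto_nhdsWithin_nhds.1 hG _ hη'
    refine ⟨ρ, hρ, fun y hy hy' => ?_⟩
    rw [← dist_eq_norm]
    exact (H hy (by rwa [dist_eq_norm])).le
  have hcc : ∀ᶠ r in 𝓝 r₀, ‖c r - c r₀‖ < ρ / 2 := by
    have := hc0.continuousAt.sub_const (c r₀) |>.norm
    refine this.eventually_lt continuousAt_const ?_
    simpa using hρ
  obtain ⟨pa, hpa, pb, hpb, hab⟩ := Filter.eventually_prod_iff.1 hO
  have hall := (((hc.and hB).and (hcc.and hpa)).and hΦc)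
  obtain ⟨δ, hδ, Hδ⟩ := Metric.eventually_nhds_iff_ball.1 hall
  filter_upwards [Metric.ball_mem_nhds r₀ hδ] with r hr
  rw [smul_zero, sub_zero]
  have hsmall : ∀ᶠ ε : ℝ in 𝓝[>] 0, pb ε ∧ ‖ε • n‖ < ρ / 2 := by
    refine hpb.and ?_
    have : ContinuousAt (fun ε : ℝ => ‖ε • n‖) 0 := by fun_prop
    refine (this.eventually_lt continuousAt_const ?_).filter_mono nhdsWithin_le_nhds
    simpa using hρ
  have hmem : ∀ τ ∈ Metric.ball r₀ δ, Tendsto (fun ε : ℝ => c τ + ε • n) (𝓝[>] 0) (𝓝[O] (c τ)) := by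
    intro τ hτ
    rw [tendsto_nhdsWithin_iff]
    constructor
    · have : ContinuousAt (fun ε : ℝ => c τ + ε • n) 0 := by fun_prop
      have h2 := this.tendsto
      simp only [zero_smul, add_zero] at h2
      exact h2.mono_left nhdsWithin_le_nhds
    · filter_upwards [hpb] with ε hε
      exact hab (Hδ τ hτ).1.2.2 hε
  have hr₀ : r₀ ∈ Metric.ball r₀ δ := Metric.mem_ball_self hδ
  have hlim : ∀ τ ∈ Metric.ball r₀ δ,
      Tendsto (fun ε : ℝ => Φ (c τ + ε • n) - G₀ (c τ)) (𝓝[>] 0) (𝓝 (Φ (c τ) - G₀ (c τ))) :=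
    fun τ hτ => ((Hδ τ hτ).2.comp (hmem τ hτ)).sub_const _
  refine le_of_tendsto ((hlim r hr).sub (hlim r₀ hr₀)).norm ?_
  filter_upwards [hsmall] with ε hε
  have hder : ∀ τ ∈ Metric.ball r₀ δ, HasDerivWithinAt (fun τ => Φ (c τ + ε • n) - G₀ (c τ))
      ((G (c τ + ε • n) - G₀) (c' τ)) (Metric.ball r₀ δ) τ := by
    intro τ hτ
    have h1 := (Hδ τ hτ).1.1.1
    have h2 := (hΦ _ (hab (Hδ τ hτ).1.2.2 hε.1)).comp_hasDerivAt τ (h1.add_const (ε • n))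
    exact (h2.sub (G₀.hasFDerivAt.comp_hasDerivAt τ h1)).hasDerivWithinAt
  have hbd : ∀ τ ∈ Metric.ball r₀ δ, ‖(G (c τ + ε • n) - G₀) (c' τ)‖ ≤ η := by
    intro τ hτ
    have h1 : ‖G (c τ + ε • n) - G₀‖ ≤ η / (B + 1) := by
      refine Hρ _ (hab (Hδ τ hτ).1.2.2 hε.1) ?_
      rw [show c τ + ε • n - c r₀ = (c τ - c r₀) + ε • n by abel]
      refine (norm_add_le _ _).trans_lt ?_
      have := (Hδ τ hτ).1.2.1
      linarith [hε.2]
    calc _ ≤ ‖G (c τ + ε • n) - G₀‖ * ‖c' τ‖ := ContinuousLinearMap.le_opNorm _ _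
      _ ≤ η / (B + 1) * (B + 1) := by
          gcongr
          linarith [(Hδ τ hτ).1.1.2]
      _ = η := by field_simp
  exact (convex_ball r₀ δ).norm_image_sub_le_of_norm_hasDerivWithin_le hder hbd hr₀ hr

/-! ### The interface -/

section Interface

variable {g T M t₁ : ℝ} {D : H4Domain} {Ωp Ωm : ℝ → Set Plane} {z : ℝ → ℝ → Plane}
  {up um : ℝ → Plane → Plane} {pp pm : ℝ → Plane → ℝ}

theorem Icc_subset_Ico_of_lt (h : t₁ < T) : Icc 0 t₁ ⊆ Ico 0 T := fun _ ht => ⟨ht.1, ht.2.trans_lt h⟩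

theorem VortexSheet.IsVortexSheet.curveFamily (hS : IsVortexSheet g T D Ωp Ωm z up um pp pm)
    (h1 : t₁ < T) : CurveFamily (Icc 0 t₁) z where
  isCompact := isCompact_Icc
  curve := fun t ht => (hS.partition t (Icc_subset_Ico_of_lt h1 ht)).curve
  cont := hS.motion_contDiff.continuousOn.mono (prod_mono_left (Icc_subset_Ico_of_lt h1))
  cont_deriv := by
    have hu : UniqueDiffOn ℝ (Ico 0 T ×ˢ (univ : Set ℝ)) := (uniqueDiffOn_Ico 0 T).prod uniqueDiffOn_univ
    have hc := hS.motion_contDiff.continuousOn_fderivWithin hu le_rfl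
    have hd := hS.motion_contDiff.differentiableOn one_ne_zero
    have he : ContinuousOn (fun q : ℝ × ℝ =>
        fderivWithin ℝ (Function.uncurry z) (Ico 0 T ×ˢ univ) q (0, 1)) (Icc 0 t₁ ×ˢ univ) :=
      (hc.clm_apply continuousOn_const).mono (prod_mono_left (Icc_subset_Ico_of_lt h1))
    refine he.congr fun q hq => ?_
    obtain ⟨t, s⟩ := q
    have ht := Icc_subset_Ico_of_lt h1 hq.1
    have h2 : HasDerivAt (fun σ : ℝ => (t, σ)) ((0 : ℝ), (1 : ℝ)) s :=
      (hasDerivAt_const s t).prodMk (hasDerivAt_id s)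
    have h3 := (hd (t, s) ⟨ht, mem_univ _⟩).hasFDerivWithinAt.comp_hasDerivWithinAt (s := univ) s
      h2.hasDerivWithinAt fun σ _ => ⟨ht, mem_univ _⟩
    rw [hasDerivWithinAt_univ] at h3
    exact h3.deriv

theorem VortexSheet.HasBounds.bounds (hS : IsVortexSheet g T D Ωp Ωm z up um pp pm)
    (hB : HasBounds T M D z up) (hM : 0 < M) {t : ℝ} (ht : t ∈ Ico 0 T) :
    CurveBounds M (z t) (fun s => up t (z t s)) ∧ CurveBounds M (z t) (curvature (z t)) := by
  have h1 : wInfNorm 2 (z t) (fun s => up t (z t s)) + wInfNorm 2 (z t) (curvature (z t)) ≤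
      ENNReal.ofReal M :=
    (le_iSup₂ (f := fun t (_ : t ∈ Ico 0 T) => wInfNorm 2 (z t) (fun s => up t (z t s)) +
      wInfNorm 2 (z t) (curvature (z t))) t ht).trans hB.norm_lt.le
  have hcv := (hS.partition t ht).curve
  exact ⟨CurveBounds.of_wInfNorm hcv hM.le (hB.mem_velocity t ht) (le_self_add.trans h1),
    CurveBounds.of_wInfNorm hcv hM.le (hB.mem_curvature t ht) (le_add_self.trans h1)⟩

theorem VortexSheet.HasBounds.norm_tangent_sub_le (hS : IsVortexSheet g T D Ωp Ωm z up um pp pm)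
    (hB : HasBounds T M D z up) (hM : 0 < M) {t : ℝ} (ht : t ∈ Ico 0 T) (s s' : ℝ) :
    ‖tangent (z t) s' - tangent (z t) s‖ ≤ M * arcLength (z t) s s' :=
  _root_.norm_tangent_sub_le (hS.partition t ht).curve (hS.partition t ht).curve_class.1
    (hB.bounds hS hM ht).2.bound s s'

theorem VortexSheet.IsPartition.mem_carrier {Ωp Ωm : Set Plane} {z : ℝ → Plane}
    (h : IsPartition D Ωp Ωm z) (s : ℝ) : z s ∈ D.carrier := by
  rw [← h.union_eq]
  exact Or.inl (Or.inr (mem_range_self s))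

theorem VortexSheet.HasBounds.exists_normal_bound (hS : IsVortexSheet g T D Ωp Ωm z up um pp pm)
    (hB : HasBounds T M D z up) (hM : 0 < M) (h1 : t₁ < T) :
    ∃ C > 0, ∀ t ∈ Icc 0 t₁, ∀ s s',
      |inner ℝ (z t s' - z t s) (normal (z t) s)| ≤ C * ‖z t s' - z t s‖ ^ 2 := by
  have hF := hS.curveFamily h1
  obtain ⟨B, hB0, hBB⟩ := hF.exists_arcLength_le
  refine hF.exists_normal_bound (L := M * B) (by positivity) fun t ht s s' => ?_
  refine (hB.norm_tangent_sub_le hS hM (Icc_subset_Ico_of_lt h1 ht) s s').trans ?_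
  rw [mul_assoc]
  gcongr
  exact hBB t ht s s'

/-- One side of the interface: `ν` is a unit normal field of the curves `z t`, and `Ω t` contains
discs of a fixed radius which touch the curve from the side of `ν`. -/
structure IsSide (J : Set ℝ) (Ω : ℝ → Set Plane) (z ν : ℝ → ℝ → Plane) (c : ℝ) : Prop where
  family : CurveFamily J z
  pos : 0 < c
  norm_eq : ∀ t ∈ J, ∀ s, ‖ν t s‖ = 1
  cont : ContinuousOn (Function.uncurry ν) (J ×ˢ univ)
  disc : ∀ t ∈ J, ∀ s, Metric.ball (z t s + c • ν t s) c ⊆ Ω t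

theorem CurveFamily.continuousOn_tangent {J : Set ℝ} (h : CurveFamily J z) :
    ContinuousOn (Function.uncurry fun t => tangent (z t)) (J ×ˢ univ) := by
  refine ContinuousOn.smul (f := fun q : ℝ × ℝ => ‖deriv (z q.1) q.2‖⁻¹)
    (g := fun q : ℝ × ℝ => deriv (z q.1) q.2) ?_ h.cont_deriv
  exact h.cont_deriv.norm.inv₀ fun q hq => norm_ne_zero_iff.2 ((h.curve q.1 hq.1).regular q.2)

theorem CurveFamily.continuousOn_normal {J : Set ℝ} (h : CurveFamily J z) :
    ContinuousOn (Function.uncurry fun t => normal (z t)) (J ×ˢ univ) :=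
  perpL.continuous.comp_continuousOn h.continuousOn_tangent

/-- Touching discs of radius `1 / (2C)` miss the interface, and `C ≥ M` keeps them within `1 / M` of
it, hence inside the container. So they lie in the union of the two phases, by connectedness in one
of them, and `sides` tells in which. -/
theorem VortexSheet.HasBounds.exists_isSide (hS : IsVortexSheet g T D Ωp Ωm z up um pp pm)
    (hB : HasBounds T M D z up) (hM : 0 < M) (h1 : t₁ < T) :
    ∃ c, IsSide (Icc 0 t₁) Ωm z (fun t => normal (z t)) c ∧
      IsSide (Icc 0 t₁) Ωp z (fun t s => -normal (z t) s) c := by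
  have hF := hS.curveFamily h1
  obtain ⟨C₀, hC₀, H₀⟩ := hB.exists_normal_bound hS hM h1
  set C := max C₀ M with hC
  have hCpos : 0 < C := lt_max_of_lt_left hC₀
  set c := 1 / (2 * C) with hc
  have hcpos : 0 < c := by positivity
  have hcC : 2 * c = 1 / C := by rw [hc]; field_simp
  have hball : ∀ t ∈ Icc 0 t₁, ∀ s, ∀ a : ℝ, |a| = c →
      Metric.ball (z t s + a • normal (z t) s) c ⊆ Ωm t ∪ Ωp t := by
    intro t ht s a ha w hw
    have hT' := Icc_subset_Ico_of_lt h1 ht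
    have hP := hS.partition t hT'
    have hn := norm_normal hP.curve s
    have hdisj := disjoint_ball_of_normal_bound (F := range (z t)) (p := z t s) (K := C) (c := a) hn
      (by rw [ha, hc]; field_simp; rfl) (by
        rintro _ ⟨s', rfl⟩
        exact (H₀ t ht s s').trans (by gcongr; exact le_max_left _ _))
    rw [ha] at hdisj
    have hwD : w ∈ D.carrier := by
      refine ball_subset_of_le_infDist (r := 1 / M) D.isOpen (hP.mem_carrier s) (hB.wall_dist t hT' s).le ?_
      rw [Metric.mem_ball] at hw ⊢
      calc dist w (z t s) ≤ dist w (z t s + a • normal (z t) s) + dist (z t s + a • normal (z t) s) (z t s) :=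
            dist_triangle _ _ _
        _ < c + c := by
            refine add_lt_add_of_lt_of_le hw ?_
            rw [dist_eq_norm, add_sub_cancel_left, norm_smul, hn, mul_one, Real.norm_eq_abs, ha]
        _ = 1 / C := by rw [← hcC]; ring
        _ ≤ 1 / M := by gcongr; exact le_max_right _ _
    rw [← hP.union_eq] at hwD
    rcases hwD with (h | h) | h
    · exact Or.inr h
    · exact absurd h (Set.disjoint_left.1 hdisj hw)
    · exact Or.inl h
  have hin : ∀ t ∈ Icc 0 t₁, ∀ s, ∀ a : ℝ, ∀ ε ∈ Ioo 0 c, |a| = c → ∀ e : ℝ, |e| = 1 → a = e * c →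
      z t s + (e * ε) • normal (z t) s ∈ Metric.ball (z t s + a • normal (z t) s) c := by
    intro t ht s a ε hε _ e he hae
    have hn := norm_normal (hF.curve t ht) s
    rw [Metric.mem_ball, dist_eq_norm, add_sub_add_left_eq_sub, ← sub_smul, norm_smul, hn, mul_one,
      Real.norm_eq_abs, hae, ← mul_sub, abs_mul, he, one_mul, abs_sub_comm, abs_of_pos (sub_pos.2 hε.2)]
    linarith [hε.1]
  have hsmall : ∀ᶠ ε in 𝓝[>] (0 : ℝ), ε ∈ Ioo 0 c := Ioo_mem_nhdsGT hcpos
  refine ⟨c, ⟨hF, hcpos,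
    fun t ht => norm_normal (hF.curve t ht), hF.continuousOn_normal, fun t ht s => ?_⟩,
    ⟨hF, hcpos,
    fun t ht s => by rw [norm_neg]; exact norm_normal (hF.curve t ht) s, hF.continuousOn_normal.neg,
    fun t ht s => ?_⟩⟩
  · have hP := hS.partition t (Icc_subset_Ico_of_lt h1 ht)
    obtain ⟨ε, h2, hε⟩ := ((hP.sides s).and hsmall).exists
    refine (convex_ball _ _).isPreconnected.subset_left_of_subset_union hP.isOpen_m hP.isOpen_p hP.disjoint.symm
      (hball t ht s c (abs_of_pos hcpos)) ⟨_, ?_, h2.1⟩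
    simpa using hin t ht s c ε hε (abs_of_pos hcpos) 1 abs_one (one_mul c).symm
  · have hP := hS.partition t (Icc_subset_Ico_of_lt h1 ht)
    obtain ⟨ε, h2, hε⟩ := ((hP.sides s).and hsmall).exists
    have hac : |(-c)| = c := by rw [abs_neg, abs_of_pos hcpos]
    rw [smul_neg, ← neg_smul]
    refine (convex_ball _ _).isPreconnected.subset_left_of_subset_union hP.isOpen_p hP.isOpen_m hP.disjoint
      ((hball t ht s (-c) hac).trans (union_comm _ _).subset) ⟨_, ?_, h2.2⟩
    have := hin t ht s (-c) ε hε hac (-1) (by simp) (by ring)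
    simpa [sub_eq_add_neg] using this

/-- From `‖ε n - c ν‖ ^ 2 = ε ^ 2 - 2 ε c ⟪n, ν⟫ + c ^ 2`. Thus one fixed direction enters the
touching discs at all nearby interface points, although the normal varies. -/
theorem IsSide.add_smul_mem {J : Set ℝ} {Ω : ℝ → Set Plane} {ν : ℝ → ℝ → Plane} {c : ℝ}
    (h : IsSide J Ω z ν c) {t : ℝ} (ht : t ∈ J) {s : ℝ} {n : Plane} (hn : ‖n‖ = 1)
    (hν : 1 / 2 < inner ℝ n (ν t s)) {ε : ℝ} (hε : ε ∈ Ioo 0 c) :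
    z t s + ε • n ∈ Metric.ball (z t s + c • ν t s) c := by
  have hc := h.pos
  rw [Metric.mem_ball, dist_eq_norm, add_sub_add_left_eq_sub, ← sq_lt_sq₀ (norm_nonneg _) hc.le,
    norm_sub_sq_real, norm_smul, norm_smul, hn, h.norm_eq t ht, inner_smul_left, inner_smul_right,
    Real.norm_eq_abs, Real.norm_eq_abs, mul_one, mul_one, sq_abs, sq_abs]
  simp only [conj_trivial]
  have h1 : ε * (c * (1 / 2)) < ε * (c * inner ℝ n (ν t s)) := by
    have := hε.1
    gcongr
  have h2 : ε * ε < ε * c := by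
    have := hε.1
    have := hε.2
    gcongr
  nlinarith

theorem IsSide.mem_closure {J : Set ℝ} {Ω : ℝ → Set Plane} {ν : ℝ → ℝ → Plane} {c : ℝ}
    (h : IsSide J Ω z ν c) {t : ℝ} (ht : t ∈ J) (s : ℝ) : z t s ∈ closure (Ω t) := by
  refine closure_mono (h.disc t ht s) ?_
  rw [closure_ball _ h.pos.ne', Metric.mem_closedBall, dist_eq_norm, sub_add_cancel_left, norm_neg,
    norm_smul, h.norm_eq t ht, mul_one, Real.norm_eq_abs, abs_of_pos h.pos]

theorem CurveFamily.exists_param_near {J : Set ℝ} (h : CurveFamily J z) {t₀ : ℝ} (ht₀ : t₀ ∈ J)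
    (s₀ : ℝ) {ε : ℝ} (hε : 0 < ε) : ∃ δ > 0, ∀ t ∈ J, |t - t₀| < δ → ∀ s, ‖z t s - z t₀ s₀‖ < δ →
      ∃ s', z t s' = z t s ∧ |s' - s₀| < ε := by
  obtain ⟨k, hk, hchord⟩ := h.exists_chord_arc
  have hcont : ContinuousWithinAt (fun t => z t s₀) J t₀ := by
    have := (h.cont (t₀, s₀) ⟨ht₀, mem_univ _⟩).comp (f := fun t : ℝ => (t, s₀)) (s := J)
      (by fun_prop) fun t ht => ⟨ht, mem_univ _⟩
    exact this
  obtain ⟨δ, hδ, H⟩ := Metric.continuousWithinAt_iff.1 hcont (k * ε / 2) (by positivity)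
  refine ⟨min δ (k * ε / 2), by positivity, fun t ht htt s hs => ?_⟩
  obtain ⟨s', hs', hss'⟩ := (h.curve t ht).periodic.exists_abs_sub_le s₀ s
  refine ⟨s', hs', ?_⟩
  have h1 := hchord t ht s₀ s' hss'
  rw [hs'] at h1
  have h2 := H ht (by rw [Real.dist_eq]; exact htt.trans_le (min_le_left _ _))
  rw [dist_eq_norm] at h2
  have h3 : ‖z t s - z t s₀‖ ≤ ‖z t s - z t₀ s₀‖ + ‖z t s₀ - z t₀ s₀‖ := by
    rw [← norm_neg (z t s₀ - z t₀ s₀)]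
    refine le_trans (le_of_eq ?_) (norm_add_le _ _)
    congr 1; abel
  have h4 := hs.trans_le (min_le_right _ _)
  have h5 : k * |s' - s₀| < k * ε := by linarith
  exact lt_of_mul_lt_mul_left h5 hk.le

end Interface

/-! ### Continuous extension to the boundary -/

section Extension

variable {F : Type*} [TopologicalSpace F] {J : Set ℝ} {Ω : ℝ → Set Plane} {f : ℝ → Plane → F}

/-- The continuous extension to the spatial boundary. -/
noncomputable def extendToClosure (J : Set ℝ) (Ω : ℝ → Set Plane) (f : ℝ → Plane → F) (t : ℝ)
    (x : Plane) : F :=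
  @extendFrom _ _ _ _ (spaceTime J Ω) (fun r : ℝ × Plane => f r.1 r.2) (t, x)

theorem VortexSheet.ExtendsToClosure.tendsto (h : ExtendsToClosure J Ω f) {t : ℝ} (ht : t ∈ J)
    {x : Plane} (hx : x ∈ closure (Ω t)) : Tendsto (fun r : ℝ × Plane => f r.1 r.2)
      (𝓝[spaceTime J Ω] (t, x)) (𝓝 (extendToClosure J Ω f t x)) :=
  tendsto_extendFrom (h (t, x) ⟨ht, hx⟩)

theorem tendsto_slice {t : ℝ} (ht : t ∈ J) (x : Plane) :
    Tendsto (fun y => (t, y)) (𝓝[Ω t] x) (𝓝[spaceTime J Ω] (t, x)) := by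
  rw [tendsto_nhdsWithin_iff]
  refine ⟨((by fun_prop : Continuous fun y : Plane => (t, y)).tendsto x).mono_left nhdsWithin_le_nhds, ?_⟩
  filter_upwards [self_mem_nhdsWithin] with y hy
  exact ⟨ht, hy⟩

theorem VortexSheet.ExtendsToClosure.tendsto_slice (h : ExtendsToClosure J Ω f) {t : ℝ} (ht : t ∈ J)
    {x : Plane} (hx : x ∈ closure (Ω t)) :
    Tendsto (f t) (𝓝[Ω t] x) (𝓝 (extendToClosure J Ω f t x)) :=
  (h.tendsto ht hx).comp (_root_.tendsto_slice ht x)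

theorem mem_closure_spaceTime {t : ℝ} (ht : t ∈ J) {x : Plane} (hx : x ∈ closure (Ω t)) :
    (t, x) ∈ closure (spaceTime J Ω) := by
  rw [mem_closure_iff_nhdsWithin_neBot] at hx ⊢
  exact (_root_.tendsto_slice ht x).neBot

theorem VortexSheet.ExtendsToClosure.continuousOn [RegularSpace F] (h : ExtendsToClosure J Ω f) :
    ContinuousOn (Function.uncurry (extendToClosure J Ω f))
      (spaceTime J fun t => closure (Ω t)) :=
  continuousOn_extendFrom (fun q hq => mem_closure_spaceTime (x := q.2) hq.1 hq.2) fun q hq => h q hq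

theorem VortexSheet.ExtendsToClosure.eq_of_mem [T2Space F] (h : ExtendsToClosure J Ω f) {t : ℝ} (ht : t ∈ J)
    {x : Plane} (hx : x ∈ Ω t) : extendToClosure J Ω f t x = f t x :=
  tendsto_nhds_unique ((h.tendsto ht (subset_closure hx)).mono_left (pure_le_nhdsWithin ⟨ht, hx⟩))
    (tendsto_pure_nhds (fun r : ℝ × Plane => f r.1 r.2) (t, x))

theorem VortexSheet.ExtendsToClosure.mem_of_isClosed (h : ExtendsToClosure J Ω f) {t : ℝ} (ht : t ∈ J)
    {x : Plane} (hx : x ∈ closure (Ω t)) {S : Set F} (hS : IsClosed S) (hf : ∀ y ∈ Ω t, f t y ∈ S) :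
    extendToClosure J Ω f t x ∈ S := by
  have := mem_closure_iff_nhdsWithin_neBot.1 hx
  refine hS.mem_of_tendsto (h.tendsto_slice ht hx) ?_
  filter_upwards [self_mem_nhdsWithin] with y hy using hf y hy

end Extension

/-! ### Derivatives of the velocity and of the pressure on the interface -/

section Boundary

variable {g T t₁ : ℝ} {Ω : ℝ → Set Plane} {u : ℝ → Plane → Plane} {p : ℝ → Plane → ℝ}
  {z ν : ℝ → ℝ → Plane} {c : ℝ}

/-- The velocity gradient, up to the boundary. -/
noncomputable def gradU (T : ℝ) (Ω : ℝ → Set Plane) (u : ℝ → Plane → Plane) :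
    ℝ → Plane → Plane →L[ℝ] Plane :=
  extendToClosure (Ico 0 T) Ω fun t => fderiv ℝ (u t)

/-- The pressure gradient, up to the boundary. -/
noncomputable def gradP (T : ℝ) (Ω : ℝ → Set Plane) (p : ℝ → Plane → ℝ) :
    ℝ → Plane → Plane :=
  extendToClosure (Ioo 0 T) Ω fun t => gradient (p t)

theorem tendsto_velocity (h : IsEulerFlow g T Ω u p) {t : ℝ} (ht : t ∈ Ico 0 T) {x : Plane}
    (hx : x ∈ closure (Ω t)) : Tendsto (u t) (𝓝[Ω t] x) (𝓝 (u t x)) := by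
  have h1 := h.velocity_cont (t, x) ⟨ht, hx⟩
  exact (h1.mono_left (nhdsWithin_mono _ fun q hq => ⟨hq.1, subset_closure hq.2⟩)).comp
    (tendsto_slice (Ω := Ω) ht x)

theorem IsSide.eventually_mem {J : Set ℝ} (h : IsSide J Ω z ν c) {t : ℝ} (ht : t ∈ J) (s₀ : ℝ) :
    ∀ᶠ q : ℝ × ℝ in 𝓝 s₀ ×ˢ 𝓝[>] 0, z t q.1 + q.2 • ν t s₀ ∈ Ω t := by
  have hc : Continuous (ν t) := by
    rw [← continuousOn_univ]
    exact h.cont.comp (f := fun s => (t, s)) (by fun_prop) fun s hs => ⟨ht, hs⟩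
  have h1 : ∀ᶠ s in 𝓝 s₀, 1 / 2 < (inner ℝ (ν t s₀) (ν t s) : ℝ) := by
    have : Continuous fun s => (inner ℝ (ν t s₀) (ν t s) : ℝ) := by fun_prop
    refine this.continuousAt.eventually_const_lt ?_
    beta_reduce
    rw [real_inner_self_eq_norm_sq, h.norm_eq t ht]
    norm_num
  filter_upwards [h1.prod_mk (Ioo_mem_nhdsGT h.pos)] with q hq
  exact h.disc t ht q.1 (h.add_smul_mem ht (h.norm_eq t ht s₀) hq.1 hq.2)

theorem IsSide.hasDerivAt_comp {J : Set ℝ} {E : Type*} [NormedAddCommGroup E] [NormedSpace ℝ E]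
    (h : IsSide J Ω z ν c) {t : ℝ} (ht : t ∈ J) {Φ : Plane → E} {G : Plane → Plane →L[ℝ] E}
    {G₀ : Plane →L[ℝ] E} (s₀ : ℝ) (hΦ : ∀ y ∈ Ω t, HasFDerivAt Φ (G y) y)
    (hΦc : ∀ x ∈ closure (Ω t), Tendsto Φ (𝓝[Ω t] x) (𝓝 (Φ x)))
    (hG : Tendsto G (𝓝[Ω t] (z t s₀)) (𝓝 G₀)) :
    HasDerivAt (fun s => Φ (z t s)) (G₀ (deriv (z t) s₀)) s₀ := by
  have hcv := h.family.curve t ht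
  have hb : ContinuousAt (fun s => ‖deriv (z t) s‖) s₀ :=
    (hcv.contDiff.continuous_deriv le_rfl).norm.continuousAt
  exact hasDerivAt_of_interior (c := z t) (B := ‖deriv (z t) s₀‖ + 1)
    (Eventually.of_forall fun s => h.family.hasDerivAt ht s)
    ((hb.eventually_lt_const (lt_add_one _)).mono fun _ => le_of_lt)
    (h.eventually_mem ht s₀) hΦ (Eventually.of_forall fun s => hΦc _ (h.mem_closure ht s)) hG

theorem IsSide.hasDerivAt_velocity (h : IsSide (Icc 0 t₁) Ω z ν c) (h1 : t₁ < T)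
    (hE : IsEulerFlow g T Ω u p) {t : ℝ} (ht : t ∈ Icc 0 t₁) (s : ℝ) :
    HasDerivAt (fun s => u t (z t s)) (gradU T Ω u t (z t s) (deriv (z t) s)) s := by
  have ht' := Icc_subset_Ico_of_lt h1 ht
  exact h.hasDerivAt_comp ht s (fun y hy => (hE.velocity_diff t ht' y hy).hasFDerivAt)
    (fun x hx => tendsto_velocity hE ht' hx) (hE.velocity_grad.tendsto_slice ht' (h.mem_closure ht s))

theorem IsSide.hasDerivAt_pressure (h : IsSide (Icc 0 t₁) Ω z ν c) (h1 : t₁ < T)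
    (hE : IsEulerFlow g T Ω u p) {t : ℝ} (ht : t ∈ Ioo 0 t₁) (s : ℝ) :
    HasDerivAt (fun s => p t (z t s)) (inner ℝ (gradP T Ω p t (z t s)) (deriv (z t) s)) s := by
  have ht' : t ∈ Ioo 0 T := ⟨ht.1, ht.2.trans h1⟩
  have htc := Ioo_subset_Icc_self ht
  have h2 := (InnerProductSpace.toDual ℝ Plane).continuous.tendsto _ |>.comp
    (hE.pressure_grad.tendsto_slice ht' (h.mem_closure htc s))
  refine h.hasDerivAt_comp htc s (fun y hy => (hE.pressure_diff t ht' y hy).hasGradientAt.hasFDerivAt)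
    (fun x hx => ?_) h2
  have h3 := hE.pressure_cont (t, x) ⟨ht', hx⟩
  exact (h3.mono_left (nhdsWithin_mono _ fun q hq => ⟨hq.1, subset_closure hq.2⟩)).comp
    (tendsto_slice (Ω := Ω) ht' x)

/-- The space-time region covered by the touching discs. -/
def discRegion (t₁ : ℝ) (z ν : ℝ → ℝ → Plane) (c : ℝ) : Set (ℝ × Plane) :=
  {q | q.1 ∈ Ioo 0 t₁ ∧ ∃ s, q.2 ∈ Metric.ball (z q.1 s + c • ν q.1 s) c}

/-- Openness of a phase at each time does not make it open in space-time. The discs move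
continuously, so they provide an open space-time region next to the interface. -/
theorem IsSide.isOpen_discRegion (h : IsSide (Icc 0 t₁) Ω z ν c) : IsOpen (discRegion t₁ z ν c) := by
  rw [isOpen_iff_mem_nhds]
  rintro ⟨t, x⟩ ⟨ht, s, hs⟩
  have hmem : Icc 0 t₁ ×ˢ (univ : Set ℝ) ∈ 𝓝 (t, s) :=
    prod_mem_nhds (Icc_mem_nhds ht.1 ht.2) univ_mem
  have hz : ContinuousAt (fun q : ℝ × Plane => z q.1 s) (t, x) :=
    ContinuousAt.comp (f := fun q : ℝ × Plane => (q.1, s)) (x := (t, x)) (h.family.cont.continuousAt hmem)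
      (by fun_prop)
  have hν : ContinuousAt (fun q : ℝ × Plane => ν q.1 s) (t, x) :=
    ContinuousAt.comp (f := fun q : ℝ × Plane => (q.1, s)) (x := (t, x)) (h.cont.continuousAt hmem)
      (by fun_prop)
  have hd : ContinuousAt (fun q : ℝ × Plane => dist q.2 (z q.1 s + c • ν q.1 s)) (t, x) :=
    continuousAt_snd.dist (hz.add (hν.const_smul c))
  filter_upwards [hd.eventually_lt_const hs, continuousAt_fst.eventually_mem (Ioo_mem_nhds ht.1 ht.2)]
    with q h1 h2
  exact ⟨h2, s, h1⟩

theorem IsSide.discRegion_subset (h : IsSide (Icc 0 t₁) Ω z ν c) (h1 : t₁ < T) :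
    discRegion t₁ z ν c ⊆ spaceTime (Ioo 0 T) Ω := by
  rintro ⟨t, x⟩ ⟨ht, s, hs⟩
  exact ⟨⟨ht.1, ht.2.trans h1⟩, h.disc t (Ioo_subset_Icc_self ht) s hs⟩

/-- The acceleration `-∇u u - ∇p - g e₂`, up to the boundary. -/
noncomputable def accel (g T : ℝ) (Ω : ℝ → Set Plane) (u : ℝ → Plane → Plane) (p : ℝ → Plane → ℝ)
    (t : ℝ) (x : Plane) : Plane :=
  -(gradU T Ω u t x (u t x) + gradP T Ω p t x + g • basisVec 1)

theorem continuousOn_accel (hE : IsEulerFlow g T Ω u p) :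
    ContinuousOn (fun q : ℝ × Plane => accel g T Ω u p q.1 q.2)
      (spaceTime (Ioo 0 T) fun t => closure (Ω t)) := by
  have hsub : spaceTime (Ioo 0 T) (fun t => closure (Ω t)) ⊆ spaceTime (Ico 0 T) fun t => closure (Ω t) :=
    fun q hq => ⟨Ioo_subset_Ico_self hq.1, hq.2⟩
  have h1 : ContinuousOn (fun q : ℝ × Plane => gradU T Ω u q.1 q.2)
      (spaceTime (Ioo 0 T) fun t => closure (Ω t)) := hE.velocity_grad.continuousOn.mono hsub
  have h2 : ContinuousOn (fun q : ℝ × Plane => u q.1 q.2)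
      (spaceTime (Ioo 0 T) fun t => closure (Ω t)) := hE.velocity_cont.mono hsub
  have h3 : ContinuousOn (fun q : ℝ × Plane => gradP T Ω p q.1 q.2)
      (spaceTime (Ioo 0 T) fun t => closure (Ω t)) := hE.pressure_grad.continuousOn
  exact (((h1.clm_apply h2).add h3).add continuousOn_const).neg

/-- The momentum equation expresses the time derivative by continuous quantities; with both partial
derivatives continuous, the velocity is differentiable in space-time. -/
theorem IsSide.hasFDerivAt_uncurry (h : IsSide (Icc 0 t₁) Ω z ν c) (h1 : t₁ < T)
    (hE : IsEulerFlow g T Ω u p) {q : ℝ × Plane} (hq : q ∈ discRegion t₁ z ν c) :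
    HasFDerivAt (Function.uncurry u) ((ContinuousLinearMap.toSpanSingleton ℝ
      (accel g T Ω u p q.1 q.2)).coprod (gradU T Ω u q.1 q.2)) q := by
  have hO := h.isOpen_discRegion.mem_nhds hq
  have hsub := h.discRegion_subset h1
  have hsub' : discRegion t₁ z ν c ⊆ spaceTime (Ioo 0 T) fun t => closure (Ω t) :=
    fun q hq => ⟨(hsub hq).1, subset_closure (hsub hq).2⟩
  have hsub'' : discRegion t₁ z ν c ⊆ spaceTime (Ico 0 T) fun t => closure (Ω t) :=
    fun q hq => ⟨Ioo_subset_Ico_self (hsub hq).1, subset_closure (hsub hq).2⟩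
  have hgU : ∀ v ∈ discRegion t₁ z ν c, gradU T Ω u v.1 v.2 = fderiv ℝ (u v.1) v.2 := fun v hv =>
    hE.velocity_grad.eq_of_mem (Ioo_subset_Ico_self (hsub hv).1) (hsub hv).2
  have hgP : ∀ v ∈ discRegion t₁ z ν c, gradP T Ω p v.1 v.2 = gradient (p v.1) v.2 := fun v hv =>
    hE.pressure_grad.eq_of_mem (hsub hv).1 (hsub hv).2
  have hca : ContinuousAt (fun q : ℝ × Plane => accel g T Ω u p q.1 q.2) q :=
    ((continuousOn_accel hE).mono hsub').continuousAt hO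
  refine (hasStrictFDerivAt_uncurry_coprod (𝕜 := ℝ) (f := u)
    (f₁ := fun t x => ContinuousLinearMap.toSpanSingleton ℝ (accel g T Ω u p t x))
    (f₂ := gradU T Ω u) ?_ ?_ ?_ ?_).hasFDerivAt
  · filter_upwards [hO] with v hv
    have h2 := hE.time_diff v.1 (hsub hv).1 v.2 (hsub hv).2
    have h3 := hE.momentum v.1 (hsub hv).1 v.2 (hsub hv).2
    have h4 : deriv (fun r => u r v.2) v.1 = accel g T Ω u p v.1 v.2 := by
      rw [accel, hgU v hv, hgP v hv, ← sub_eq_zero, ← sub_eq_zero.2 h3]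
      abel
    have h5 := h2.hasDerivAt
    rw [h4] at h5
    exact h5.hasFDerivAt
  · filter_upwards [hO] with v hv
    have h2 := (hE.velocity_diff v.1 (Ioo_subset_Ico_self (hsub hv).1) v.2 (hsub hv).2).hasFDerivAt
    rw [← hgU v hv] at h2
    exact h2
  · exact (ContinuousLinearMap.toSpanSingletonCLE (𝕜 := ℝ) (E := Plane)).continuous.continuousAt.comp hca
  · exact (hE.velocity_grad.continuousOn.mono hsub'').continuousAt hO

/-- The derivative of the velocity along a path in the interface. -/
theorem IsSide.hasDerivAt_along (h : IsSide (Icc 0 t₁) Ω z ν c) (h1 : t₁ < T)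
    (hE : IsEulerFlow g T Ω u p) {X v : ℝ → Plane} (hX : ∀ t ∈ Ioo 0 t₁, HasDerivAt X (v t) t)
    (hv : ContinuousOn v (Ioo 0 t₁)) (hXz : ∀ t ∈ Ioo 0 t₁, X t ∈ range (z t)) {t₀ : ℝ}
    (ht₀ : t₀ ∈ Ioo 0 t₁) :
    HasDerivAt (fun r => u r (X r)) (accel g T Ω u p t₀ (X t₀) + gradU T Ω u t₀ (X t₀) (v t₀)) t₀ := by
  have hJ := Ioo_mem_nhds ht₀.1 ht₀.2
  have ht₀' := Ioo_subset_Icc_self ht₀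
  obtain ⟨s₀, hs₀⟩ := hXz t₀ ht₀
  have hXcl : ∀ t ∈ Ioo 0 t₁, X t ∈ closure (Ω t) := by
    intro t ht
    obtain ⟨s, hs⟩ := hXz t ht
    rw [← hs]
    exact h.mem_closure (Ioo_subset_Icc_self ht) s
  have hsub := h.discRegion_subset h1
  have hsub' : discRegion t₁ z ν c ⊆ spaceTime (Ioo 0 T) fun t => closure (Ω t) :=
    fun q hq => ⟨(hsub hq).1, subset_closure (hsub hq).2⟩
  have hsub'' : discRegion t₁ z ν c ⊆ spaceTime (Ico 0 T) fun t => closure (Ω t) :=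
    fun q hq => ⟨Ioo_subset_Ico_self (hsub hq).1, subset_closure (hsub hq).2⟩
  have hTm : ∀ t ∈ Ioo 0 t₁, t ∈ Ioo 0 T := fun t ht => ⟨ht.1, ht.2.trans h1⟩
  have key := hasDerivAt_of_interior (O := discRegion t₁ z ν c) (Φ := Function.uncurry u)
    (G := fun q => (ContinuousLinearMap.toSpanSingleton ℝ
      (accel g T Ω u p q.1 q.2)).coprod (gradU T Ω u q.1 q.2))
    (G₀ := (ContinuousLinearMap.toSpanSingleton ℝ
      (accel g T Ω u p t₀ (X t₀))).coprod (gradU T Ω u t₀ (X t₀)))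
    (c := fun r => (r, X r)) (c' := fun r => (1, v r)) (r₀ := t₀)
    (B := max 1 (‖v t₀‖ + 1)) (n := (0, ν t₀ s₀)) ?_ ?_ ?_ ?_ ?_ ?_
  · simpa using key
  · filter_upwards [hJ] with r hr
    exact (hasDerivAt_id r).prodMk (hX r hr)
  · filter_upwards [(hv.continuousAt hJ).norm.eventually_lt_const (lt_add_one _)] with r hr
    rw [Prod.norm_mk, norm_one]
    exact max_le_max le_rfl hr.le
  -- The normal frozen at `(t₀, s₀)` has to point into the disc at each nearby `X r`. A parameter of
  -- `X r` close to `s₀` exists, so the normal there differs from the frozen one by less than `1 /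
  -- 2`.
  · obtain ⟨δ₁, hδ₁, H₁⟩ := Metric.continuousWithinAt_iff.1 (h.cont (t₀, s₀) ⟨ht₀', mem_univ _⟩) (1 / 2)
      (by norm_num)
    obtain ⟨δ₂, hδ₂, H₂⟩ := h.family.exists_param_near ht₀' s₀ hδ₁
    have hXc : ContinuousAt X t₀ := (hX t₀ ht₀).continuousAt
    have hne : ∀ᶠ r in 𝓝 t₀, r ∈ Ioo 0 t₁ ∧ |r - t₀| < min δ₁ δ₂ ∧ ‖X r - X t₀‖ < δ₂ := by
      filter_upwards [hJ, Metric.ball_mem_nhds t₀ (lt_min hδ₁ hδ₂),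
        hXc.eventually (Metric.ball_mem_nhds (X t₀) hδ₂)] with r a1 a2 a3
      rw [Metric.mem_ball, Real.dist_eq] at a2
      rw [dist_eq_norm] at a3
      exact ⟨a1, a2, a3⟩
    filter_upwards [hne.prod_mk (Ioo_mem_nhdsGT h.pos)] with q hq
    obtain ⟨⟨ha, hb, hc⟩, hε⟩ := hq
    obtain ⟨s, hs⟩ := hXz q.1 ha
    rw [← hs, ← hs₀] at hc
    have ha' := Ioo_subset_Icc_self ha
    obtain ⟨s', hs', hs''⟩ := H₂ q.1 ha' (hb.trans_le (min_le_right _ _)) s hc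
    have h3 : ‖ν q.1 s' - ν t₀ s₀‖ < 1 / 2 := by
      have := @H₁ (q.1, s') ⟨ha', mem_univ _⟩ (by
        rw [Prod.dist_eq, Real.dist_eq, Real.dist_eq]
        exact max_lt (hb.trans_le (min_le_left _ _)) hs'')
      rwa [dist_eq_norm] at this
    have h4 : 1 / 2 < (inner ℝ (ν t₀ s₀) (ν q.1 s') : ℝ) := by
      have h5 := norm_sub_sq_real (ν q.1 s') (ν t₀ s₀)
      rw [h.norm_eq _ ha', h.norm_eq _ ht₀', real_inner_comm] at h5
      nlinarith [norm_nonneg (ν q.1 s' - ν t₀ s₀)]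
    have h5 := h.add_smul_mem ha' (h.norm_eq _ ht₀' s₀) h4 hε
    rw [hs', hs] at h5
    refine ⟨by simpa using ha, s', ?_⟩
    simp only [Prod.fst_add, Prod.smul_fst, smul_zero, add_zero, Prod.snd_add, Prod.smul_snd]
    rw [hs', hs]
    exact h5
  · exact fun y hy => h.hasFDerivAt_uncurry h1 hE hy
  · filter_upwards [hJ] with r hr
    exact (hE.velocity_cont (r, X r) ⟨Ioo_subset_Ico_self (hTm r hr), hXcl r hr⟩).mono_left
      (nhdsWithin_mono _ hsub'')
  · have ha : Tendsto (fun q : ℝ × Plane => accel g T Ω u p q.1 q.2)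
        (𝓝[discRegion t₁ z ν c] (t₀, X t₀)) (𝓝 (accel g T Ω u p t₀ (X t₀))) :=
      (continuousOn_accel hE (t₀, X t₀) ⟨hTm t₀ ht₀, hXcl t₀ ht₀⟩).mono_left (nhdsWithin_mono _ hsub')
    have hb : Tendsto (fun q : ℝ × Plane => gradU T Ω u q.1 q.2)
        (𝓝[discRegion t₁ z ν c] (t₀, X t₀)) (𝓝 (gradU T Ω u t₀ (X t₀))) :=
      (hE.velocity_grad.continuousOn (t₀, X t₀)
        ⟨Ioo_subset_Ico_self (hTm t₀ ht₀), hXcl t₀ ht₀⟩).mono_left (nhdsWithin_mono _ hsub'')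
    have ha' := ((ContinuousLinearMap.toSpanSingletonCLE (𝕜 := ℝ) (E := Plane)).continuous.tendsto _).comp ha
    have hcop : ∀ (A : ℝ →L[ℝ] Plane) (B : Plane →L[ℝ] Plane), A.coprod B =
        A.comp (ContinuousLinearMap.fst ℝ ℝ Plane) + B.comp (ContinuousLinearMap.snd ℝ ℝ Plane) := by
      intro A B
      ext <;> simp
    simp only [hcop]
    exact ((((ContinuousLinearMap.fst ℝ ℝ Plane).precomp Plane).continuous.tendsto _).comp ha').add
      ((((ContinuousLinearMap.snd ℝ ℝ Plane).precomp Plane).continuous.tendsto _).comp hb)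

end Boundary

/-! ### Gronwall estimates -/

/-- The equations are differentiated at positive times only, so Gronwall is started at `y > a` and
continuity lets `y → a`. -/
theorem norm_le_of_norm_deriv_le_Ioo {E : Type*} [NormedAddCommGroup E] [NormedSpace ℝ E]
    {f f' : ℝ → E} {a b K ε : ℝ} (hK : 0 < K) (hf : ContinuousOn f (Icc a b))
    (hd : ∀ x ∈ Ioo a b, HasDerivAt f (f' x) x) (hb : ∀ x ∈ Ioo a b, ‖f' x‖ ≤ K * ‖f x‖ + ε) :
    ∀ x ∈ Icc a b,
      ‖f x‖ ≤ ‖f a‖ * Real.exp (K * (x - a)) + ε / K * (Real.exp (K * (x - a)) - 1) := by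
  intro x hx
  rcases hx.1.eq_or_lt with rfl | hax
  · simp
  have hlim : Tendsto (fun y => ‖f y‖ * Real.exp (K * (x - y)) +
      ε / K * (Real.exp (K * (x - y)) - 1)) (𝓝[>] a)
      (𝓝 (‖f a‖ * Real.exp (K * (x - a)) + ε / K * (Real.exp (K * (x - a)) - 1))) := by
    have h1 : Tendsto f (𝓝[>] a) (𝓝 (f a)) :=
      (hf a (left_mem_Icc.2 (hx.1.trans hx.2))).mono_of_mem_nhdsWithin
        (Icc_mem_nhdsGT (hax.trans_le hx.2))
    have h2 : Tendsto (fun y => Real.exp (K * (x - y))) (𝓝[>] a) (𝓝 (Real.exp (K * (x - a)))) :=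
      ((by fun_prop : Continuous fun y => Real.exp (K * (x - y))).tendsto a).mono_left
        nhdsWithin_le_nhds
    exact (h1.norm.mul h2).add ((h2.sub_const 1).const_mul _)
  refine ge_of_tendsto hlim ?_
  filter_upwards [Ioo_mem_nhdsGT hax] with y hy
  have hsub : ∀ r ∈ Ico y x, r ∈ Ioo a b := fun r hr =>
    ⟨hy.1.trans_le hr.1, hr.2.trans_le hx.2⟩
  have := norm_le_gronwallBound_of_norm_deriv_right_le (f := f) (f' := f') (δ := ‖f y‖) (K := K)
    (ε := ε) (a := y) (b := x) (hf.mono (Icc_subset_Icc hy.1.le hx.2))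
    (fun r hr => (hd r (hsub r hr)).hasDerivWithinAt) le_rfl (fun r hr => hb r (hsub r hr))
    x (right_mem_Icc.2 hy.2.le)
  rwa [gronwallBound_of_K_ne_0 hK.ne'] at this

theorem norm_le_exp_mul_of_norm_deriv_le {E : Type*} [NormedAddCommGroup E] [NormedSpace ℝ E]
    {f f' : ℝ → E} {a b K : ℝ} (hK : 0 < K) (hf : ContinuousOn f (Icc a b))
    (hd : ∀ x ∈ Ioo a b, HasDerivAt f (f' x) x) (hb : ∀ x ∈ Ioo a b, ‖f' x‖ ≤ K * ‖f x‖) :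
    ∀ x ∈ Icc a b, ‖f x‖ ≤ ‖f a‖ * Real.exp (K * (x - a)) := by
  intro x hx
  simpa using norm_le_of_norm_deriv_le_Ioo (ε := 0) hK hf hd (by simpa using hb) x hx

/-- The preceding estimate under time reversal; it keeps distinct particles apart. -/
theorem norm_left_le_exp_mul_of_norm_deriv_le {E : Type*} [NormedAddCommGroup E] [NormedSpace ℝ E]
    {f f' : ℝ → E} {a b K : ℝ} (hK : 0 < K) (hab : a ≤ b) (hf : ContinuousOn f (Icc a b))
    (hd : ∀ x ∈ Ioo a b, HasDerivAt f (f' x) x) (hb : ∀ x ∈ Ioo a b, ‖f' x‖ ≤ K * ‖f x‖) :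
    ‖f a‖ ≤ ‖f b‖ * Real.exp (K * (b - a)) := by
  have hmaps : ∀ r ∈ Ioo a b, a + b - r ∈ Ioo a b := fun r hr =>
    ⟨by linarith [hr.2], by linarith [hr.1]⟩
  have := norm_le_exp_mul_of_norm_deriv_le (f := fun r => f (a + b - r))
    (f' := fun r => -f' (a + b - r)) hK
    (hf.comp (by fun_prop) fun r hr => ⟨by linarith [hr.2], by linarith [hr.1]⟩)
    (fun r hr => by
      have h1 : HasDerivAt (fun r : ℝ => a + b - r) (-1) r := (hasDerivAt_id r).const_sub (a + b)
      have h2 := (hd _ (hmaps r hr)).scomp r h1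
      rw [neg_one_smul] at h2
      exact h2)
    (fun r hr => by rw [norm_neg]; exact hb _ (hmaps r hr)) b (right_mem_Icc.2 hab)
  simpa using this

/-- A flow of a vector field with a uniform first order expansion along a moving set is
continuously differentiable with respect to its initial data. -/
theorem differentiable_flow {E : Type*} [NormedAddCommGroup E] [NormedSpace ℝ E] [CompleteSpace E]
    {t₁ L B K₀ : ℝ} (hL0 : 0 < L) (hB0 : 0 < B) (hK0 : 0 < K₀) {S : ℝ → Set E} {U : ℝ → E → E}
    {G : ℝ → E → E →L[ℝ] E}
    (hL : ∀ t ∈ Icc 0 t₁, ∀ x ∈ S t, ∀ x' ∈ S t, ‖U t x' - U t x‖ ≤ L * ‖x' - x‖)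
    (hB : ∀ t ∈ Icc 0 t₁, ∀ x ∈ S t, ‖G t x‖ ≤ B)
    (hexp : ∀ ε > 0, ∃ δ > 0, ∀ t ∈ Icc 0 t₁, ∀ x ∈ S t, ∀ x' ∈ S t, ‖x' - x‖ < δ →
      ‖U t x' - U t x - G t x (x' - x)‖ ≤ ε * ‖x' - x‖)
    {X : ℝ → ℝ → E} (hXS : ∀ t ∈ Icc 0 t₁, ∀ s, X t s ∈ S t)
    (hXc : ∀ s, ContinuousOn (fun t => X t s) (Icc 0 t₁))
    (hXd : ∀ s, ∀ t ∈ Ioo 0 t₁, HasDerivAt (fun t => X t s) (U t (X t s)) t)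
    (hK : ∀ s s', ‖X 0 s' - X 0 s‖ ≤ K₀ * |s' - s|) {Y : ℝ → E}
    (hY : ∀ ε > 0, ∃ δ > 0, ∀ s s', |s' - s| < δ →
      ‖X 0 s' - X 0 s - (s' - s) • Y s‖ ≤ ε * |s' - s|)
    {t : ℝ} (ht : t ∈ Icc 0 t₁) : Differentiable ℝ (X t) ∧ Continuous (deriv (X t)) := by
  have hexpmono : ∀ K > 0, ∀ r ∈ Icc 0 t₁, Real.exp (K * (r - 0)) ≤ Real.exp (K * t₁) := by
    intro K hK r hr
    gcongr
    linarith [hr.2]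
  set A := K₀ * Real.exp (L * t₁) with hA
  have hA0 : 0 < A := by positivity
  have hlip : ∀ s h, ∀ r ∈ Icc 0 t₁, ‖X r (s + h) - X r s‖ ≤ A * |h| := by
    intro s h r hr
    have h1 := norm_le_exp_mul_of_norm_deriv_le hL0 ((hXc (s + h)).fun_sub (hXc s))
      (fun r hr => (hXd (s + h) r hr).fun_sub (hXd s r hr))
      (fun r hr => hL r (Ioo_subset_Icc_self hr) _ (hXS r (Ioo_subset_Icc_self hr) s) _
        (hXS r (Ioo_subset_Icc_self hr) (s + h))) r hr
    have h2 := hK s (s + h)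
    rw [add_sub_cancel_left] at h2
    calc _ ≤ _ := h1
      _ ≤ (K₀ * |h|) * Real.exp (L * t₁) := by
          gcongr ?_ * ?_
          exact hexpmono L hL0 r hr
      _ = A * |h| := by rw [hA]; ring
  set q : ℝ → ℝ → ℝ → E := fun s h r => h⁻¹ • (X r (s + h) - X r s) with hq
  set C := 2 * Real.exp (B * t₁) + 2 * A / B * Real.exp (B * t₁) with hC
  have hC0 : 0 < C := by positivity
  -- Two difference quotients solve the same linearized equation up to a small error, so Gronwall
  -- makes them Cauchy uniformly in `s`. This yields the derivative and, as a uniform limit of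
  -- continuous quotients, its continuity.
  have hcauchy : ∀ ε > 0, ∃ δ > 0, ∀ s h k, |h| < δ → h ≠ 0 → |k| < δ → k ≠ 0 →
      ‖q s h t - q s k t‖ < ε := by
    intro ε hε
    have hε' : 0 < ε / (2 * C) := by positivity
    obtain ⟨δ, hδ, Hδ⟩ := hexp (ε / (2 * C)) hε'
    obtain ⟨ρ, hρ, Hρ⟩ := hY (ε / (2 * C)) hε'
    refine ⟨min ρ (δ / A), by positivity, fun s h k hh2 hh3 hk2 hk3 => ?_⟩
    have hrem : ∀ h, |h| < min ρ (δ / A) → h ≠ 0 → ∀ r ∈ Icc 0 t₁,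
        ‖h⁻¹ • (U r (X r (s + h)) - U r (X r s)) - G r (X r s) (q s h r)‖ ≤ ε / (2 * C) * A := by
      intro h hh hne r hr
      have h1 := hlip s h r hr
      have h2 : A * |h| < δ := by
        rw [mul_comm, ← lt_div_iff₀ hA0]; exact hh.trans_le (min_le_right _ _)
      have h3 := Hδ r hr _ (hXS r hr s) _ (hXS r hr (s + h)) (h1.trans_lt h2)
      have h4 : h⁻¹ • (U r (X r (s + h)) - U r (X r s)) - G r (X r s) (q s h r) =
          h⁻¹ • (U r (X r (s + h)) - U r (X r s) - G r (X r s) (X r (s + h) - X r s)) := by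
        rw [smul_sub h⁻¹ (_ - _), ← map_smul]
      have habs : 0 < |h| := abs_pos.2 hne
      rw [h4, norm_smul, norm_inv, Real.norm_eq_abs, inv_mul_le_iff₀ habs]
      calc _ ≤ _ := h3
        _ ≤ ε / (2 * C) * (A * |h|) := by gcongr
        _ = _ := by ring
    have hini : ∀ h, |h| < min ρ (δ / A) → h ≠ 0 → ‖q s h 0 - Y s‖ ≤ ε / (2 * C) := by
      intro h hh hne
      have h1 := Hρ s (s + h) (by rw [add_sub_cancel_left]; exact hh.trans_le (min_le_left _ _))
      rw [add_sub_cancel_left] at h1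
      have h4 : q s h 0 - Y s = h⁻¹ • (X 0 (s + h) - X 0 s - h • Y s) := by
        rw [smul_sub h⁻¹ (_ - _), inv_smul_smul₀ hne]
      rw [h4, norm_smul, norm_inv, Real.norm_eq_abs, inv_mul_le_iff₀ (abs_pos.2 hne)]
      linarith
    have hcont : ∀ h, ContinuousOn (q s h) (Icc 0 t₁) := fun h =>
      ((hXc (s + h)).fun_sub (hXc s)).const_smul _
    have hder : ∀ h, ∀ r ∈ Ioo 0 t₁,
        HasDerivAt (q s h) (h⁻¹ • (U r (X r (s + h)) - U r (X r s))) r := fun h r hr =>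
      ((hXd (s + h) r hr).fun_sub (hXd s r hr)).const_smul _
    have key := norm_le_of_norm_deriv_le_Ioo (f := fun r => q s h r - q s k r) (K := B)
      (ε := 2 * (ε / (2 * C) * A)) hB0 ((hcont h).fun_sub (hcont k))
      (fun r hr => (hder h r hr).fun_sub (hder k r hr)) (fun r hr => by
        have hr' := Ioo_subset_Icc_self hr
        have h1 := hrem h hh2 hh3 r hr'
        have h2 := hrem k hk2 hk3 r hr'
        have h3 : ‖G r (X r s) (q s h r - q s k r)‖ ≤ B * ‖q s h r - q s k r‖ :=
          ((G r (X r s)).le_opNorm _).trans (by gcongr; exact hB r hr' _ (hXS r hr' s))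
        rw [map_sub] at h3
        set a := h⁻¹ • (U r (X r (s + h)) - U r (X r s))
        set b := k⁻¹ • (U r (X r (s + k)) - U r (X r s))
        calc ‖a - b‖ = ‖(G r (X r s) (q s h r) - G r (X r s) (q s k r)) +
              (a - G r (X r s) (q s h r)) - (b - G r (X r s) (q s k r))‖ := by congr 1; abel
          _ ≤ _ := (norm_sub_le _ _).trans (add_le_add_left (norm_add_le _ _) _)
          _ ≤ _ := by linarith) t ht
    have hinit : ‖q s h 0 - q s k 0‖ ≤ 2 * (ε / (2 * C)) := by
      have h1 := norm_sub_le_norm_sub_add_norm_sub (q s h 0) (Y s) (q s k 0)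
      rw [norm_sub_rev (Y s)] at h1
      linarith [hini h hh2 hh3, hini k hk2 hk3]
    have hE := hexpmono B hB0 t ht
    have hE0 : 0 < Real.exp (B * t₁) := Real.exp_pos _
    calc ‖q s h t - q s k t‖ ≤ _ := key
      _ ≤ 2 * (ε / (2 * C)) * Real.exp (B * t₁) +
          2 * (ε / (2 * C) * A) / B * Real.exp (B * t₁) := by
          gcongr
          linarith
      _ = ε / (2 * C) * C := by rw [hC]; ring
      _ = ε / 2 := by field_simp
      _ < ε := by linarith
  have hsm : ∀ δ > 0, ∀ᶠ h in 𝓝[≠] (0 : ℝ), |h| < δ ∧ h ≠ 0 := by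
    intro δ hδ
    have : ContinuousAt (fun h : ℝ => |h|) 0 := by fun_prop
    refine ((this.eventually_lt_const ?_).filter_mono nhdsWithin_le_nhds).and self_mem_nhdsWithin
    simpa using hδ
  have hdiff : Differentiable ℝ (X t) := by
    intro s
    have hc : Cauchy (map (fun h => q s h t) (𝓝[≠] 0)) := by
      rw [Metric.cauchy_iff]
      refine ⟨inferInstance, fun ε hε => ?_⟩
      obtain ⟨δ, hδ, Hδ⟩ := hcauchy ε hε
      refine ⟨_, image_mem_map (hsm δ hδ), ?_⟩
      rintro _ ⟨h, ⟨hh1, hh2⟩, rfl⟩ _ ⟨k, ⟨hk1, hk2⟩, rfl⟩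
      rw [dist_eq_norm]
      exact Hδ s h k hh1 hh2 hk1 hk2
    obtain ⟨y, hy⟩ := CompleteSpace.complete hc
    exact (hasDerivAt_iff_tendsto_slope_zero.2 hy).differentiableAt
  refine ⟨hdiff, continuous_of_uniform_approx_of_continuous fun V hV => ?_⟩
  obtain ⟨ε, hε, HV⟩ := Metric.mem_uniformity_dist.1 hV
  obtain ⟨δ, hδ, Hδ⟩ := hcauchy (ε / 2) (by positivity)
  refine ⟨fun s => q s (δ / 2) t, ?_, fun s => HV ?_⟩
  · have := hdiff.continuous
    exact ((this.comp (continuous_add_const _)).sub this).const_smul _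
  · have hd := hasDerivAt_iff_tendsto_slope_zero.1 (hdiff s).hasDerivAt
    rw [dist_comm, dist_eq_norm]
    have h2 : ‖q s (δ / 2) t - deriv (X t) s‖ ≤ ε / 2 := by
      refine le_of_tendsto (hd.const_sub (q s (δ / 2) t)).norm ?_
      filter_upwards [hsm δ hδ] with k hk
      refine (Hδ s (δ / 2) k ?_ (by positivity) hk.1 hk.2).le
      rw [abs_of_pos (by positivity)]
      linarith
    linarith

/-! ### Quantities along the interface -/

section Along

variable {J : Set ℝ} {z : ℝ → ℝ → Plane}

theorem VortexSheet.IsClosedCurve.eq_of_eq {α : Type*} {z : ℝ → Plane} (h : IsClosedCurve z)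
    {f : ℝ → α} (hf : Function.Periodic f 1) {s s' : ℝ} (hs : z s = z s') : f s = f s' := by
  have hp : Function.Periodic (fun r => (z r, f r)) 1 := fun r => by
    simp only [h.periodic r, hf r]
  obtain ⟨s'', h1, h2⟩ := hp.exists_abs_sub_le s s'
  obtain ⟨h3, h4⟩ := Prod.ext_iff.1 h1
  have h5 := h.eq_of_abs_sub_lt (s := s) (s' := s'') (by linarith) (hs.trans h3.symm)
  rw [h5]
  exact h4

/-- The parameter `σ t` is chosen without any continuity. Periodicity makes `F t (σ t)` independent
of the choice, and `exists_param_near` offers a choice close to `σ t₀`. -/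
theorem CurveFamily.continuousOn_along {E : Type*} [NormedAddCommGroup E] (h : CurveFamily J z)
    {F : ℝ → ℝ → E} (hF : ContinuousOn (Function.uncurry F) (J ×ˢ univ))
    (hp : ∀ t ∈ J, Function.Periodic (F t) 1) {X : ℝ → Plane} (hX : ContinuousOn X J) {σ : ℝ → ℝ}
    (hσ : ∀ t ∈ J, z t (σ t) = X t) : ContinuousOn (fun t => F t (σ t)) J := by
  intro t₀ ht₀
  rw [Metric.continuousWithinAt_iff]
  intro ε hε
  obtain ⟨δ₁, hδ₁, H₁⟩ := Metric.continuousWithinAt_iff.1 (hF (t₀, σ t₀) ⟨ht₀, mem_univ _⟩) ε hε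
  obtain ⟨δ₂, hδ₂, H₂⟩ := h.exists_param_near ht₀ (σ t₀) hδ₁
  obtain ⟨δ₃, hδ₃, H₃⟩ := Metric.continuousWithinAt_iff.1 (hX t₀ ht₀) δ₂ hδ₂
  refine ⟨min δ₁ (min δ₂ δ₃), by positivity, fun {t} ht htt => ?_⟩
  obtain ⟨ha, hb⟩ := lt_min_iff.1 htt
  obtain ⟨hb, hc⟩ := lt_min_iff.1 hb
  have h1 := H₃ ht hc
  rw [dist_eq_norm, ← hσ t ht, ← hσ t₀ ht₀] at h1
  rw [Real.dist_eq] at ha hb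
  obtain ⟨s', hs', hs''⟩ := H₂ t ht hb _ h1
  rw [(h.curve t ht).eq_of_eq (hp t ht) hs'.symm]
  exact @H₁ (t, s') ⟨ht, mem_univ _⟩ (by
    rw [Prod.dist_eq, Real.dist_eq, Real.dist_eq]
    exact max_lt ha hs'')

variable {g T t₁ : ℝ} {Ω : ℝ → Set Plane} {u : ℝ → Plane → Plane} {p : ℝ → Plane → ℝ}
  {ν : ℝ → ℝ → Plane} {c : ℝ}

/-- A phase need not be convex, so mean value estimates run along the interface, and the chord-arc
bound converts parameters into distances. -/
theorem IsSide.exists_velocity_bounds (h : IsSide (Icc 0 t₁) Ω z ν c) (h1 : t₁ < T)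
    (hE : IsEulerFlow g T Ω u p) : ∃ L > 0,
      (∀ t ∈ Icc 0 t₁, ∀ x ∈ range (z t), ∀ x' ∈ range (z t), ‖u t x' - u t x‖ ≤ L * ‖x' - x‖) ∧
      (∀ t ∈ Icc 0 t₁, ∀ x ∈ range (z t), ‖gradU T Ω u t x‖ ≤ L) ∧
      ∀ ε > 0, ∃ δ > 0, ∀ t ∈ Icc 0 t₁, ∀ x ∈ range (z t), ∀ x' ∈ range (z t), ‖x' - x‖ < δ →
        ‖u t x' - u t x - gradU T Ω u t x (x' - x)‖ ≤ ε * ‖x' - x‖ := by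
  have hF := h.family
  have hper : ∀ t ∈ Icc 0 t₁, Function.Periodic (z t) 1 := fun t ht => (hF.curve t ht).periodic
  have hGc : ContinuousOn (Function.uncurry fun t s => gradU T Ω u t (z t s)) (Icc 0 t₁ ×ˢ univ) := by
    have hc : ContinuousOn (fun q : ℝ × ℝ => (q.1, z q.1 q.2)) (Icc 0 t₁ ×ˢ univ) :=
      continuousOn_fst.prodMk hF.cont
    have hG : ContinuousOn (fun q : ℝ × Plane => gradU T Ω u q.1 q.2)
        (spaceTime (Ico 0 T) fun t => closure (Ω t)) := hE.velocity_grad.continuousOn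
    exact hG.comp (f := fun q : ℝ × ℝ => (q.1, z q.1 q.2)) hc fun q hq =>
      ⟨Icc_subset_Ico_of_lt h1 hq.1, h.mem_closure hq.1 q.2⟩
  have hfc : ContinuousOn (Function.uncurry fun t s => gradU T Ω u t (z t s) (deriv (z t) s))
      (Icc 0 t₁ ×ˢ univ) := hGc.clm_apply hF.cont_deriv
  have hGp : ∀ t ∈ Icc 0 t₁, Function.Periodic (fun s => gradU T Ω u t (z t s)) 1 := by
    intro t ht s
    simp only [hper t ht s]
  have hfp : ∀ t ∈ Icc 0 t₁,
      Function.Periodic (fun s => gradU T Ω u t (z t s) (deriv (z t) s)) 1 := by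
    intro t ht s
    simp only [hper t ht s, (hper t ht).deriv' s]
  obtain ⟨B, hB0, hB⟩ := exists_uniform_bound hF.isCompact hGc hGp
  obtain ⟨B', hB'0, hB'⟩ := exists_uniform_bound hF.isCompact hfc hfp
  obtain ⟨k, hk, hchord⟩ := hF.exists_chord_arc
  have hL : ∀ t ∈ Icc 0 t₁, ∀ x ∈ range (z t), ∀ x' ∈ range (z t),
      ∃ s s', z t s = x ∧ z t s' = x' ∧ k * |s' - s| ≤ ‖x' - x‖ := by
    rintro t ht x ⟨s, rfl⟩ x' ⟨s₁, rfl⟩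
    obtain ⟨s', hs', hs⟩ := (hper t ht).exists_abs_sub_le s s₁
    refine ⟨s, s', rfl, hs', ?_⟩
    rw [← hs']
    exact hchord t ht s s' hs
  refine ⟨max B (B' / k), lt_max_of_lt_left hB0, fun t ht x hx x' hx' => ?_, ?_, fun ε hε => ?_⟩
  · obtain ⟨s, s', rfl, rfl, hss⟩ := hL t ht x hx x' hx'
    have h2 := convex_univ.norm_image_sub_le_of_norm_hasDerivWithin_le (x := s) (y := s')
      (fun s _ => (h.hasDerivAt_velocity h1 hE ht s).hasDerivWithinAt) (fun s _ => hB' t ht s)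
      (mem_univ _) (mem_univ _)
    rw [Real.norm_eq_abs] at h2
    calc _ ≤ _ := h2
      _ = B' / k * (k * |s' - s|) := by field_simp
      _ ≤ _ := by gcongr; exact le_max_right _ _
  · rintro t ht _ ⟨s, rfl⟩
    exact (hB t ht s).trans (le_max_left _ _)
  · have hε' : 0 < k * ε / (1 + B) := by positivity
    obtain ⟨δ₁, hδ₁, H₁⟩ := exists_uniform_modulus hF.isCompact hfc hfp hε'
    obtain ⟨δ₂, hδ₂, H₂⟩ := hF.exists_expansion hε'
    refine ⟨k * min δ₁ δ₂, by positivity, fun t ht x hx x' hx' hxx => ?_⟩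
    obtain ⟨s, s', rfl, rfl, hss⟩ := hL t ht x hx x' hx'
    have hs := lt_of_mul_lt_mul_left (hss.trans_lt hxx) hk.le
    have h2 := norm_sub_sub_smul_le (s := s) (s' := s') (h.hasDerivAt_velocity h1 hE ht)
      fun σ hσ => (H₁ t ht s σ (hσ.trans_lt (hs.trans_le (min_le_left _ _)))).le
    have h3 := H₂ t ht s s' (hs.trans_le (min_le_right _ _))
    set Gs := gradU T Ω u t (z t s)
    have h4 : ‖Gs (z t s' - z t s - (s' - s) • deriv (z t) s)‖ ≤
        B * (k * ε / (1 + B) * |s' - s|) :=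
      (Gs.le_opNorm _).trans (mul_le_mul (hB t ht s) h3 (norm_nonneg _) hB0.le)
    calc ‖u t (z t s') - u t (z t s) - Gs (z t s' - z t s)‖
        = ‖(u t (z t s') - u t (z t s) - (s' - s) • Gs (deriv (z t) s)) -
          Gs (z t s' - z t s - (s' - s) • deriv (z t) s)‖ := by
            congr 1
            simp only [map_sub, map_smul]
            abel
      _ ≤ k * ε / (1 + B) * |s' - s| + B * (k * ε / (1 + B) * |s' - s|) :=
          (norm_sub_le _ _).trans (add_le_add h2 h4)
      _ = ε * (k * |s' - s|) := by field_simp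
      _ ≤ _ := by gcongr

end Along

/-! ### The Lagrangian parametrization of the interface -/

/-- Replacing `τ t` by `τ t₀` changes the inner product by `⟪w, τ⟫ ‖τ t - τ t₀‖ ^ 2 / 2`, since `w`
is parallel to the unit vector `τ`. This is quadratic in time, so a Lipschitz bound for `τ` replaces
its differentiability. -/
theorem hasDerivAt_inner_of_parallel {w τ : ℝ → Plane} {w' : Plane} {t₀ K : ℝ}
    (hw : HasDerivAt w w' t₀) (hτ : ∀ᶠ t in 𝓝 t₀, ‖τ t‖ = 1 ∧ ‖τ t - τ t₀‖ ≤ K * |t - t₀| ∧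
      w t = (inner ℝ (w t) (τ t) : ℝ) • τ t) :
    HasDerivAt (fun t => (inner ℝ (w t) (τ t) : ℝ)) (inner ℝ w' (τ t₀)) t₀ := by
  have h1 : HasDerivAt (fun t => (inner ℝ (w t) (τ t₀) : ℝ)) (inner ℝ w' (τ t₀)) t₀ := by
    simpa using hw.inner ℝ (hasDerivAt_const t₀ (τ t₀))
  have h2 : HasDerivAt (fun t => (inner ℝ (w t) (τ t) : ℝ) - inner ℝ (w t) (τ t₀)) 0 t₀ := by
    have hO : (fun t => (inner ℝ (w t) (τ t) : ℝ) - inner ℝ (w t) (τ t₀)) =O[𝓝 t₀]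
        fun t => ‖t - t₀‖ ^ 2 := by
      refine Asymptotics.IsBigO.of_bound ((‖w t₀‖ + 1) * K ^ 2) ?_
      filter_upwards [hτ, hw.continuousAt.norm.eventually_lt_const (lt_add_one _)] with t ht hwt
      obtain ⟨ha, hb, hc⟩ := ht
      have hτ₀ := hτ.self_of_nhds.1
      have h3 : (inner ℝ (τ t) (τ t - τ t₀) : ℝ) = ‖τ t - τ t₀‖ ^ 2 / 2 := by
        rw [norm_sub_sq_real, inner_sub_right, real_inner_self_eq_norm_sq, ha, hτ₀]
        ring
      have h4 : (inner ℝ (w t) (τ t) : ℝ) - inner ℝ (w t) (τ t₀) =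
          inner ℝ (w t) (τ t) * (‖τ t - τ t₀‖ ^ 2 / 2) := by
        rw [← inner_sub_right]
        conv_lhs => rw [hc]
        rw [inner_smul_left, h3]
        rfl
      have h5 : |(inner ℝ (w t) (τ t) : ℝ)| ≤ ‖w t₀‖ + 1 := by
        refine (abs_real_inner_le_norm _ _).trans ?_
        rw [ha, mul_one]
        exact hwt.le
      rw [h4, norm_mul, Real.norm_eq_abs, Real.norm_eq_abs, abs_of_nonneg (a := _ ^ 2 / 2) (by positivity),
        Real.norm_eq_abs (_ ^ 2), abs_of_nonneg (a := _ ^ 2) (by positivity), Real.norm_eq_abs]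
      have h6 : ‖τ t - τ t₀‖ ^ 2 ≤ K ^ 2 * |t - t₀| ^ 2 := by
        rw [← mul_pow]; gcongr
      calc _ ≤ (‖w t₀‖ + 1) * (K ^ 2 * |t - t₀| ^ 2) := by
            gcongr
            nlinarith [sq_nonneg ‖τ t - τ t₀‖]
        _ = _ := by ring
    have := hO.hasFDerivAt (𝕜 := ℝ) one_lt_two
    exact this.hasDerivAt
  have h3 := h2.fun_add h1
  simpa using h3

theorem norm_inv_smul_sub_le {E : Type*} [NormedAddCommGroup E] [NormedSpace ℝ E] {a b : E}
    (ha : a ≠ 0) (hb : b ≠ 0) : ‖‖a‖⁻¹ • a - ‖b‖⁻¹ • b‖ ≤ 2 * ‖a - b‖ / ‖a‖ := by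
  have ha' := norm_pos_iff.2 ha
  have hb' := norm_pos_iff.2 hb
  have h1 : ‖a‖⁻¹ • a - ‖b‖⁻¹ • b = ‖a‖⁻¹ • ((a - b) + (‖b‖ - ‖a‖) • (‖b‖⁻¹ • b)) := by
    have : ‖b‖⁻¹ • b = ‖a‖⁻¹ • ‖a‖ • ‖b‖⁻¹ • b := by rw [inv_smul_smul₀ ha'.ne']
    rw [sub_smul, smul_inv_smul₀ hb'.ne', smul_add, smul_sub, smul_sub, ← this]
    abel
  have h2 : ‖(‖b‖ - ‖a‖) • (‖b‖⁻¹ • b)‖ ≤ ‖a - b‖ := by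
    rw [norm_smul, norm_smul, norm_inv, norm_norm, inv_mul_cancel₀ hb'.ne', mul_one, norm_sub_rev a b]
    exact abs_norm_sub_norm_le b a
  rw [h1, norm_smul, norm_inv, norm_norm, inv_mul_eq_div]
  gcongr
  exact (norm_add_le _ _).trans (by linarith)

/-- A vortex sheet with its a priori bounds and its Lagrangian flow. -/
structure LagrangianSheet (g T M : ℝ) (D : H4Domain) (Ωp Ωm : ℝ → Set Plane) (z : ℝ → ℝ → Plane)
    (up um : ℝ → Plane → Plane) (pp pm : ℝ → Plane → ℝ) (η : ℝ → Plane → Plane) : Prop where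
  sheet : IsVortexSheet g T D Ωp Ωm z up um pp pm
  bounds : HasBounds T M D z up
  flow : IsLagrangianFlow T Ωm z um η
  time_pos : 0 < T
  bound_pos : 0 < M

namespace LagrangianSheet

variable {g T M t₁ : ℝ} {D : H4Domain} {Ωp Ωm : ℝ → Set Plane} {z : ℝ → ℝ → Plane}
  {up um : ℝ → Plane → Plane} {pp pm : ℝ → Plane → ℝ} {η : ℝ → Plane → Plane}

theorem curve (h : LagrangianSheet g T M D Ωp Ωm z up um pp pm η) {t : ℝ} (ht : t ∈ Ico 0 T) :
    IsClosedCurve (z t) := (h.sheet.partition t ht).curve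

theorem mem_closure (h : LagrangianSheet g T M D Ωp Ωm z up um pp pm η) {t : ℝ} (ht : t ∈ Ico 0 T)
    (s : ℝ) : z t s ∈ closure (Ωm t) ∧ z t s ∈ closure (Ωp t) := by
  obtain ⟨c, hm, hp⟩ := h.bounds.exists_isSide h.sheet h.bound_pos ht.2
  exact ⟨hm.mem_closure (right_mem_Icc.2 ht.1) s, hp.mem_closure (right_mem_Icc.2 ht.1) s⟩

theorem zero_mem (h : LagrangianSheet g T M D Ωp Ωm z up um pp pm η) : (0 : ℝ) ∈ Ico 0 T :=
  ⟨le_rfl, h.time_pos⟩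

theorem mem_range (h : LagrangianSheet g T M D Ωp Ωm z up um pp pm η) {t : ℝ} (ht : t ∈ Ico 0 T)
    (s : ℝ) : η t (z 0 s) ∈ range (z t) := by
  rw [← h.flow.image_interface t ht]
  exact mem_image_of_mem _ (mem_range_self s)

theorem mem_closure' (h : LagrangianSheet g T M D Ωp Ωm z up um pp pm η) {t : ℝ} (ht : t ∈ Ico 0 T)
    (s : ℝ) : η t (z 0 s) ∈ closure (Ωm t) ∧ η t (z 0 s) ∈ closure (Ωp t) := by
  obtain ⟨σ, hσ⟩ := h.mem_range ht s
  rw [← hσ]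
  exact h.mem_closure ht σ

theorem initial (h : LagrangianSheet g T M D Ωp Ωm z up um pp pm η) (s : ℝ) : η 0 (z 0 s) = z 0 s :=
  h.flow.initial _ (h.mem_closure h.zero_mem s).1

theorem hasDerivWithinAt (h : LagrangianSheet g T M D Ωp Ωm z up um pp pm η) (s : ℝ) {t : ℝ}
    (ht : t ∈ Ico 0 T) :
    HasDerivWithinAt (fun r => η r (z 0 s)) (um t (η t (z 0 s))) (Ico 0 T) t :=
  h.flow.ode _ (h.mem_closure h.zero_mem s).1 t ht

theorem hasDerivAt (h : LagrangianSheet g T M D Ωp Ωm z up um pp pm η) (s : ℝ) {t : ℝ}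
    (ht : t ∈ Ioo 0 T) : HasDerivAt (fun r => η r (z 0 s)) (um t (η t (z 0 s))) t :=
  (h.hasDerivWithinAt s (Ioo_subset_Ico_self ht)).hasDerivAt (Ico_mem_nhds ht.1 ht.2)

theorem continuousOn (h : LagrangianSheet g T M D Ωp Ωm z up um pp pm η) (s : ℝ) :
    ContinuousOn (fun r => η r (z 0 s)) (Ico 0 T) :=
  fun _ ht => (h.hasDerivWithinAt s ht).continuousWithinAt

theorem continuousOn_um (h : LagrangianSheet g T M D Ωp Ωm z up um pp pm η) (s : ℝ) :
    ContinuousOn (fun r => um r (η r (z 0 s))) (Ico 0 T) :=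
  h.sheet.flow_m.velocity_cont.comp (f := fun r => (r, η r (z 0 s)))
    (continuousOn_id.prodMk (h.continuousOn s)) fun _ ht => ⟨ht, (h.mem_closure' ht s).1⟩

theorem continuousOn_up (h : LagrangianSheet g T M D Ωp Ωm z up um pp pm η) (s : ℝ) :
    ContinuousOn (fun r => up r (η r (z 0 s))) (Ico 0 T) :=
  h.sheet.flow_p.velocity_cont.comp (f := fun r => (r, η r (z 0 s)))
    (continuousOn_id.prodMk (h.continuousOn s)) fun _ ht => ⟨ht, (h.mem_closure' ht s).2⟩

theorem differentiable (h : LagrangianSheet g T M D Ωp Ωm z up um pp pm η) {t : ℝ}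
    (ht : t ∈ Ico 0 T) : Differentiable ℝ (fun s => η t (z 0 s)) ∧
      Continuous (deriv fun s => η t (z 0 s)) := by
  obtain ⟨c, hm, -⟩ := h.bounds.exists_isSide h.sheet h.bound_pos ht.2
  obtain ⟨L, hL0, hL, hG, hexp⟩ := hm.exists_velocity_bounds ht.2 h.sheet.flow_m
  have hsub := Icc_subset_Ico_of_lt ht.2
  have hcv := h.curve h.zero_mem
  obtain ⟨K, hK, HK⟩ := hcv.periodic.exists_lipschitz hcv.contDiff
  refine differentiable_flow (X := fun t s => η t (z 0 s)) (Y := deriv (z 0)) hL0 hL0 hK hL hG hexp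
    (fun r hr s => h.mem_range (hsub hr) s) (fun s => (h.continuousOn s).mono hsub)
    (fun s r hr => h.hasDerivAt s ⟨hr.1, hr.2.trans ht.2⟩) ?_ ?_ (right_mem_Icc.2 ht.1)
  · simpa only [h.initial] using HK
  · intro ε hε
    obtain ⟨δ, hδ, H⟩ := (curveFamily_const hcv).exists_expansion hε
    exact ⟨δ, hδ, by simpa only [h.initial] using H 0 rfl⟩

theorem differentiableAt (h : LagrangianSheet g T M D Ωp Ωm z up um pp pm η) {t : ℝ}
    (ht : t ∈ Ico 0 T) (s : ℝ) : DifferentiableAt ℝ (fun s => η t (z 0 s)) s :=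
  (h.differentiable ht).1 s

/-- Gronwall forwards and backwards with the Lipschitz constant of `u⁻` on `[0, t₁]`. No uniformity
as `t₁ → T` is claimed. -/
theorem exists_lipschitz (h : LagrangianSheet g T M D Ωp Ωm z up um pp pm η)
    (h1 : t₁ < T) : ∃ L > 0, ∀ t ∈ Icc 0 t₁, ∀ s s',
      ‖η t (z 0 s') - η t (z 0 s)‖ ≤ L * |s' - s| ∧
      ‖um t (η t (z 0 s')) - um t (η t (z 0 s))‖ ≤ L * |s' - s| ∧
      ‖z 0 s' - z 0 s‖ ≤ L * ‖η t (z 0 s') - η t (z 0 s)‖ := by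
  obtain ⟨c, hm, -⟩ := h.bounds.exists_isSide h.sheet h.bound_pos h1
  obtain ⟨L, hL0, hL, -, -⟩ := hm.exists_velocity_bounds h1 h.sheet.flow_m
  have hsub := Icc_subset_Ico_of_lt h1
  obtain ⟨K, hK, HK⟩ := (h.curve h.zero_mem).periodic.exists_lipschitz (h.curve h.zero_mem).contDiff
  set e := Real.exp (L * t₁) with he
  have he0 : 0 < e := Real.exp_pos _
  have hexp : ∀ t ∈ Icc 0 t₁, Real.exp (L * (t - 0)) ≤ e := by
    intro r hr
    rw [he]
    gcongr
    linarith [hr.2]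
  have hd : ∀ s s', ∀ t ∈ Ioo 0 t₁, HasDerivAt (fun t => η t (z 0 s') - η t (z 0 s))
      (um t (η t (z 0 s')) - um t (η t (z 0 s))) t := fun s s' t ht =>
    (h.hasDerivAt s' ⟨ht.1, ht.2.trans h1⟩).fun_sub (h.hasDerivAt s ⟨ht.1, ht.2.trans h1⟩)
  have hc : ∀ s s', ContinuousOn (fun t => η t (z 0 s') - η t (z 0 s)) (Icc 0 t₁) := fun s s' =>
    ((h.continuousOn s').mono hsub).fun_sub ((h.continuousOn s).mono hsub)
  have hb : ∀ s s', ∀ t ∈ Icc 0 t₁, ‖um t (η t (z 0 s')) - um t (η t (z 0 s))‖ ≤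
      L * ‖η t (z 0 s') - η t (z 0 s)‖ := fun s s' t ht =>
    hL t ht _ (h.mem_range (hsub ht) s) _ (h.mem_range (hsub ht) s')
  refine ⟨max e (max (K * e) (L * (K * e))), lt_max_of_lt_left he0, fun t ht s s' => ?_⟩
  have h2 : ‖η t (z 0 s') - η t (z 0 s)‖ ≤ K * e * |s' - s| := by
    have := norm_le_exp_mul_of_norm_deriv_le hL0 (hc s s') (hd s s')
      (fun t ht => hb s s' t (Ioo_subset_Icc_self ht)) t ht
    rw [h.initial, h.initial] at this
    calc _ ≤ _ := this
      _ ≤ K * |s' - s| * e := by gcongr; exacts [HK s s', hexp t ht]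
      _ = _ := by ring
  refine ⟨h2.trans (by gcongr; exact (le_max_left _ _).trans (le_max_right _ _)), ?_, ?_⟩
  · calc _ ≤ _ := hb s s' t ht
      _ ≤ L * (K * e * |s' - s|) := by gcongr
      _ = L * (K * e) * |s' - s| := by ring
      _ ≤ _ := by gcongr; exact (le_max_right _ _).trans (le_max_right _ _)
  · have := norm_left_le_exp_mul_of_norm_deriv_le hL0 ht.1
      ((hc s s').mono (Icc_subset_Icc_right ht.2))
      (fun r hr => hd s s' r ⟨hr.1, hr.2.trans_le ht.2⟩)
      (fun r hr => hb s s' r ⟨hr.1.le, hr.2.le.trans ht.2⟩)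
    rw [h.initial, h.initial] at this
    calc _ ≤ _ := this
      _ ≤ ‖η t (z 0 s') - η t (z 0 s)‖ * e := by gcongr; exact hexp t ht
      _ ≤ _ := by rw [mul_comm]; gcongr; exact le_max_left _ _

/-- The derivative of the Lagrangian parametrization depends Lipschitz continuously on time. -/
theorem norm_deriv_sub_le (h : LagrangianSheet g T M D Ωp Ωm z up um pp pm η) {I : Set ℝ}
    (hI : Convex ℝ I) (hIT : I ⊆ Ico 0 T) {A : ℝ}
    (hA : ∀ t ∈ I, ∀ s s', ‖um t (η t (z 0 s')) - um t (η t (z 0 s))‖ ≤ A * |s' - s|) {t t' : ℝ}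
    (ht : t ∈ I) (ht' : t' ∈ I) (s : ℝ) :
    (∀ s', ‖(η t' (z 0 s') - η t' (z 0 s)) - (η t (z 0 s') - η t (z 0 s))‖ ≤
      A * |t' - t| * |s' - s|) ∧
    ‖deriv (fun s => η t' (z 0 s)) s - deriv (fun s => η t (z 0 s)) s‖ ≤ A * |t' - t| := by
  have h1 : ∀ s', ‖(η t' (z 0 s') - η t' (z 0 s)) - (η t (z 0 s') - η t (z 0 s))‖ ≤
      A * |t' - t| * |s' - s| := by
    intro s'
    have := hI.norm_image_sub_le_of_norm_hasDerivWithin_le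
      (f := fun t => η t (z 0 s') - η t (z 0 s))
      (fun r hr => ((h.hasDerivWithinAt s' (hIT hr)).mono hIT).fun_sub
        ((h.hasDerivWithinAt s (hIT hr)).mono hIT)) (fun r hr => hA r hr s s') ht ht'
    rw [Real.norm_eq_abs] at this
    linarith
  refine ⟨h1, ?_⟩
  have hd := (h.differentiableAt (hIT ht') s).hasDerivAt.fun_sub (h.differentiableAt (hIT ht) s).hasDerivAt
  have hA0 : 0 ≤ A := by
    have := (norm_nonneg _).trans (hA t ht 0 1)
    simpa using this
  refine hd.le_of_lip' (by positivity) (Eventually.of_forall fun s' => ?_)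
  rw [Real.norm_eq_abs]
  refine le_trans (le_of_eq ?_) (h1 s')
  congr 1
  abel

theorem exists_deriv_bounds (h : LagrangianSheet g T M D Ωp Ωm z up um pp pm η)
    (h1 : t₁ < T) : ∃ L > 0, (∀ t ∈ Icc 0 t₁, ∀ s, L⁻¹ ≤ ‖deriv (fun s => η t (z 0 s)) s‖ ∧
      ‖deriv (fun s => η t (z 0 s)) s‖ ≤ L) ∧
      ∀ t ∈ Icc 0 t₁, ∀ t' ∈ Icc 0 t₁, ∀ s,
        ‖deriv (fun s => η t' (z 0 s)) s - deriv (fun s => η t (z 0 s)) s‖ ≤ L * |t' - t| := by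
  obtain ⟨L, hL, H⟩ := h.exists_lipschitz h1
  have hsub := Icc_subset_Ico_of_lt h1
  obtain ⟨b, hb, B, hB, hbB⟩ := (curveFamily_const (h.curve h.zero_mem)).exists_speed_bounds
  replace hbB := hbB 0 rfl
  refine ⟨max L (L / b), lt_max_of_lt_left hL, fun t ht s => ⟨?_, ?_⟩, fun t ht t' ht' s => ?_⟩
  · have hd := hasDerivAt_iff_tendsto_slope_zero.1 (h.differentiableAt (hsub ht) s).hasDerivAt
    have hd0 := hasDerivAt_iff_tendsto_slope_zero.1
      ((h.curve h.zero_mem).differentiable s).hasDerivAt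
    have h2 : ‖deriv (z 0) s‖ ≤ L * ‖deriv (fun s => η t (z 0 s)) s‖ := by
      refine le_of_tendsto_of_tendsto' hd0.norm (hd.norm.const_mul L) fun r => ?_
      rw [norm_smul, norm_smul, mul_left_comm]
      gcongr
      exact (H t ht s (s + r)).2.2
    have h3 := (hbB s).1.trans h2
    have h4 : (L / b)⁻¹ ≤ ‖deriv (fun s => η t (z 0 s)) s‖ := by
      rw [inv_div, div_le_iff₀ hL]
      linarith
    refine le_trans ?_ h4
    gcongr
    exact le_max_right _ _
  · refine ((h.differentiableAt (hsub ht) s).hasDerivAt.le_of_lip' hL.le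
      (Eventually.of_forall fun s' => ?_)).trans (le_max_left _ _)
    exact (H t ht s s').1
  · refine (h.norm_deriv_sub_le (convex_Icc 0 t₁) hsub (fun t ht s s' => (H t ht s s').2.1)
      ht ht' s).2.trans ?_
    gcongr
    exact le_max_left _ _

theorem deriv_ne_zero (h : LagrangianSheet g T M D Ωp Ωm z up um pp pm η) {t : ℝ}
    (ht : t ∈ Ico 0 T) (s : ℝ) : deriv (fun s => η t (z 0 s)) s ≠ 0 := by
  obtain ⟨L, hL, H, -⟩ := h.exists_deriv_bounds ht.2
  exact norm_pos_iff.1 ((inv_pos.2 hL).trans_le (H t (right_mem_Icc.2 ht.1) s).1)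

/-- The interface leaves its tangent line only quadratically, so the normal component of `η t (z 0
s') - η t (z 0 s)` is `O(|s' - s| ^ 2)`. No smooth change of parameters between `η` and `z t` is
needed. -/
theorem inner_deriv_normal (h : LagrangianSheet g T M D Ωp Ωm z up um pp pm η) {t : ℝ}
    (ht : t ∈ Ico 0 T) {s σ : ℝ} (hσ : z t σ = η t (z 0 s)) :
    inner ℝ (deriv (fun s => η t (z 0 s)) s) (normal (z t) σ) = 0 := by
  have htt := right_mem_Icc.2 ht.1
  obtain ⟨L, hL, H⟩ := h.exists_lipschitz ht.2
  obtain ⟨C, hC, HC⟩ := h.bounds.exists_normal_bound h.sheet h.bound_pos ht.2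
  have h1 : HasDerivAt (fun s' => (inner ℝ (η t (z 0 s') - η t (z 0 s)) (normal (z t) σ) : ℝ))
      (inner ℝ (deriv (fun s => η t (z 0 s)) s) (normal (z t) σ)) s := by
    simpa using ((h.differentiableAt ht s).hasDerivAt.sub_const (η t (z 0 s))).inner ℝ
      (hasDerivAt_const s (normal (z t) σ))
  have hO : (fun s' => (inner ℝ (η t (z 0 s') - η t (z 0 s)) (normal (z t) σ) : ℝ)) =O[𝓝 s]
      fun s' => ‖s' - s‖ ^ 2 := by
    refine Asymptotics.IsBigO.of_bound (C * L ^ 2) (Eventually.of_forall fun s' => ?_)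
    obtain ⟨σ', hσ'⟩ := h.mem_range ht s'
    have h2 := HC t htt σ σ'
    rw [hσ, hσ'] at h2
    rw [Real.norm_eq_abs, norm_pow, norm_norm, Real.norm_eq_abs]
    calc _ ≤ _ := h2
      _ ≤ C * (L * |s' - s|) ^ 2 := by gcongr; exact (H t htt s s').1
      _ = _ := by ring
  exact h1.unique (hO.hasFDerivAt (𝕜 := ℝ) one_lt_two).hasDerivAt

/-- The Lagrangian parametrization keeps the orientation of the interface. -/
theorem deriv_eq (h : LagrangianSheet g T M D Ωp Ωm z up um pp pm η) {t : ℝ}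
    (ht : t ∈ Ico 0 T) {s σ : ℝ} (hσ : z t σ = η t (z 0 s)) :
    ‖deriv (fun s => η t (z 0 s)) s‖⁻¹ • deriv (fun s => η t (z 0 s)) s = tangent (z t) σ := by
  have hF := h.sheet.curveFamily ht.2
  have hsub := Icc_subset_Ico_of_lt ht.2
  have hex : ∀ r, ∃ σ', r ∈ Icc 0 t → z r σ' = η r (z 0 s) := by
    intro r
    by_cases hr : r ∈ Icc 0 t
    · obtain ⟨σ', hσ'⟩ := h.mem_range (hsub hr) s
      exact ⟨σ', fun _ => hσ'⟩
    · exact ⟨0, fun h => absurd h hr⟩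
  choose σ' hσ' using hex
  obtain ⟨L, hL, H, H'⟩ := h.exists_deriv_bounds ht.2
  set Y : ℝ → Plane := fun r => deriv (fun s => η r (z 0 s)) s with hY
  have hYc : ContinuousOn Y (Icc 0 t) :=
    (LipschitzOnWith.of_dist_le_mul (K := L.toNNReal) fun r hr r' hr' => by
      rw [dist_eq_norm, Real.dist_eq, Real.coe_toNNReal _ hL.le]
      exact H' r' hr' r hr s).continuousOn
  have hYne : ∀ r ∈ Icc 0 t, Y r ≠ 0 := fun r hr => h.deriv_ne_zero (hsub hr) s
  have hτc : ContinuousOn (fun r => tangent (z r) (σ' r)) (Icc 0 t) :=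
    hF.continuousOn_along (F := fun r => tangent (z r)) hF.continuousOn_tangent
      (fun r hr => periodic_tangent (hF.curve r hr)) ((h.continuousOn s).mono hsub)
      fun r hr => hσ' r hr
  have hic : ContinuousOn (fun r => (inner ℝ (Y r) (tangent (z r) (σ' r)) : ℝ)) (Icc 0 t) :=
    ContinuousOn.inner (𝕜 := ℝ) hYc hτc
  have habs : ∀ r ∈ Icc 0 t, Y r = (inner ℝ (Y r) (tangent (z r) (σ' r)) : ℝ) • tangent (z r) (σ' r) :=
    fun r hr => eq_smul_of_inner_perp_eq_zero (norm_tangent (hF.curve r hr) _)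
      (h.inner_deriv_normal (hsub hr) (hσ' r hr))
  have h00 : (0 : ℝ) ∈ Icc 0 t := left_mem_Icc.2 ht.1
  have htt : t ∈ Icc 0 t := right_mem_Icc.2 ht.1
  have hY0 : Y 0 = deriv (z 0) s := by
    rw [hY]
    have : (fun s => η 0 (z 0 s)) = z 0 := funext h.initial
    simp only [this]
  have hτ0 : tangent (z 0) (σ' 0) = tangent (z 0) s :=
    (hF.curve 0 h00).eq_of_eq (periodic_tangent (hF.curve 0 h00))
      ((hσ' 0 h00).trans (h.initial s))
  have hpos0 : 0 < (inner ℝ (Y 0) (tangent (z 0) (σ' 0)) : ℝ) := by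
    rw [hτ0, hY0, deriv_eq_smul_tangent (hF.curve 0 h00) s, inner_smul_left,
      real_inner_self_eq_norm_sq, norm_tangent (hF.curve 0 h00)]
    simpa using (hF.curve 0 h00).regular s
  -- The signed length is continuous in time, positive at time zero, and cannot vanish because its
  -- modulus is `‖Y r‖ ≠ 0`.
  have hpos : 0 < (inner ℝ (Y t) (tangent (z t) (σ' t)) : ℝ) := by
    by_contra! hle
    obtain ⟨r, hr, hr0⟩ := isPreconnected_Icc.intermediate_value htt h00 hic ⟨hle, hpos0.le⟩
    have := habs r hr
    simp only at hr0
    rw [hr0, zero_smul] at this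
    exact hYne r hr this
  have hτt : tangent (z t) (σ' t) = tangent (z t) σ :=
    (hF.curve t htt).eq_of_eq (periodic_tangent (hF.curve t htt)) ((hσ' t htt).trans hσ.symm)
  have h2 := habs t htt
  have h3 : ‖Y t‖ = inner ℝ (Y t) (tangent (z t) (σ' t)) := by
    conv_lhs => rw [h2]
    rw [norm_smul, norm_tangent (hF.curve t htt), mul_one, Real.norm_eq_abs, abs_of_pos hpos]
  change ‖Y t‖⁻¹ • Y t = _
  rw [← hτt, inv_smul_eq_iff₀ (norm_ne_zero_iff.2 (hYne t htt)), h3]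
  exact h2

end LagrangianSheet

/-! ### The strength of the vortex sheet -/

/-- The unit tangent along the Lagrangian parametrization. -/
noncomputable def lagrangianTangent (z : ℝ → ℝ → Plane) (η : ℝ → Plane → Plane) (t s : ℝ) : Plane :=
  ‖deriv (fun s => η t (z 0 s)) s‖⁻¹ • deriv (fun s => η t (z 0 s)) s

/-- The jump of the tangential velocity across the interface, in Lagrangian coordinates. -/
noncomputable def shear (z : ℝ → ℝ → Plane) (up um : ℝ → Plane → Plane) (η : ℝ → Plane → Plane)
    (t s : ℝ) : ℝ :=
  inner ℝ (um t (η t (z 0 s)) - up t (η t (z 0 s))) (lagrangianTangent z η t s)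

namespace LagrangianSheet

variable {g T M t₁ : ℝ} {D : H4Domain} {Ωp Ωm : ℝ → Set Plane} {z : ℝ → ℝ → Plane}
  {up um : ℝ → Plane → Plane} {pp pm : ℝ → Plane → ℝ} {η : ℝ → Plane → Plane}

theorem sub_eq_shear_smul (h : LagrangianSheet g T M D Ωp Ωm z up um pp pm η) {t : ℝ}
    (ht : t ∈ Ico 0 T) (s : ℝ) : um t (η t (z 0 s)) - up t (η t (z 0 s)) =
      shear z up um η t s • lagrangianTangent z η t s := by
  obtain ⟨σ, hσ⟩ := h.mem_range ht s
  have h1 := h.sheet.normal_jump t ht σ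
  rw [shear, lagrangianTangent, h.deriv_eq ht hσ]
  refine eq_smul_of_inner_perp_eq_zero (norm_tangent (h.curve ht) σ) ?_
  rw [← neg_sub, inner_neg_left, ← hσ, neg_eq_zero]
  exact h1

theorem norm_lagrangianTangent (h : LagrangianSheet g T M D Ωp Ωm z up um pp pm η) {t : ℝ}
    (ht : t ∈ Ico 0 T) (s : ℝ) : ‖lagrangianTangent z η t s‖ = 1 := by
  rw [lagrangianTangent, norm_smul, norm_inv, norm_norm,
    inv_mul_cancel₀ (norm_ne_zero_iff.2 (h.deriv_ne_zero ht s))]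

theorem exists_lipschitz_tangent (h : LagrangianSheet g T M D Ωp Ωm z up um pp pm η)
    (h1 : t₁ < T) : ∃ L > 0, ∀ t ∈ Icc 0 t₁, ∀ t' ∈ Icc 0 t₁, ∀ s,
      ‖lagrangianTangent z η t' s - lagrangianTangent z η t s‖ ≤ L * |t' - t| := by
  obtain ⟨L, hL, H, H'⟩ := h.exists_deriv_bounds h1
  have hsub := Icc_subset_Ico_of_lt h1
  refine ⟨2 * L * L, by positivity, fun t ht t' ht' s => ?_⟩
  have hb := (H t' ht' s).1
  calc _ ≤ _ := norm_inv_smul_sub_le (h.deriv_ne_zero (hsub ht') s) (h.deriv_ne_zero (hsub ht) s)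
    _ ≤ 2 * (L * |t' - t|) / L⁻¹ := by gcongr; exact H' t ht t' ht' s
    _ = _ := by rw [div_inv_eq_mul]; ring

theorem continuousOn_shear (h : LagrangianSheet g T M D Ωp Ωm z up um pp pm η)
    (h1 : t₁ < T) (s : ℝ) : ContinuousOn (fun t => shear z up um η t s) (Icc 0 t₁) := by
  obtain ⟨L, hL, H⟩ := h.exists_lipschitz_tangent h1
  have hsub := Icc_subset_Ico_of_lt h1
  have hτ : ContinuousOn (fun t => lagrangianTangent z η t s) (Icc 0 t₁) :=
    (LipschitzOnWith.of_dist_le_mul (K := L.toNNReal) fun r hr r' hr' => by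
      rw [dist_eq_norm, Real.dist_eq, Real.coe_toNNReal _ hL.le]
      exact H r' hr' r hr s).continuousOn
  exact ContinuousOn.inner (𝕜 := ℝ)
    (((h.continuousOn_um s).mono hsub).fun_sub ((h.continuousOn_up s).mono hsub)) hτ

/-- The evolution of the vortex sheet strength. -/
theorem hasDerivAt_shear (h : LagrangianSheet g T M D Ωp Ωm z up um pp pm η) {t : ℝ}
    (ht : t ∈ Ioo 0 T) {s σ : ℝ} (hσ : z t σ = η t (z 0 s)) :
    HasDerivAt (fun t => shear z up um η t s)
      (tangentialDeriv (z t) (curvature (z t)) σ - shear z up um η t s *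
        inner ℝ (tangentialDeriv (z t) (fun s => up t (z t s)) σ) (tangent (z t) σ)) t := by
  obtain ⟨t₁, htt₁, h1⟩ := exists_between ht.2
  have ht₁ : t ∈ Ioo 0 t₁ := ⟨ht.1, htt₁⟩
  have htc := Ioo_subset_Icc_self ht₁
  have hto := Ioo_subset_Ico_self ht
  have hsub := Icc_subset_Ico_of_lt h1
  obtain ⟨c, hm, hp⟩ := h.bounds.exists_isSide h.sheet h.bound_pos h1
  have hX : ∀ r ∈ Ioo 0 t₁, HasDerivAt (fun r => η r (z 0 s)) (um r (η r (z 0 s))) r :=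
    fun r hr => h.hasDerivAt s ⟨hr.1, hr.2.trans h1⟩
  have hv : ContinuousOn (fun r => um r (η r (z 0 s))) (Ioo 0 t₁) :=
    (h.continuousOn_um s).mono (Ioo_subset_Icc_self.trans hsub)
  have hXz : ∀ r ∈ Ioo 0 t₁, η r (z 0 s) ∈ range (z r) :=
    fun r hr => h.mem_range (hsub (Ioo_subset_Icc_self hr)) s
  have hdm := hm.hasDerivAt_along h1 h.sheet.flow_m hX hv hXz ht₁
  have hdp := hp.hasDerivAt_along h1 h.sheet.flow_p hX hv hXz ht₁
  obtain ⟨L, hL, H⟩ := h.exists_lipschitz_tangent h1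
  -- The jump is parallel to the tangent, so the time derivative of the tangent does not contribute.
  have key := hasDerivAt_inner_of_parallel (τ := fun r => lagrangianTangent z η r s) (K := L)
    (hdm.fun_sub hdp) (by
      filter_upwards [Ioo_mem_nhds ht₁.1 ht₁.2] with r hr
      have hr' := hsub (Ioo_subset_Icc_self hr)
      exact ⟨h.norm_lagrangianTangent hr' s, H t htc r (Ioo_subset_Icc_self hr) s,
        h.sub_eq_shear_smul hr' s⟩)
  have hτ : lagrangianTangent z η t s = tangent (z t) σ := h.deriv_eq hto hσ
  have hb : tangentialDeriv (z t) (fun s => up t (z t s)) σ =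
      gradU T Ωp up t (η t (z 0 s)) (tangent (z t) σ) := by
    rw [tangentialDeriv, (hp.hasDerivAt_velocity h1 h.sheet.flow_p htc σ).deriv, tangent, map_smul, hσ]
  have ha : tangentialDeriv (z t) (curvature (z t)) σ =
      inner ℝ (gradP T Ωp pp t (η t (z 0 s)) - gradP T Ωm pm t (η t (z 0 s))) (tangent (z t) σ) := by
    have h2 := (hp.hasDerivAt_pressure h1 h.sheet.flow_p ht₁ σ).fun_sub
      (hm.hasDerivAt_pressure h1 h.sheet.flow_m ht₁ σ)
    have h3 : (fun s => pp t (z t s) - pm t (z t s)) = curvature (z t) :=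
      funext (h.sheet.pressure_jump t ht)
    rw [h3] at h2
    rw [tangentialDeriv, h2.deriv, tangent, inner_smul_right, inner_sub_left, hσ]
    rfl
  convert! key using 1
  have hw := h.sub_eq_shear_smul hto s
  rw [hτ] at hw
  -- The path follows `u⁻`, which cancels `∇u⁻`. But `u⁺` is differentiated along `u⁻` instead of
  -- `u⁺`, and this leaves `∇u⁺` applied to the jump.
  have h4 : accel g T Ωm um pm t (η t (z 0 s)) + gradU T Ωm um t (η t (z 0 s)) (um t (η t (z 0 s))) -
      (accel g T Ωp up pp t (η t (z 0 s)) + gradU T Ωp up t (η t (z 0 s)) (um t (η t (z 0 s)))) =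
      (gradP T Ωp pp t (η t (z 0 s)) - gradP T Ωm pm t (η t (z 0 s))) -
        gradU T Ωp up t (η t (z 0 s)) (um t (η t (z 0 s)) - up t (η t (z 0 s))) := by
    rw [accel, accel, map_sub]
    abel
  rw [h4, hτ, inner_sub_left, ha, hw, map_smul, inner_smul_left, hb]
  rfl

/-- The evolution equation is linear in the strength, with coefficient and source bounded by `M`;
the source accounts for the summand `1`. -/
theorem abs_shear_le (h : LagrangianSheet g T M D Ωp Ωm z up um pp pm η) {Λ₀ : ℝ}
    (hΛ : ∀ s, |shear z up um η 0 s| ≤ Λ₀) {t : ℝ} (ht : t ∈ Ico 0 T) (s : ℝ) :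
    |shear z up um η t s| ≤ (Λ₀ + 1) * Real.exp (M * T) := by
  have hM := h.bound_pos
  have hsub := Icc_subset_Ico_of_lt ht.2
  have hex : ∀ r, ∃ σ', r ∈ Icc 0 t → z r σ' = η r (z 0 s) := by
    intro r
    by_cases hr : r ∈ Icc 0 t
    · obtain ⟨σ', hσ'⟩ := h.mem_range (hsub hr) s
      exact ⟨σ', fun _ => hσ'⟩
    · exact ⟨0, fun h => absurd h hr⟩
  choose σ hσ using hex
  have key := norm_le_of_norm_deriv_le_Ioo hM (ε := M) (h.continuousOn_shear ht.2 s)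
    (fun r hr => h.hasDerivAt_shear ⟨hr.1, hr.2.trans ht.2⟩ (hσ r (Ioo_subset_Icc_self hr)))
    (fun r hr => by
      have hr' := hsub (Ioo_subset_Icc_self hr)
      obtain ⟨hb, ha⟩ := h.bounds.bounds h.sheet hM hr'
      refine (norm_sub_le _ _).trans ?_
      rw [norm_mul]
      have h1 := ha.grad_bound (σ r)
      have h2 := hb.grad_bound (σ r)
      have h3 : ‖(inner ℝ (tangentialDeriv (z r) (fun s => up r (z r s)) (σ r))
          (tangent (z r) (σ r)) : ℝ)‖ ≤ M := by
        refine (norm_inner_le_norm _ _).trans ?_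
        rwa [norm_tangent (h.curve hr'), mul_one]
      have h4 := mul_le_mul_of_nonneg_left h3 (norm_nonneg (shear z up um η r s))
      linarith) t (right_mem_Icc.2 ht.1)
  rw [Real.norm_eq_abs, Real.norm_eq_abs, div_self hM.ne', one_mul] at key
  have he : Real.exp (M * (t - 0)) ≤ Real.exp (M * T) := by
    gcongr
    linarith [ht.2]
  have h0 := hΛ s
  have h00 := abs_nonneg (shear z up um η 0 s)
  calc _ ≤ _ := key
    _ ≤ Λ₀ * Real.exp (M * T) + Real.exp (M * T) := by
        have h5 := Real.exp_pos (M * (t - 0))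
        have h6 := mul_le_mul h0 he h5.le (h00.trans h0)
        linarith
    _ = _ := by ring

theorem norm_um_le (h : LagrangianSheet g T M D Ωp Ωm z up um pp pm η) {Λ : ℝ} {t : ℝ}
    (ht : t ∈ Ico 0 T) {s : ℝ} (hΛ : |shear z up um η t s| ≤ Λ) :
    ‖um t (η t (z 0 s))‖ ≤ M + Λ := by
  obtain ⟨σ, hσ⟩ := h.mem_range ht s
  have h1 := (h.bounds.bounds h.sheet h.bound_pos ht).1.bound σ
  simp only [hσ] at h1
  have h2 := h.sub_eq_shear_smul ht s
  rw [sub_eq_iff_eq_add'] at h2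
  rw [h2]
  refine (norm_add_le _ _).trans (add_le_add h1 ?_)
  rwa [norm_smul, h.norm_lagrangianTangent ht, mul_one, Real.norm_eq_abs]

/-- Growth bounds for differences, in terms of the differences of positions and strengths. -/
theorem norm_um_sub_le (h : LagrangianSheet g T M D Ωp Ωm z up um pp pm η) {Λ d : ℝ}
    {t : ℝ} (ht : t ∈ Ico 0 T) {s s' σ σ' : ℝ} (hΛ : |shear z up um η t s| ≤ Λ)
    (hσ : z t σ = η t (z 0 s)) (hσ' : z t σ' = η t (z 0 s'))
    (hd : arcLength (z t) σ σ' ≤ d) :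
    ‖um t (η t (z 0 s')) - um t (η t (z 0 s))‖ ≤
      (M + Λ * M) * d + |shear z up um η t s' - shear z up um η t s| ∧
    |(tangentialDeriv (z t) (curvature (z t)) σ' - shear z up um η t s' *
        inner ℝ (tangentialDeriv (z t) (fun s => up t (z t s)) σ') (tangent (z t) σ')) -
      (tangentialDeriv (z t) (curvature (z t)) σ - shear z up um η t s *
        inner ℝ (tangentialDeriv (z t) (fun s => up t (z t s)) σ) (tangent (z t) σ))| ≤
      (M + Λ * M + Λ * M * M) * d + M * |shear z up um η t s' - shear z up um η t s| := by
  have hM := h.bound_pos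
  obtain ⟨hb, ha⟩ := h.bounds.bounds h.sheet hM ht
  have hτ : ‖tangent (z t) σ' - tangent (z t) σ‖ ≤ M * d :=
    (h.bounds.norm_tangent_sub_le h.sheet hM ht σ σ').trans (by gcongr)
  have hT := norm_tangent (h.curve ht)
  have hΛ0 : 0 ≤ Λ := (abs_nonneg _).trans hΛ
  set l := shear z up um η t s with hl
  set l' := shear z up um η t s' with hl'
  constructor
  · have h1 := h.sub_eq_shear_smul ht s
    have h2 := h.sub_eq_shear_smul ht s'
    rw [sub_eq_iff_eq_add', lagrangianTangent, h.deriv_eq ht hσ, ← hl] at h1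
    rw [sub_eq_iff_eq_add', lagrangianTangent, h.deriv_eq ht hσ', ← hl'] at h2
    have h3 := (hb.lip σ σ').trans (mul_le_mul_of_nonneg_left hd hM.le)
    simp only [hσ, hσ'] at h3
    have h4 : um t (η t (z 0 s')) - um t (η t (z 0 s)) = (up t (η t (z 0 s')) - up t (η t (z 0 s))) +
        ((l' - l) • tangent (z t) σ' + l • (tangent (z t) σ' - tangent (z t) σ)) := by
      rw [h1, h2, sub_smul, smul_sub]
      abel
    have h5 : ‖(l' - l) • tangent (z t) σ'‖ = |l' - l| := by
      rw [norm_smul, hT, mul_one, Real.norm_eq_abs]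
    have h6 : ‖l • (tangent (z t) σ' - tangent (z t) σ)‖ ≤ Λ * (M * d) := by
      rw [norm_smul, Real.norm_eq_abs]
      gcongr
    rw [h4]
    calc _ ≤ _ := norm_add_le _ _
      _ ≤ _ := add_le_add_right (norm_add_le _ _) _
      _ ≤ _ := by linarith
  · set a := tangentialDeriv (z t) (curvature (z t)) σ
    set a' := tangentialDeriv (z t) (curvature (z t)) σ'
    set b := tangentialDeriv (z t) (fun s => up t (z t s)) σ
    set b' := tangentialDeriv (z t) (fun s => up t (z t s)) σ'
    set τ := tangent (z t) σ
    set τ' := tangent (z t) σ'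
    have h1 : |a' - a| ≤ M * d := (ha.grad_lip σ σ').trans (mul_le_mul_of_nonneg_left hd hM.le)
    have h2 : ‖b' - b‖ ≤ M * d := (hb.grad_lip σ σ').trans (mul_le_mul_of_nonneg_left hd hM.le)
    have hb0 : ‖b‖ ≤ M := hb.grad_bound σ
    have hb1 : ‖b'‖ ≤ M := hb.grad_bound σ'
    have h3 : |(inner ℝ b' τ' : ℝ)| ≤ M := by
      refine (abs_real_inner_le_norm _ _).trans ?_
      rwa [hT, mul_one]
    have h4 : |(inner ℝ (b' - b) τ' : ℝ)| ≤ M * d := by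
      refine (abs_real_inner_le_norm _ _).trans ?_
      rwa [hT, mul_one]
    have h5 : |(inner ℝ b (τ' - τ) : ℝ)| ≤ M * (M * d) :=
      (abs_real_inner_le_norm _ _).trans (mul_le_mul hb0 hτ (norm_nonneg _) hM.le)
    have h6 : (a' - l' * inner ℝ b' τ') - (a - l * inner ℝ b τ) = (a' - a) -
        ((l' - l) * inner ℝ b' τ' + (l * inner ℝ (b' - b) τ' + l * inner ℝ b (τ' - τ))) := by
      rw [inner_sub_left, inner_sub_right]
      ring
    have h7 : |(l' - l) * inner ℝ b' τ'| ≤ |l' - l| * M := by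
      rw [abs_mul]; gcongr
    have h8 : |l * inner ℝ (b' - b) τ'| ≤ Λ * (M * d) := by
      rw [abs_mul]; gcongr
    have h9 : |l * inner ℝ b (τ' - τ)| ≤ Λ * (M * (M * d)) := by
      rw [abs_mul]; gcongr
    rw [h6]
    have h10 := abs_sub (a' - a) ((l' - l) * inner ℝ b' τ' + (l * inner ℝ (b' - b) τ' + l * inner ℝ b (τ' - τ)))
    have h11 := abs_add_le ((l' - l) * inner ℝ b' τ') (l * inner ℝ (b' - b) τ' + l * inner ℝ b (τ' - τ))
    have h12 := abs_add_le (l * inner ℝ (b' - b) τ') (l * inner ℝ b (τ' - τ))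
    linarith

/-- Close points of the interface have close parameters. -/
theorem exists_param (h : LagrangianSheet g T M D Ωp Ωm z up um pp pm η) (h1 : t₁ < T) :
    ∃ ρ > 0, ∀ t ∈ Icc 0 t₁, ∀ s s', |s' - s| < ρ → ∃ σ σ', z t σ = η t (z 0 s) ∧
      z t σ' = η t (z 0 s') ∧ arcLength (z t) σ σ' ≤ 2 * ‖η t (z 0 s') - η t (z 0 s)‖ := by
  have hF := h.sheet.curveFamily h1
  have hsub := Icc_subset_Ico_of_lt h1
  obtain ⟨δ, hδ, Hδ⟩ := hF.exists_arcLength_le_chord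
  obtain ⟨k, hk, hchord⟩ := hF.exists_chord_arc
  obtain ⟨L, hL, HL⟩ := h.exists_lipschitz h1
  refine ⟨k * δ / L, by positivity, fun t ht s s' hs => ?_⟩
  obtain ⟨σ, hσ⟩ := h.mem_range (hsub ht) s
  obtain ⟨σ₁, hσ₁⟩ := h.mem_range (hsub ht) s'
  obtain ⟨σ', hσ', hσσ'⟩ := (hF.curve t ht).periodic.exists_abs_sub_le σ σ₁
  rw [hσ₁] at hσ'
  refine ⟨σ, σ', hσ, hσ', ?_⟩
  rw [← hσ, ← hσ']
  refine Hδ t ht σ σ' ?_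
  have h2 := hchord t ht σ σ' hσσ'
  rw [hσ, hσ'] at h2
  have h3 := (HL t ht s s').1
  rw [lt_div_iff₀ hL] at hs
  exact lt_of_mul_lt_mul_left (by linarith) hk.le

theorem hasDerivAt_um (h : LagrangianSheet g T M D Ωp Ωm z up um pp pm η) {t : ℝ}
    (ht : t ∈ Ico 0 T) (s : ℝ) : HasDerivAt (fun s => um t (η t (z 0 s)))
      (gradU T Ωm um t (η t (z 0 s)) (deriv (fun s => η t (z 0 s)) s)) s := by
  obtain ⟨c, hm, -⟩ := h.bounds.exists_isSide h.sheet h.bound_pos ht.2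
  obtain ⟨-, -, -, -, hexp⟩ := hm.exists_velocity_bounds ht.2 h.sheet.flow_m
  have htt := right_mem_Icc.2 ht.1
  obtain ⟨L, hL, H⟩ := h.exists_lipschitz ht.2
  have hX := (h.differentiableAt ht s).hasDerivAt
  set G := gradU T Ωm um t (η t (z 0 s)) with hG
  suffices h2 : HasDerivAt (fun s' => um t (η t (z 0 s')) - G (η t (z 0 s'))) 0 s by
    have h3 := h2.fun_add (G.hasFDerivAt.comp_hasDerivAt s hX)
    simpa using h3
  rw [hasDerivAt_iff_isLittleO, Asymptotics.isLittleO_iff]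
  intro ε hε
  obtain ⟨δ, hδ, Hδ⟩ := hexp (ε / L) (by positivity)
  have hc := hX.continuousAt.eventually (Metric.ball_mem_nhds (η t (z 0 s)) hδ)
  filter_upwards [hc] with s' hs'
  rw [smul_zero, sub_zero]
  rw [dist_eq_norm] at hs'
  have h3 := Hδ t htt _ (h.mem_range ht s) _ (h.mem_range ht s') hs'
  calc _ = ‖um t (η t (z 0 s')) - um t (η t (z 0 s)) - G (η t (z 0 s') - η t (z 0 s))‖ := by
        rw [map_sub]; congr 1; abel
    _ ≤ _ := h3
    _ ≤ ε / L * (L * |s' - s|) := by gcongr; exact (H t htt s s').1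
    _ = _ := by rw [Real.norm_eq_abs]; field_simp

/-- Bounds for the Lagrangian parametrization and the velocity in terms of the initial data. -/
theorem deriv_le_of_initial (h : LagrangianSheet g T M D Ωp Ωm z up um pp pm η) {Λ K K₀ A : ℝ}
    (hΛ : ∀ t ∈ Ico 0 T, ∀ s, |shear z up um η t s| ≤ Λ) (hΛ0 : 0 ≤ Λ)
    (hK : K = 1 + 5 * M + 4 * (Λ * M) + 2 * (Λ * M * M)) (hA : A = (1 + K) * (K₀ * Real.exp (K * T)))
    (h0 : ∀ s s', ‖z 0 s' - z 0 s‖ ≤ K₀ * |s' - s| ∧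
      |shear z up um η 0 s' - shear z up um η 0 s| ≤ K₀ * |s' - s|) {t : ℝ} (ht : t ∈ Ico 0 T) (s : ℝ) :
    ‖deriv (fun s => η t (z 0 s)) s‖ ≤ A ∧
      ‖gradU T Ωm um t (η t (z 0 s)) (deriv (fun s => η t (z 0 s)) s)‖ ≤ A := by
  have hM := h.bound_pos
  have hLM : 0 ≤ Λ * M := mul_nonneg hΛ0 hM.le
  have hLMM : 0 ≤ Λ * M * M := mul_nonneg hLM hM.le
  have hK0 : 0 < K := by rw [hK]; linarith
  have hK₀ : 0 ≤ K₀ := by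
    have := (norm_nonneg _).trans (h0 0 1).1
    simpa using this
  have hsub := Icc_subset_Ico_of_lt ht.2
  have htt := right_mem_Icc.2 ht.1
  obtain ⟨ρ, hρ, Hρ⟩ := h.exists_param ht.2
  -- How close `s'` must be to `s` depends on `t`, through `exists_param`; the constant `A` does
  -- not.
  have key : ∀ᶠ s' in 𝓝 s, ‖η t (z 0 s') - η t (z 0 s)‖ ≤ A * ‖s' - s‖ ∧
      ‖um t (η t (z 0 s')) - um t (η t (z 0 s))‖ ≤ A * ‖s' - s‖ := by
    filter_upwards [Metric.ball_mem_nhds s hρ] with s' hs'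
    rw [Metric.mem_ball, Real.dist_eq] at hs'
    have hex : ∀ r, ∃ σ σ', r ∈ Icc 0 t → z r σ = η r (z 0 s) ∧ z r σ' = η r (z 0 s') ∧
        arcLength (z r) σ σ' ≤ 2 * ‖η r (z 0 s') - η r (z 0 s)‖ := by
      intro r
      by_cases hr : r ∈ Icc 0 t
      · obtain ⟨σ, σ', hh⟩ := Hρ r hr s s' hs'
        exact ⟨σ, σ', fun _ => hh⟩
      · exact ⟨0, 0, fun h => absurd h hr⟩
    choose σ σ' hσ using hex
    -- Neither component closes alone: the velocity involves the strength, and the equation for the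
    -- strength involves the position through `H`, `u⁺` and the tangent.
    set E : ℝ → Plane × ℝ := fun r =>
      (η r (z 0 s') - η r (z 0 s), shear z up um η r s' - shear z up um η r s) with hE
    have hfst : ∀ r, ‖η r (z 0 s') - η r (z 0 s)‖ ≤ ‖E r‖ := fun r => norm_fst_le (E r)
    have hsnd : ∀ r, |shear z up um η r s' - shear z up um η r s| ≤ ‖E r‖ := fun r => norm_snd_le (E r)
    have hum : ∀ r ∈ Icc 0 t, ‖um r (η r (z 0 s')) - um r (η r (z 0 s))‖ ≤ K * ‖E r‖ := by
      intro r hr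
      obtain ⟨ha, hb, hc⟩ := hσ r hr
      have h1 := (h.norm_um_sub_le (hsub hr) (hΛ r (hsub hr) s) ha hb hc).1
      have h2 := mul_le_mul_of_nonneg_left (hfst r) (by positivity : 0 ≤ 2 * (M + Λ * M))
      have h3 := hsnd r
      have h4 := norm_nonneg (E r)
      calc _ ≤ _ := h1
        _ ≤ (1 + 2 * (M + Λ * M)) * ‖E r‖ := by linarith
        _ ≤ K * ‖E r‖ := by gcongr; rw [hK]; linarith
    -- `K` is the sum of the growth constants of the two components, with arc length replaced by
    -- twice the chord.
    have hgron := norm_le_exp_mul_of_norm_deriv_le (f := E) (a := 0) (b := t) hK0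
      (((((h.continuousOn s').mono hsub).fun_sub ((h.continuousOn s).mono hsub))).prodMk
        ((h.continuousOn_shear ht.2 s').fun_sub (h.continuousOn_shear ht.2 s)))
      (fun r hr => by
        have hr' : r ∈ Ioo 0 T := ⟨hr.1, hr.2.trans ht.2⟩
        obtain ⟨ha, hb, hc⟩ := hσ r (Ioo_subset_Icc_self hr)
        exact ((h.hasDerivAt s' hr').fun_sub (h.hasDerivAt s hr')).prodMk
          ((h.hasDerivAt_shear hr' hb).fun_sub (h.hasDerivAt_shear hr' ha)))
      (fun r hr => by
        have hr' := Ioo_subset_Icc_self hr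
        obtain ⟨ha, hb, hc⟩ := hσ r hr'
        refine max_le (hum r hr') ?_
        have h1 := (h.norm_um_sub_le (hsub hr') (hΛ r (hsub hr') s) ha hb hc).2
        have h2 := mul_le_mul_of_nonneg_left (hfst r) (by positivity : 0 ≤ 2 * (M + Λ * M + Λ * M * M))
        have h3 := mul_le_mul_of_nonneg_left (hsnd r) hM.le
        have h4 := norm_nonneg (E r)
        calc _ ≤ _ := h1
          _ ≤ (2 * (M + Λ * M + Λ * M * M) + M) * ‖E r‖ := by linarith
          _ ≤ K * ‖E r‖ := by gcongr; rw [hK]; linarith) t htt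
    have hE0 : ‖E 0‖ ≤ K₀ * |s' - s| := by
      refine max_le ?_ (h0 s s').2
      change ‖η 0 (z 0 s') - η 0 (z 0 s)‖ ≤ _
      rw [h.initial, h.initial]
      exact (h0 s s').1
    have hEt : ‖E t‖ ≤ K₀ * Real.exp (K * T) * |s' - s| := by
      have he : Real.exp (K * (t - 0)) ≤ Real.exp (K * T) := by
        gcongr
        linarith [ht.2]
      calc _ ≤ _ := hgron
        _ ≤ K₀ * |s' - s| * Real.exp (K * T) := by gcongr
        _ = _ := by ring
    have hq : 0 ≤ K₀ * Real.exp (K * T) * |s' - s| := by positivity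
    rw [Real.norm_eq_abs, hA]
    constructor
    · calc _ ≤ _ := (hfst t).trans hEt
        _ ≤ (1 + K) * (K₀ * Real.exp (K * T) * |s' - s|) := by nlinarith
        _ = _ := by ring
    · calc _ ≤ _ := hum t htt
        _ ≤ K * (K₀ * Real.exp (K * T) * |s' - s|) := by gcongr
        _ ≤ (1 + K) * (K₀ * Real.exp (K * T) * |s' - s|) := by nlinarith
        _ = _ := by ring
  have hA0 : 0 ≤ A := by rw [hA]; positivity
  exact ⟨(h.differentiableAt ht s).hasDerivAt.le_of_lip' hA0 (key.mono fun _ hs => hs.1),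
    (h.hasDerivAt_um ht s).le_of_lip' hA0 (key.mono fun _ hs => hs.2)⟩

end LagrangianSheet

/-! ### Symmetric trace-free matrices -/

/-- The gradient of an irrotational, incompressible vector field. -/
def SymmTraceFree (A : Plane →L[ℝ] Plane) : Prop :=
  A (basisVec 0) 1 - A (basisVec 1) 0 = 0 ∧ A (basisVec 0) 0 + A (basisVec 1) 1 = 0

theorem plane_eq_sum (v : Plane) : v = v 0 • basisVec 0 + v 1 • basisVec 1 := by
  ext i
  fin_cases i <;> simp [basisVec]

theorem norm_basisVec (i : Fin 2) : ‖basisVec i‖ = 1 := by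
  rw [basisVec, EuclideanSpace.single, PiLp.norm_single, norm_one]

/-- The matrix with rows `(a, b)` and `(b, -a)` is `√(a ^ 2 + b ^ 2)` times a reflection. Hence the
derivative in one direction determines the size of the whole gradient. -/
theorem SymmTraceFree.norm_apply {A : Plane →L[ℝ] Plane} (h : SymmTraceFree A) (v : Plane) :
    ‖A v‖ = ‖A (basisVec 0)‖ * ‖v‖ := by
  obtain ⟨h1, h2⟩ := h
  rw [← sq_eq_sq₀ (norm_nonneg _) (by positivity), mul_pow, plane_norm_sq v,
    plane_norm_sq (A (basisVec 0))]
  conv_lhs => rw [plane_eq_sum v]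
  rw [map_add, map_smul, map_smul, plane_norm_sq]
  simp only [PiLp.add_apply, PiLp.smul_apply, smul_eq_mul]
  rw [← sub_eq_zero.1 h1, eq_neg_of_add_eq_zero_right h2]
  ring

theorem SymmTraceFree.norm_eq {A : Plane →L[ℝ] Plane} (h : SymmTraceFree A) :
    ‖A‖ = ‖A (basisVec 0)‖ := by
  refine le_antisymm (A.opNorm_le_bound (norm_nonneg _) fun v => (h.norm_apply v).le) ?_
  have := A.le_opNorm (basisVec 0)
  rwa [norm_basisVec, mul_one] at this

theorem SymmTraceFree.norm_apply_eq {A : Plane →L[ℝ] Plane} (h : SymmTraceFree A) (v : Plane) :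
    ‖A v‖ = ‖A‖ * ‖v‖ := by
  rw [h.norm_apply, h.norm_eq]

theorem isClosed_symmTraceFree : IsClosed {A | SymmTraceFree A} := by
  have hc : ∀ i j : Fin 2, Continuous fun A : Plane →L[ℝ] Plane => A (basisVec i) j := by
    intro i j
    have h1 : Continuous fun A : Plane →L[ℝ] Plane => A (basisVec i) := by fun_prop
    exact (EuclideanSpace.proj j : Plane →L[ℝ] ℝ).continuous.comp h1
  exact (isClosed_eq ((hc 0 1).sub (hc 1 0)) continuous_const).and
    (isClosed_eq ((hc 0 0).add (hc 1 1)) continuous_const)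

theorem toComplex_symm_one : toComplex.symm 1 = basisVec 0 := by
  rw [LinearIsometryEquiv.symm_apply_eq, toComplex_apply]
  simp [basisVec]

theorem toComplex_symm_I : toComplex.symm Complex.I = basisVec 1 := by
  rw [LinearIsometryEquiv.symm_apply_eq, toComplex_apply]
  simp [basisVec]

/-- The complex velocity `u₁ - i u₂`. -/
noncomputable def complexVelocity (u : Plane → Plane) (w : ℂ) : ℂ :=
  (starRingEnd ℂ) (toComplex (u (toComplex.symm w)))

/-- The derivative of the complex velocity, in terms of the velocity gradient. -/
noncomputable def complexGradient (G : Plane → Plane →L[ℝ] Plane) (w : ℂ) : ℂ :=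
  (starRingEnd ℂ) (toComplex (G (toComplex.symm w) (basisVec 0)))

/-- Vanishing curl and divergence are the Cauchy–Riemann equations for `u₁ - i u₂`. -/
theorem hasDerivAt_complexVelocity {u : Plane → Plane} {G : Plane → Plane →L[ℝ] Plane} {w : ℂ}
    (hu : HasFDerivAt u (G (toComplex.symm w)) (toComplex.symm w))
    (hG : SymmTraceFree (G (toComplex.symm w))) :
    HasDerivAt (complexVelocity u) (complexGradient G w) w := by
  set A := G (toComplex.symm w) with hA
  have h1 : HasFDerivAt (complexVelocity u) ((Complex.conjCLE : ℂ →L[ℝ] ℂ).comp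
      ((toComplex.toContinuousLinearEquiv : Plane →L[ℝ] ℂ).comp
        (A.comp (toComplex.symm.toContinuousLinearEquiv : ℂ →L[ℝ] Plane)))) w :=
    (Complex.conjCLE : ℂ →L[ℝ] ℂ).hasFDerivAt.comp w
      ((toComplex.toContinuousLinearEquiv : Plane →L[ℝ] ℂ).hasFDerivAt.comp w
        (hu.comp w (toComplex.symm.toContinuousLinearEquiv : ℂ →L[ℝ] Plane).hasFDerivAt))
  have h2 : HasFDerivAt (complexVelocity u)
      (ContinuousLinearMap.toSpanSingleton ℂ (complexGradient G w)) w := by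
    refine hasFDerivAt_of_restrictScalars ℝ h1 ?_
    refine ContinuousLinearMap.ext fun v => ?_
    have hv : toComplex.symm v = v.re • basisVec 0 + v.im • basisVec 1 := by
      rw [LinearIsometryEquiv.symm_apply_eq, map_add, map_smul, map_smul, ← toComplex_symm_one,
        ← toComplex_symm_I, LinearIsometryEquiv.apply_symm_apply,
        LinearIsometryEquiv.apply_symm_apply]
      simp
    obtain ⟨ha, hb⟩ := hG
    have h3 : ((A (basisVec 1) 0 : ℝ) : ℂ) = A (basisVec 0) 1 := by
      rw [sub_eq_zero.1 ha]
    have h4 : ((A (basisVec 1) 1 : ℝ) : ℂ) = -A (basisVec 0) 0 := by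
      rw [eq_neg_of_add_eq_zero_right hb]; push_cast; rfl
    change v * complexGradient G w = (starRingEnd ℂ) (toComplex (A (toComplex.symm v)))
    rw [hv, complexGradient, ← hA, map_add, map_smul, map_smul, map_add, map_smul, map_smul,
      toComplex_apply, toComplex_apply, h3, h4]
    conv_lhs => rw [← Complex.re_add_im v]
    simp only [map_add, map_mul, Complex.conj_ofReal, Complex.conj_I, map_neg, Complex.real_smul]
    linear_combination (-(v.im : ℂ) * (A (basisVec 0) 1)) * Complex.I_mul_I
  simpa using h2.hasDerivAt

theorem norm_complexGradient {G : Plane → Plane →L[ℝ] Plane} {w : ℂ}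
    (hG : SymmTraceFree (G (toComplex.symm w))) :
    ‖complexGradient G w‖ = ‖G (toComplex.symm w)‖ := by
  rw [complexGradient, Complex.norm_conj, LinearIsometryEquiv.norm_map, hG.norm_eq]

theorem norm_complexVelocity (u : Plane → Plane) (w : ℂ) :
    ‖complexVelocity u w‖ = ‖u (toComplex.symm w)‖ := by
  rw [complexVelocity, Complex.norm_conj, LinearIsometryEquiv.norm_map]

theorem im_conj_mul (x τ : Plane) :
    ((starRingEnd ℂ) (toComplex x) * toComplex τ).im = -inner ℝ x (perp τ) := by
  rw [toComplex_apply, toComplex_apply, plane_inner, perp_zero, perp_one]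
  simp
  ring

/-! ### The diameter of a closed curve -/

/-- At a point farthest from `z 0` the derivative of the squared distance vanishes. Half its second
derivative in arc length is `1 - H ⟪z - z 0, N⟫`, which would be positive at a distance below `1 /
M`, contradicting maximality. -/
theorem exists_le_norm_sub_of_curvature_le {z : ℝ → Plane} (h : IsClosedCurve z) (hz : ContDiff ℝ 3 z)
    {M : ℝ} (hM : 0 < M) (hH : ∀ s, ‖curvature z s‖ ≤ M) : ∃ s, 1 / M ≤ ‖z s - z 0‖ := by
  obtain ⟨_, ⟨s₀, rfl⟩, hmax⟩ := h.isCompact_range.exists_isMaxOn ⟨z 0, mem_range_self 0⟩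
    (f := fun x => ‖x - z 0‖ ^ 2) (by fun_prop)
  refine ⟨s₀, ?_⟩
  by_contra! hlt
  have hmax' : ∀ s, ‖z s - z 0‖ ^ 2 ≤ ‖z s₀ - z 0‖ ^ 2 := fun s => hmax (mem_range_self s)
  set ψ : ℝ → ℝ := fun s => inner ℝ (z s - z 0) (tangent z s) with hψ
  have hzd : ∀ s, HasDerivAt z (deriv z s) s := fun s => (h.differentiable s).hasDerivAt
  have hpos : ∀ s, 0 < ‖deriv z s‖ := fun s => norm_pos_iff.2 (h.regular s)
  have hφ : ∀ s, HasDerivAt (fun s => ‖z s - z 0‖ ^ 2) (2 * (‖deriv z s‖ * ψ s)) s := by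
    intro s
    convert! ((hzd s).sub_const (z 0)).norm_sq using 1
    rw [hψ]
    conv_rhs => rw [deriv_eq_smul_tangent h s, inner_smul_right]
  have hψ0 : ψ s₀ = 0 := by
    have hloc : IsLocalMax (fun s => ‖z s - z 0‖ ^ 2) s₀ := Eventually.of_forall hmax'
    have := hloc.hasDerivAt_eq_zero (hφ s₀)
    have h2 := (hpos s₀).ne'
    simpa [h2] using this
  have hψd : HasDerivAt ψ (‖deriv z s₀‖ * (1 - curvature z s₀ *
      inner ℝ (z s₀ - z 0) (normal z s₀))) s₀ := by
    have := ((hzd s₀).sub_const (z 0)).inner ℝ (hasDerivAt_tangent h hz s₀)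
    convert! this using 1
    rw [neg_smul, inner_neg_right, inner_smul_right]
    conv_rhs => rw [deriv_eq_smul_tangent h s₀, inner_smul_left, real_inner_self_eq_norm_sq,
      norm_tangent h]
    simp only [norm_smul, norm_norm, norm_tangent h, conj_trivial]
    ring
  have hder : 0 < ‖deriv z s₀‖ * (1 - curvature z s₀ * inner ℝ (z s₀ - z 0) (normal z s₀)) := by
    refine mul_pos (hpos s₀) ?_
    have h1 : curvature z s₀ * inner ℝ (z s₀ - z 0) (normal z s₀) ≤ M * ‖z s₀ - z 0‖ := by
      refine (le_abs_self _).trans ?_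
      rw [abs_mul]
      refine mul_le_mul (hH s₀) ?_ (abs_nonneg _) hM.le
      have := abs_real_inner_le_norm (z s₀ - z 0) (normal z s₀)
      rwa [norm_normal h, mul_one] at this
    rw [lt_div_iff₀ hM] at hlt
    linarith
  have hev : ∀ᶠ s in 𝓝[>] s₀, 0 < ψ s := by
    have h1 := (hasDerivAt_iff_tendsto_slope.1 hψd).eventually_const_lt hder
    have h2 : 𝓝[>] s₀ ≤ 𝓝[≠] s₀ := nhdsWithin_mono _ fun s hs => ne_of_gt hs
    filter_upwards [h1.filter_mono h2, self_mem_nhdsWithin] with s hs hs'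
    rw [slope_def_field, hψ0, sub_zero] at hs
    have h3 : 0 < s - s₀ := sub_pos.2 hs'
    exact (div_pos_iff_of_pos_right h3).1 hs
  obtain ⟨b, hb, hb'⟩ := mem_nhdsGT_iff_exists_Ioc_subset.1 hev
  have hmono : StrictMonoOn (fun s => ‖z s - z 0‖ ^ 2) (Icc s₀ b) := by
    refine strictMonoOn_of_deriv_pos (convex_Icc _ _)
      (fun s _ => (hφ s).continuousAt.continuousWithinAt) fun s hs => ?_
    rw [interior_Icc] at hs
    rw [(hφ s).deriv]
    have h1 : 0 < ψ s := hb' ⟨hs.1, hs.2.le⟩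
    have := hpos s
    positivity
  have := hmono (left_mem_Icc.2 (le_of_lt hb)) (right_mem_Icc.2 (le_of_lt hb)) hb
  exact absurd this (not_lt.2 (hmax' b))

/-! ### The outer phase -/

namespace VortexSheet.IsPartition

variable {D : H4Domain} {Ωp Ωm : Set Plane} {z : ℝ → Plane}

theorem subset_m (h : IsPartition D Ωp Ωm z) : Ωm ⊆ D.carrier := by
  rw [← h.union_eq]
  exact subset_union_right

theorem frontier_m (h : IsPartition D Ωp Ωm z) {x : Plane} (hx : x ∈ frontier Ωm)
    (hxD : x ∈ D.carrier) : x ∈ range z := by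
  rw [← h.union_eq] at hxD
  rw [frontier, h.isOpen_m.interior_eq] at hx
  rcases hxD with (hp | hz) | hm
  · exact absurd hx.1 (Set.disjoint_left.1 (h.disjoint.closure_right h.isOpen_p) hp)
  · exact hz
  · exact absurd hm hx.2

theorem frontier_m' (h : IsPartition D Ωp Ωm z) {x : Plane} (hx : x ∈ frontier Ωm) :
    x ∈ range z ∨ x ∈ frontier D.carrier := by
  by_cases hxD : x ∈ D.carrier
  · exact Or.inl (h.frontier_m hx hxD)
  · refine Or.inr ⟨closure_mono h.subset_m (frontier_subset_closure hx), fun h' => hxD (interior_subset h')⟩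

/-- The segment from `x` to its nearest frontier point stays in the container and avoids the
interface. Starting in `Ωp` it would remain there, so its endpoint would lie in the closure of `Ωp`,
which does not reach the frontier. -/
theorem collar_m (h : IsPartition D Ωp Ωm z) {d : ℝ}
    (hd : ∀ s, d ≤ Metric.infDist (z s) (frontier D.carrier)) {x : Plane} (hx : x ∈ D.carrier)
    (hxd : Metric.infDist x (frontier D.carrier) < d) : x ∈ Ωm := by
  have hx' := hx
  rw [← h.union_eq] at hx'
  rcases hx' with (hp | ⟨s, rfl⟩) | hm
  · exfalso
    have hne : (frontier D.carrier).Nonempty := by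
      rw [nonempty_frontier_iff]
      refine ⟨⟨x, hx⟩, fun hu => NormedSpace.unbounded_univ ℝ Plane ?_⟩
      rw [← hu]
      exact D.isBounded
    obtain ⟨y, hy, hxy⟩ := isClosed_frontier.exists_infDist_eq_dist hne x
    have hyD : y ∉ D.carrier := fun h' => hy.2 (by rwa [D.isOpen.interior_eq])
    have hpos : 0 < dist x y := dist_pos.2 fun hxy => hyD (hxy ▸ hx)
    set S := AffineMap.lineMap x y '' Ico (0 : ℝ) 1 with hS
    have hSc : IsPreconnected S :=
      isPreconnected_Ico.image _ AffineMap.lineMap_continuous.continuousOn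
    have hsub : S ⊆ Ωp ∪ Ωm := by
      rintro _ ⟨c, hc, rfl⟩
      have h1 : AffineMap.lineMap x y c ∈ D.carrier := by
        refine ball_subset_of_le_infDist D.isOpen hx hxy.ge ?_
        rw [Metric.mem_ball, dist_lineMap_left, Real.norm_eq_abs, abs_of_nonneg hc.1]
        nlinarith [hc.2]
      have h2 : dist (AffineMap.lineMap x y c) y < d := by
        rw [dist_lineMap_right, Real.norm_eq_abs, abs_of_nonneg (by linarith [hc.2])]
        rw [hxy] at hxd
        nlinarith [hc.1]
      rw [← h.union_eq] at h1
      rcases h1 with (h3 | ⟨s, hs⟩) | h3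
      · exact Or.inl h3
      · exfalso
        have h4 := Metric.infDist_le_dist_of_mem (x := z s) hy
        rw [hs] at h4
        have h5 := hd s
        rw [hs] at h5
        linarith
      · exact Or.inr h3
    have hSp : S ⊆ Ωp := hSc.subset_left_of_subset_union h.isOpen_p h.isOpen_m h.disjoint hsub
      ⟨x, ⟨0, by simp, by simp⟩, hp⟩
    refine hyD (h.closure_p (closure_mono hSp ?_))
    have h6 : (1 : ℝ) ∈ closure (Ico (0 : ℝ) 1) := by
      rw [closure_Ico zero_ne_one]; simp
    have h7 := image_closure_subset_closure_image (f := AffineMap.lineMap x y)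
      (AffineMap.lineMap_continuous (R := ℝ)) (mem_image_of_mem _ h6)
    rwa [AffineMap.lineMap_apply_one] at h7
  · exact absurd (hd s) (not_le.2 hxd)
  · exact hm

end VortexSheet.IsPartition

/-! ### The gradient bound -/

section Gradient

variable {g T : ℝ} {Ω : ℝ → Set Plane} {u : ℝ → Plane → Plane} {p : ℝ → Plane → ℝ}

theorem VortexSheet.IsEulerFlow.symmTraceFree (hE : IsEulerFlow g T Ω u p) {t : ℝ}
    (ht : t ∈ Ico 0 T) {x : Plane} (hx : x ∈ closure (Ω t)) : SymmTraceFree (gradU T Ω u t x) :=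
  hE.velocity_grad.mem_of_isClosed ht hx isClosed_symmTraceFree fun y hy =>
    ⟨hE.curl_free t ht y hy, hE.div_free t ht y hy⟩

theorem toComplex_symm_mem_iff {S : Set Plane} {w : ℂ} :
    toComplex.symm w ∈ S ↔ w ∈ toComplex '' S := by
  constructor
  · exact fun h => ⟨_, h, by simp⟩
  · rintro ⟨x, hx, rfl⟩
    simpa using hx

/-- The velocity gradient in the outer phase is bounded by the velocity and its gradient on the
interface. -/
theorem exists_bound_fderiv (D : H4Domain) {M : ℝ} (hM : 0 < M) : ∃ C > 0,
    ∀ (g T : ℝ) (Ωp Ωm : ℝ → Set Plane) (z : ℝ → ℝ → Plane) (up um : ℝ → Plane → Plane)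
      (pp pm : ℝ → Plane → ℝ), IsVortexSheet g T D Ωp Ωm z up um pp pm → HasBounds T M D z up →
      ∀ t ∈ Ico 0 T, ∀ k B : ℝ, 0 < k → (∀ s, ‖um t (z t s)‖ < k) →
        (∀ s, ‖gradU T Ωm um t (z t s)‖ ≤ B) → ∀ y ∈ Ωm t, ‖fderiv ℝ (um t) y‖ ≤ max B (C * k) := by
  obtain ⟨K, hW⟩ := D.exists_wallData
  have hDc : IsPreconnected (toComplex '' D.carrier) :=
    D.isConnected.isPreconnected.image _ toComplex.continuous.continuousOn
  obtain ⟨C, hC, HC⟩ := hW.exists_bound_of_inner_bound hDc (one_div_pos.2 hM) (one_div_pos.2 hM)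
  refine ⟨C, hC, ?_⟩
  intro g T Ωp Ωm z up um pp pm hS hB t ht k B hk hum hgrad y hy
  have hP := hS.partition t ht
  have hE := hS.flow_m
  set F := complexVelocity (um t) with hF
  set G := complexGradient (gradU T Ωm um t) with hG
  have hopen : IsOpen (toComplex '' Ωm t) := toComplex.toHomeomorph.isOpen_image.2 hP.isOpen_m
  have hmaps : MapsTo (fun w => (t, toComplex.symm w)) (closure (toComplex '' Ωm t))
      (spaceTime (Ico 0 T) fun t => closure (Ωm t)) := by
    intro w hw
    rw [toComplex_image_closure] at hw
    exact ⟨ht, toComplex_symm_mem_iff.2 hw⟩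
  have hcomp : ContinuousOn (fun w : ℂ => (t, toComplex.symm w)) (closure (toComplex '' Ωm t)) :=
    (continuous_const.prodMk toComplex.symm.continuous).continuousOn
  have hFc : ContinuousOn F (closure (toComplex '' Ωm t)) := by
    have h1 := hE.velocity_cont.comp hcomp hmaps
    exact (Complex.continuous_conj.comp toComplex.continuous).comp_continuousOn h1
  have hGc : ContinuousOn G (closure (toComplex '' Ωm t)) := by
    have h0 : ContinuousOn (fun q : ℝ × Plane => gradU T Ωm um q.1 q.2)
        (spaceTime (Ico 0 T) fun t => closure (Ωm t)) := hE.velocity_grad.continuousOn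
    have h1 := (h0.comp hcomp hmaps).clm_apply (continuousOn_const (c := basisVec 0))
    exact (Complex.continuous_conj.comp toComplex.continuous).comp_continuousOn h1
  have hstf : ∀ w ∈ closure (toComplex '' Ωm t),
      SymmTraceFree (gradU T Ωm um t (toComplex.symm w)) := fun w hw =>
    hE.symmTraceFree ht (hmaps hw).2
  have hFd : ∀ w ∈ toComplex '' Ωm t, HasDerivAt F (G w) w := by
    intro w hw
    have hw' : toComplex.symm w ∈ Ωm t := toComplex_symm_mem_iff.2 hw
    refine hasDerivAt_complexVelocity ?_ (hstf w (subset_closure hw))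
    have h1 := (hE.velocity_diff t ht _ hw').hasFDerivAt
    rwa [← hE.velocity_grad.eq_of_mem ht hw'] at h1
  have hbdd : Bornology.IsBounded (toComplex '' Ωm t) :=
    hW.bounded.subset (image_mono hP.subset_m)
  obtain ⟨S, hSb⟩ := hbdd.isCompact_closure.exists_bound_of_continuousOn hFc
  have hfr : ∀ w, Metric.infDist (toComplex w) (frontier (toComplex '' D.carrier)) =
      Metric.infDist w (frontier D.carrier) := fun w => by
    rw [toComplex_image_frontier, Metric.infDist_image toComplex.isometry]
  have hd : ∀ s, 1 / M ≤ Metric.infDist (z t s) (frontier D.carrier) := fun s =>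
    (hB.wall_dist t ht s).le
  -- The bound `max S 1` is not controlled; the constant of `exists_bound_of_inner_bound` does not
  -- involve it.
  have hTF : TangentField (toComplex '' D.carrier)
      (fun q : Fin D.numWalls × ℝ => toComplex (D.wall q.1 q.2))
      (fun q => toComplex (tangent (D.wall q.1) q.2)) (1 / M) (max S 1) (toComplex '' Ωm t) F G :=
    { isOpen := hopen
      subset := image_mono hP.subset_m
      collar := by
        rintro _ ⟨x, hx, rfl⟩ hxd
        rw [hfr] at hxd
        exact mem_image_of_mem _ (hP.collar_m hd hx hxd)
      cont_f := hFc
      cont_g := hGc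
      hasDerivAt := hFd
      bound_pos := lt_max_of_lt_right one_pos
      bound := fun x hx => (hSb x hx).trans (le_max_left _ _)
      tangential := by
        rintro ⟨i, s⟩
        rw [hF, complexVelocity, LinearIsometryEquiv.symm_apply_apply, im_conj_mul, neg_eq_zero]
        exact hS.wall_condition t ht i s }
  have hcv := hP.curve
  obtain ⟨s₁, hs₁⟩ := exists_le_norm_sub_of_curvature_le hcv hP.curve_class.1 hM
    (hB.bounds hS hM ht).2.bound
  have hwall := HC _ _ F G hTF (toComplex '' range (z t)) k hk
    (hcv.isCompact_range.image toComplex.continuous)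
    ((isPreconnected_range hcv.contDiff.continuous).image _ toComplex.continuous.continuousOn)
    (by
      rintro _ ⟨_, ⟨s, rfl⟩, rfl⟩
      exact mem_image_of_mem _ (hP.mem_carrier s))
    (by
      rw [toComplex_image_frontier]
      rintro _ ⟨x, hx, rfl⟩ hxD
      refine mem_image_of_mem _ (hP.frontier_m hx ?_)
      simpa using toComplex_symm_mem_iff.2 hxD)
    (by
      rintro _ ⟨_, ⟨s, rfl⟩, rfl⟩
      rw [hfr]
      exact hd s)
    ⟨_, mem_image_of_mem _ (mem_range_self 0), _, mem_image_of_mem _ (mem_range_self s₁), by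
      rwa [← map_sub, LinearIsometryEquiv.norm_map]⟩
    (by
      rintro _ ⟨_, ⟨s, rfl⟩, rfl⟩
      rw [hF, norm_complexVelocity, LinearIsometryEquiv.symm_apply_apply]
      exact hum s)
  have hmax := le_of_forall_frontier_le (g := fun w => ‖G w‖) (B := max B (C * k)) hopen hbdd hGc.norm
    (fun x hx => LocallyNormHolo.of_differentiable hopen hx fun w hw => by
      have hdF : DifferentiableOn ℂ F (toComplex '' Ωm t) := fun w hw =>
        (hFd w hw).differentiableAt.differentiableWithinAt
      have h1 := (hdF.deriv hopen).differentiableAt (hopen.mem_nhds hw)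
      refine h1.congr_of_eventuallyEq ?_
      filter_upwards [hopen.mem_nhds hw] with w hw using (hFd w hw).deriv.symm)
    (by
      intro w hw
      have hwc := frontier_subset_closure hw
      rw [toComplex_image_frontier] at hw
      obtain ⟨x, hx, rfl⟩ := hw
      rcases hP.frontier_m' hx with ⟨s, rfl⟩ | hxD
      · have h1 := norm_complexGradient (hstf _ hwc)
        rw [LinearIsometryEquiv.symm_apply_apply] at h1
        rw [hG, h1]
        exact (hgrad s).trans (le_max_left _ _)
      · rw [D.frontier_eq, mem_iUnion] at hxD
        obtain ⟨i, s, rfl⟩ := hxD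
        exact (hwall (i, s)).trans (le_max_right _ _))
    (subset_closure (mem_image_of_mem toComplex hy))
  have h2 := norm_complexGradient (hstf _ (subset_closure (mem_image_of_mem toComplex hy)))
  rw [LinearIsometryEquiv.symm_apply_apply] at h2
  have h3 : gradU T Ωm um t y = fderiv ℝ (um t) y := hE.velocity_grad.eq_of_mem ht hy
  rw [← h3, ← h2]
  exact hmax

end Gradient

/-! ### The minimal speed -/

theorem Function.Periodic.isLeast_range_iInf {f : ℝ → ℝ} (hp : Function.Periodic f 1)
    (hf : Continuous f) : IsLeast (range f) (⨅ s, f s) :=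
  (hp.compact_of_continuous one_ne_zero hf).isLeast_sInf (range_nonempty f)

theorem Function.Periodic.exists_norm_le {E : Type*} [NormedAddCommGroup E] {f : ℝ → E}
    (hp : Function.Periodic f 1) (hf : Continuous f) : ∃ B > 0, ∀ s, ‖f s‖ ≤ B := by
  obtain ⟨B, hB, H⟩ := exists_uniform_bound (J := {(0 : ℝ)}) (F := fun _ => f)
    isCompact_singleton ((hf.comp continuous_snd).continuousOn) fun _ _ => hp
  exact ⟨B, hB, H 0 rfl⟩

namespace LagrangianSheet

variable {g T M t₁ : ℝ} {D : H4Domain} {Ωp Ωm : ℝ → Set Plane} {z : ℝ → ℝ → Plane}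
  {up um : ℝ → Plane → Plane} {pp pm : ℝ → Plane → ℝ} {η : ℝ → Plane → Plane}

theorem shear_zero (h : LagrangianSheet g T M D Ωp Ωm z up um pp pm η) (s : ℝ) :
    shear z up um η 0 s = inner ℝ (um 0 (z 0 s) - up 0 (z 0 s)) (tangent (z 0) s) := by
  rw [shear, lagrangianTangent, h.deriv_eq h.zero_mem (h.initial s).symm, h.initial]

/-- At time zero the velocities on the interface are Lipschitz in position and the tangent is
Lipschitz in the parameter, hence so is the strength. These two constants carry the dependence on
the initial data. -/
theorem exists_initial_bounds (h : LagrangianSheet g T M D Ωp Ωm z up um pp pm η) :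
    ∃ Λ₀ K₀ : ℝ, (∀ s, |shear z up um η 0 s| ≤ Λ₀) ∧
      ∀ s s', ‖z 0 s' - z 0 s‖ ≤ K₀ * |s' - s| ∧
        |shear z up um η 0 s' - shear z up um η 0 s| ≤ K₀ * |s' - s| := by
  have h00 : (0 : ℝ) ∈ Icc (0 : ℝ) 0 := left_mem_Icc.2 le_rfl
  have hcv := h.curve h.zero_mem
  obtain ⟨c, hm, hp⟩ := h.bounds.exists_isSide h.sheet h.bound_pos h.time_pos
  obtain ⟨Lm, hLm, Hm, -, -⟩ := hm.exists_velocity_bounds h.time_pos h.sheet.flow_m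
  obtain ⟨Lp, hLp, Hp, -, -⟩ := hp.exists_velocity_bounds h.time_pos h.sheet.flow_p
  obtain ⟨K, hK, HK⟩ := hcv.periodic.exists_lipschitz hcv.contDiff
  obtain ⟨L, hL, HL⟩ := (periodic_tangent hcv).exists_lipschitz
    ((contDiff_tangent (n := 2) hcv (by
      exact_mod_cast (h.sheet.partition 0 h.zero_mem).curve_class.1)).of_le one_le_two)
  set w : ℝ → Plane := fun s => um 0 (z 0 s) - up 0 (z 0 s) with hw
  have hwlip : ∀ s s', ‖w s' - w s‖ ≤ (Lm + Lp) * K * |s' - s| := by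
    intro s s'
    have h1 := Hm 0 h00 _ (mem_range_self s) _ (mem_range_self s')
    have h2 := Hp 0 h00 _ (mem_range_self s) _ (mem_range_self s')
    calc ‖w s' - w s‖ = ‖(um 0 (z 0 s') - um 0 (z 0 s)) - (up 0 (z 0 s') - up 0 (z 0 s))‖ := by
          simp only [hw]; congr 1; abel
      _ ≤ Lm * ‖z 0 s' - z 0 s‖ + Lp * ‖z 0 s' - z 0 s‖ := (norm_sub_le _ _).trans (add_le_add h1 h2)
      _ = (Lm + Lp) * ‖z 0 s' - z 0 s‖ := by ring
      _ ≤ (Lm + Lp) * (K * |s' - s|) := by gcongr; exact HK s s'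
      _ = _ := by ring
  have hwc : Continuous w :=
    (LipschitzWith.of_dist_le_mul (K := ((Lm + Lp) * K).toNNReal) fun s s' => by
      rw [dist_eq_norm, Real.dist_eq, Real.coe_toNNReal _ (by positivity)]
      exact hwlip s' s).continuous
  have hwp : Function.Periodic w 1 := fun s => by
    simp only [hw, hcv.periodic s]
  obtain ⟨W, hW, HW⟩ := hwp.exists_norm_le hwc
  have hT := norm_tangent hcv
  refine ⟨W, max K ((Lm + Lp) * K + W * L), fun s => ?_, fun s s' => ⟨?_, ?_⟩⟩
  · rw [h.shear_zero]
    refine (abs_real_inner_le_norm _ _).trans ?_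
    rw [hT, mul_one]
    exact HW s
  · exact (HK s s').trans (by gcongr; exact le_max_left _ _)
  · rw [h.shear_zero, h.shear_zero]
    have h1 : (inner ℝ (w s') (tangent (z 0) s') : ℝ) - inner ℝ (w s) (tangent (z 0) s) =
        inner ℝ (w s' - w s) (tangent (z 0) s') +
          inner ℝ (w s) (tangent (z 0) s' - tangent (z 0) s) := by
      rw [inner_sub_left (w s') (w s), inner_sub_right (w s)]; ring
    have h2 := abs_real_inner_le_norm (w s' - w s) (tangent (z 0) s')
    rw [hT, mul_one] at h2
    have h3 := abs_real_inner_le_norm (w s) (tangent (z 0) s' - tangent (z 0) s)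
    calc _ = |(inner ℝ (w s') (tangent (z 0) s') : ℝ) - inner ℝ (w s) (tangent (z 0) s)| := rfl
      _ ≤ (Lm + Lp) * K * |s' - s| + W * (L * |s' - s|) := by
          rw [h1]
          refine (abs_add_le _ _).trans (add_le_add (h2.trans (hwlip s s')) (h3.trans ?_))
          gcongr
          exacts [HW s, HL s s']
      _ = ((Lm + Lp) * K + W * L) * |s' - s| := by ring
      _ ≤ _ := by gcongr; exact le_max_right _ _

theorem um_zero_eq (h : LagrangianSheet g T M D Ωp Ωm z up um pp pm η) {Ωm₀ Ωp₀ : Set Plane}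
    {θ : ℝ → Plane} {up₀ um₀ : Plane → Plane}
    (hI : HasInitialState Ωp Ωm z up um Ωp₀ Ωm₀ θ up₀ um₀) (s : ℝ) :
    (Tendsto um₀ (𝓝[Ωm₀] (θ s)) (𝓝 (um 0 (z 0 s))) ∧ (𝓝[Ωm₀] (θ s)).NeBot) ∧
    (Tendsto up₀ (𝓝[Ωp₀] (θ s)) (𝓝 (up 0 (z 0 s))) ∧ (𝓝[Ωp₀] (θ s)).NeBot) := by
  obtain ⟨hm, hp⟩ := h.mem_closure h.zero_mem s
  have h1 := tendsto_velocity h.sheet.flow_m h.zero_mem hm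
  have h2 := tendsto_velocity h.sheet.flow_p h.zero_mem hp
  rw [mem_closure_iff_nhdsWithin_neBot] at hm hp
  rw [← hI.interface, ← hI.phase_m, ← hI.phase_p]
  refine ⟨⟨h1.congr' ?_, hm⟩, h2.congr' ?_, hp⟩
  · filter_upwards [self_mem_nhdsWithin] with x hx
    exact hI.velocity_m (hI.phase_m ▸ hx)
  · filter_upwards [self_mem_nhdsWithin] with x hx
    exact hI.velocity_p (hI.phase_p ▸ hx)

/-- The initial strength is determined by the initial data. -/
theorem shear_zero_eq (h : LagrangianSheet g T M D Ωp Ωm z up um pp pm η) {Ωm₀ Ωp₀ : Set Plane}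
    {θ : ℝ → Plane} {up₀ um₀ : Plane → Plane}
    (hI : HasInitialState Ωp Ωm z up um Ωp₀ Ωm₀ θ up₀ um₀) {Ωp' Ωm' : ℝ → Set Plane}
    {z' : ℝ → ℝ → Plane} {up' um' : ℝ → Plane → Plane} {pp' pm' : ℝ → Plane → ℝ}
    {η' : ℝ → Plane → Plane} (h' : LagrangianSheet g T M D Ωp' Ωm' z' up' um' pp' pm' η')
    (hI' : HasInitialState Ωp' Ωm' z' up' um' Ωp₀ Ωm₀ θ up₀ um₀) (s : ℝ) :
    shear z up um η 0 s = shear z' up' um' η' 0 s := by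
  obtain ⟨⟨h1, hne⟩, h2, hne'⟩ := h.um_zero_eq hI s
  obtain ⟨⟨h3, -⟩, h4, -⟩ := h'.um_zero_eq hI' s
  rw [h.shear_zero, h'.shear_zero, tendsto_nhds_unique h1 h3, tendsto_nhds_unique h2 h4,
    hI.interface, hI'.interface]

theorem periodic_deriv (h : LagrangianSheet g T M D Ωp Ωm z up um pp pm η) (t : ℝ) :
    Function.Periodic (deriv fun s => η t (z 0 s)) 1 :=
  Function.Periodic.deriv' fun s => by rw [(h.curve h.zero_mem).periodic s]

theorem isLeast_minSpeed (h : LagrangianSheet g T M D Ωp Ωm z up um pp pm η) {t : ℝ}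
    (hc : Continuous (deriv fun s => η t (z 0 s))) :
    IsLeast (range (speed η (z 0) t)) (minSpeed η (z 0) t) :=
  Function.Periodic.isLeast_range_iInf
    (fun s => by rw [speed, speed, h.periodic_deriv t s]) hc.norm

/-- The flow is continuous up to the final time. -/
theorem tendsto_final (h : LagrangianSheet g T M D Ωp Ωm z up um pp pm η) {B : ℝ}
    (hB : ∀ t ∈ Ico 0 T, ∀ s, ‖um t (η t (z 0 s))‖ ≤ B) (s : ℝ) :
    Tendsto (fun t => η t (z 0 s)) (𝓝[<] T) (𝓝 (η T (z 0 s))) := by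
  have hint : IntegrableOn (fun r => um r (η r (z 0 s))) (Ico 0 T) := by
    refine Integrable.of_bound ((h.continuousOn_um s).aestronglyMeasurable measurableSet_Ico) B ?_
    filter_upwards [ae_restrict_mem measurableSet_Ico] with r hr using hB r hr s
  have hint' : IntegrableOn (fun r => um r (η r (z 0 s))) (Icc 0 T) := by
    rwa [integrableOn_Icc_iff_integrableOn_Ico]
  have hc := intervalIntegral.continuousOn_primitive_interval (a := 0) (b := T)
    (by rwa [uIcc_of_le h.time_pos.le])
  rw [uIcc_of_le h.time_pos.le] at hc
  have h1 : Tendsto (fun t => ∫ r in (0 : ℝ)..t, um r (η r (z 0 s))) (𝓝[<] T)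
      (𝓝 (∫ r in (0 : ℝ)..T, um r (η r (z 0 s)))) :=
    (hc T (right_mem_Icc.2 h.time_pos.le)).mono_left
      (nhdsWithin_le_of_mem (Icc_mem_nhdsLT h.time_pos))
  rw [h.flow.final _ (mem_range_self s)]
  refine (h1.const_add (z 0 s)).congr' ?_
  filter_upwards [Ioo_mem_nhdsLT h.time_pos] with t ht
  have hsub := Icc_subset_Ico_of_lt ht.2
  have h2 := intervalIntegral.integral_eq_sub_of_hasDerivAt_of_le ht.1.le
    ((h.continuousOn s).mono hsub) (fun r hr => h.hasDerivAt s ⟨hr.1, hr.2.trans ht.2⟩)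
    (((h.continuousOn_um s).mono (by rwa [uIcc_of_le ht.1.le])).intervalIntegrable)
  rw [h2, h.initial]
  abel

/-- Up to the final time, the derivative of the parametrization is Lipschitz in time. -/
theorem exists_final_deriv (h : LagrangianSheet g T M D Ωp Ωm z up um pp pm η) {A B : ℝ}
    (hA0 : 0 < A) (hB : ∀ t ∈ Ico 0 T, ∀ s, ‖um t (η t (z 0 s))‖ ≤ B)
    (hA : ∀ t ∈ Ico 0 T, ∀ s s', ‖um t (η t (z 0 s')) - um t (η t (z 0 s))‖ ≤ A * |s' - s|) (s : ℝ) :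
    DifferentiableAt ℝ (fun s => η T (z 0 s)) s ∧ ∀ t ∈ Ico 0 T,
      ‖deriv (fun s => η T (z 0 s)) s - deriv (fun s => η t (z 0 s)) s‖ ≤ A * (T - t) := by
  have hcx : Convex ℝ (Ico 0 T) := convex_Ico 0 T
  have hin : ∀ᶠ t in 𝓝[<] T, t ∈ Ico 0 T := Ico_mem_nhdsLT h.time_pos
  obtain ⟨G, hG, hGY⟩ := (LipschitzOnWith.of_dist_le_mul (K := A.toNNReal) (s := Ico 0 T)
    (f := fun t => deriv (fun s => η t (z 0 s)) s) fun t ht t' ht' => by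
      rw [dist_eq_norm, Real.dist_eq, Real.coe_toNNReal _ hA0.le]
      exact (h.norm_deriv_sub_le hcx subset_rfl hA ht' ht s).2).extend_finite_dimension
  have hYlim : Tendsto (fun t => deriv (fun s => η t (z 0 s)) s) (𝓝[<] T) (𝓝 (G T)) := by
    refine ((hG.continuous.tendsto T).mono_left nhdsWithin_le_nhds).congr' ?_
    filter_upwards [hin] with t ht using (hGY ht).symm
  have hAlim : ∀ t, Tendsto (fun t' => A * |t' - t|) (𝓝[<] T) (𝓝 (A * |T - t|)) := fun t =>
    ((by fun_prop : Continuous fun t' => A * |t' - t|).tendsto T).mono_left nhdsWithin_le_nhds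
  have habs : ∀ t ∈ Ico 0 T, |T - t| = T - t := fun t ht => abs_of_pos (sub_pos.2 ht.2)
  have hY : ∀ t ∈ Ico 0 T, ‖G T - deriv (fun s => η t (z 0 s)) s‖ ≤ A * (T - t) := by
    intro t ht
    have := le_of_tendsto_of_tendsto (hYlim.sub_const _).norm (hAlim t) (by
      filter_upwards [hin] with t' ht'
      exact (h.norm_deriv_sub_le hcx subset_rfl hA ht ht' s).2)
    rwa [habs t ht] at this
  have hX : ∀ t ∈ Ico 0 T, ∀ s', ‖(η T (z 0 s') - η T (z 0 s)) - (η t (z 0 s') - η t (z 0 s))‖ ≤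
      A * (T - t) * |s' - s| := by
    intro t ht s'
    have := le_of_tendsto_of_tendsto
      (((h.tendsto_final hB s').sub (h.tendsto_final hB s)).sub_const
        (η t (z 0 s') - η t (z 0 s))).norm ((hAlim t).mul_const |s' - s|) (by
      filter_upwards [hin] with t' ht'
      exact (h.norm_deriv_sub_le hcx subset_rfl hA ht ht' s).1 s')
    rwa [habs t ht] at this
  -- Comparison with a time `t` close to `T` splits the remainder into three parts of size `ε / 3`:
  -- the change of increments, the remainder at time `t`, and the change of the derivative.
  have hd : HasDerivAt (fun s => η T (z 0 s)) (G T) s := by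
    rw [hasDerivAt_iff_isLittleO, Asymptotics.isLittleO_iff]
    intro ε hε
    obtain ⟨t, ht, htε⟩ : ∃ t ∈ Ico 0 T, A * (T - t) ≤ ε / 3 := by
      have hlim : Tendsto (fun t => A * (T - t)) (𝓝[<] T) (𝓝 0) := by
        have h1 := ((by fun_prop : Continuous fun t' => A * (T - t')).tendsto T).mono_left
          (nhdsWithin_le_nhds (s := Iio T))
        simpa using h1
      obtain ⟨t, h1, h2⟩ := (hin.and (hlim.eventually_lt_const (by positivity : 0 < ε / 3))).exists
      exact ⟨t, h1, h2.le⟩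
    have h1 := (h.differentiableAt ht s).hasDerivAt
    rw [hasDerivAt_iff_isLittleO, Asymptotics.isLittleO_iff] at h1
    filter_upwards [h1 (by positivity : 0 < ε / 3)] with s' hs'
    have h2 := hX t ht s'
    have h3 := hY t ht
    set Y := deriv (fun s => η t (z 0 s)) s
    have h4 : ‖(s' - s) • (G T - Y)‖ ≤ A * (T - t) * |s' - s| := by
      rw [norm_smul, Real.norm_eq_abs, mul_comm]
      gcongr
    have h5 : A * (T - t) * |s' - s| ≤ ε / 3 * |s' - s| := by gcongr
    rw [Real.norm_eq_abs] at hs' ⊢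
    calc _ = ‖((η T (z 0 s') - η T (z 0 s)) - (η t (z 0 s') - η t (z 0 s))) +
          (η t (z 0 s') - η t (z 0 s) - (s' - s) • Y) - (s' - s) • (G T - Y)‖ := by
            rw [smul_sub]; congr 1; abel
      _ ≤ _ := (norm_sub_le _ _).trans (add_le_add_left (norm_add_le _ _) _)
      _ ≤ _ := by linarith
  refine ⟨hd.differentiableAt, ?_⟩
  rw [hd.deriv]
  exact hY

end LagrangianSheet

theorem lemma2 (g T M : ℝ) (hT : 0 < T) (hM : 0 < M) (D : H4Domain)
    (Ωp₀ Ωm₀ : Set Plane) (hΩp₀ : IsConnected Ωp₀) (hΩm₀ : IsConnected Ωm₀)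
    (θ : ℝ → Plane) (up₀ um₀ : Plane → Plane) :
    ∃ C : ℝ, 0 < C ∧
      ∀ (Ωp Ωm : ℝ → Set Plane) (z : ℝ → ℝ → Plane) (up um : ℝ → Plane → Plane)
        (pp pm : ℝ → Plane → ℝ) (η : ℝ → Plane → Plane),
        IsVortexSheet g T D Ωp Ωm z up um pp pm →
        HasInitialState Ωp Ωm z up um Ωp₀ Ωm₀ θ up₀ um₀ →
        HasBounds T M D z up →
        IsLagrangianFlow T Ωm z um η →
        -- the Lagrangian parametrization is differentiable and `|η'|` attains its minimum
        (∀ t ∈ Icc 0 T, Differentiable ℝ (fun s => η t (θ s)) ∧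
          IsLeast (range (speed η θ t)) (minSpeed η θ t)) ∧
        -- the estimate for `0 ≤ t < T`
        (∀ t ∈ Ico 0 T, 0 < minSpeed η θ t ∧
          ∀ y ∈ Ωm t, ‖fderiv ℝ (um t) y‖ ≤ C * M / minSpeed η θ t) ∧
        -- the estimate for limits at the final time
        (∀ (y : Plane) (A : Plane →L[ℝ] Plane), (∀ᶠ t in 𝓝[<] T, y ∈ Ωm t) →
          Tendsto (fun t => fderiv ℝ (um t) y) (𝓝[<] T) (𝓝 A) →
          ‖A‖ * minSpeed η θ T ≤ C * M) ∧
        -- the gradient can blow up only if `min |η'|` tends to zero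
        (∀ (τ : ℕ → ℝ) (y : ℕ → Plane), (∀ n, τ n ∈ Ico 0 T ∧ y n ∈ Ωm (τ n)) →
          Tendsto (fun n => ‖fderiv ℝ (um (τ n)) (y n)‖) atTop atTop →
          Tendsto (fun n => minSpeed η θ (τ n)) atTop (𝓝 0)) := by
  obtain ⟨Cw, hCw, HCw⟩ := exists_bound_fderiv D hM
  -- The constant is fixed before the solution. It is read off from one reference solution with the
  -- given initial data; every other one has the same initial strength by `shear_zero_eq`. Without
  -- any solution there is nothing to prove.
  by_cases hex : ∃ (Ωp Ωm : ℝ → Set Plane) (z : ℝ → ℝ → Plane) (up um : ℝ → Plane → Plane)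
      (pp pm : ℝ → Plane → ℝ) (η : ℝ → Plane → Plane),
      LagrangianSheet g T M D Ωp Ωm z up um pp pm η ∧
        HasInitialState Ωp Ωm z up um Ωp₀ Ωm₀ θ up₀ um₀
  swap
  · refine ⟨1, one_pos, ?_⟩
    intro Ωp Ωm z up um pp pm η hS hI hB hη
    exact absurd ⟨Ωp, Ωm, z, up, um, pp, pm, η, ⟨hS, hB, hη, hT, hM⟩, hI⟩ hex
  obtain ⟨Ωp', Ωm', z', up', um', pp', pm', η', h', hI'⟩ := hex
  obtain ⟨Λ₀, K₀, hΛ₀, hK₀⟩ := h'.exists_initial_bounds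
  set Λ := (Λ₀ + 1) * Real.exp (M * T) with hΛ
  set K := 1 + 5 * M + 4 * (Λ * M) + 2 * (Λ * M * M) with hK
  set A := (1 + K) * (K₀ * Real.exp (K * T)) with hA
  have hΛ0 : 0 < Λ := by
    have := (abs_nonneg _).trans (hΛ₀ 0)
    positivity
  have hK₀0 : 0 ≤ K₀ := by
    have := (norm_nonneg _).trans (hK₀ 0 1).1
    simpa using this
  have hA0 : 0 ≤ A := by positivity
  set k := M + Λ + 1 with hk
  have hk0 : 0 < k := by positivity
  -- `A` serves the interface, `Cw * k * A` the walls, and `1` makes the constant positive.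
  refine ⟨(A + Cw * k * A + 1) / M, by positivity, ?_⟩
  rw [div_mul_cancel₀ _ hM.ne']
  intro Ωp Ωm z up um pp pm η hS hI hB hη
  have h : LagrangianSheet g T M D Ωp Ωm z up um pp pm η := ⟨hS, hB, hη, hT, hM⟩
  obtain rfl : z 0 = θ := hI.interface
  have hsh : ∀ s, shear z up um η 0 s = shear z' up' um' η' 0 s := h.shear_zero_eq hI h' hI'
  have hΛt : ∀ t ∈ Ico 0 T, ∀ s, |shear z up um η t s| ≤ Λ := fun t ht s =>
    h.abs_shear_le (fun s => by rw [hsh]; exact hΛ₀ s) ht s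
  have hder : ∀ t ∈ Ico 0 T, ∀ s, ‖deriv (fun s => η t (z 0 s)) s‖ ≤ A ∧
      ‖gradU T Ωm um t (η t (z 0 s)) (deriv (fun s => η t (z 0 s)) s)‖ ≤ A := fun t ht s =>
    h.deriv_le_of_initial hΛt hΛ0.le hK hA (fun s s' => by
      rw [hsh, hsh, ← hI'.interface]; exact hK₀ s s') ht s
  have hum : ∀ t ∈ Ico 0 T, ∀ s, ‖um t (η t (z 0 s))‖ ≤ M + Λ := fun t ht s =>
    h.norm_um_le ht (hΛt t ht s)
  have hlip : ∀ t ∈ Ico 0 T, ∀ s s', ‖um t (η t (z 0 s')) - um t (η t (z 0 s))‖ ≤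
      (A + 1) * |s' - s| := by
    intro t ht s s'
    have := convex_univ.norm_image_sub_le_of_norm_hasDerivWithin_le (x := s) (y := s')
      (fun s _ => (h.hasDerivAt_um ht s).hasDerivWithinAt) (fun s _ => (hder t ht s).2)
      (mem_univ _) (mem_univ _)
    rw [Real.norm_eq_abs] at this
    exact this.trans (by gcongr; linarith)
  have hfin := h.exists_final_deriv (by positivity : 0 < A + 1) hum hlip
  have hmin : ∀ t ∈ Ico 0 T, IsLeast (range (speed η (z 0) t)) (minSpeed η (z 0) t) := fun t ht =>
    h.isLeast_minSpeed (h.differentiable ht).2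
  -- The derivative at the final time is a uniform limit of continuous ones, so the minimum is
  -- attained also at `T`.
  have hcfin : Continuous (deriv fun s => η T (z 0 s)) := by
    refine continuous_of_uniform_approx_of_continuous fun V hV => ?_
    obtain ⟨ε, hε, HV⟩ := Metric.mem_uniformity_dist.1 hV
    have hlim : Tendsto (fun t => (A + 1) * (T - t)) (𝓝[<] T) (𝓝 0) := by
      have h1 := ((by fun_prop : Continuous fun t' => (A + 1) * (T - t')).tendsto T).mono_left
        (nhdsWithin_le_nhds (s := Iio T))
      simpa using h1
    have hin : ∀ᶠ t in 𝓝[<] T, t ∈ Ico 0 T := Ico_mem_nhdsLT hT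
    obtain ⟨t, ht, htε⟩ := (hin.and (hlim.eventually_lt_const hε)).exists
    refine ⟨_, (h.differentiable ht).2, fun s => HV ?_⟩
    rw [dist_eq_norm]
    exact ((hfin s).2 t ht).trans_lt htε
  have hminT := h.isLeast_minSpeed hcfin
  have hpos : ∀ t ∈ Ico 0 T, 0 < minSpeed η (z 0) t := by
    intro t ht
    obtain ⟨s, hs⟩ := (hmin t ht).1
    rw [← hs]
    exact norm_pos_iff.2 (h.deriv_ne_zero ht s)
  have hest : ∀ t ∈ Ico 0 T, ∀ y ∈ Ωm t,
      ‖fderiv ℝ (um t) y‖ ≤ (A + Cw * k * A + 1) / minSpeed η (z 0) t := by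
    intro t ht y hy
    have hm := hpos t ht
    have hle : ∀ s, minSpeed η (z 0) t ≤ ‖deriv (fun s => η t (z 0 s)) s‖ := fun s =>
      (hmin t ht).2 (mem_range_self s)
    have hsurj : ∀ σ, ∃ s, η t (z 0 s) = z t σ := by
      intro σ
      have h1 : z t σ ∈ η t '' range (z 0) := by
        rw [hη.image_interface t ht]
        exact mem_range_self σ
      obtain ⟨_, ⟨s, rfl⟩, hs⟩ := h1
      exact ⟨s, hs⟩
    have h1 := HCw g T Ωp Ωm z up um pp pm hS hB t ht k (A / minSpeed η (z 0) t) hk0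
      (fun σ => by
        obtain ⟨s, hs⟩ := hsurj σ
        rw [← hs]
        exact (hum t ht s).trans_lt (lt_add_one _))
      (fun σ => by
        obtain ⟨s, hs⟩ := hsurj σ
        have h2 := (hder t ht s).2
        rw [(hS.flow_m.symmTraceFree ht (h.mem_closure' ht s).1).norm_apply_eq] at h2
        rw [← hs, le_div_iff₀ hm]
        refine le_trans ?_ h2
        gcongr
        exact hle s) y hy
    refine h1.trans (max_le ?_ ?_)
    · gcongr
      have : 0 ≤ Cw * k * A := by positivity
      linarith
    -- The wall bound `Cw * k` carries no factor `1 / min |η'|`; it is absorbed by means of `min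
    -- |η'| ≤ A`.
    · rw [le_div_iff₀ hm]
      have h3 : minSpeed η (z 0) t ≤ A := (hle 0).trans (hder t ht 0).1
      have h4 := mul_le_mul_of_nonneg_left h3 (by positivity : 0 ≤ Cw * k)
      linarith
  refine ⟨fun t ht => ?_, fun t ht => ⟨hpos t ht, hest t ht⟩, ?_, ?_⟩
  · rcases ht.2.eq_or_lt with rfl | hlt
    · exact ⟨fun s => (hfin s).1, hminT⟩
    · exact ⟨(h.differentiable ⟨ht.1, hlt⟩).1, hmin t ⟨ht.1, hlt⟩⟩
  · intro y G hy hG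
    -- The Lipschitz bound in time gives `minSpeed` at `t` as at least its value at `T` less `(A +
    -- 1) * (T - t)`, so the estimate at `t` passes to the limit.
    have hlim : Tendsto (fun t => ‖fderiv ℝ (um t) y‖ * (minSpeed η (z 0) T - (A + 1) * (T - t)))
        (𝓝[<] T) (𝓝 (‖G‖ * minSpeed η (z 0) T)) := by
      have h1 := ((by fun_prop : Continuous fun t' => minSpeed η (z 0) T - (A + 1) * (T - t')).tendsto
        T).mono_left (nhdsWithin_le_nhds (s := Iio T))
      simp only [sub_self, mul_zero, sub_zero] at h1
      exact hG.norm.mul h1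
    refine le_of_tendsto hlim ?_
    have hin : ∀ᶠ t in 𝓝[<] T, t ∈ Ico 0 T := Ico_mem_nhdsLT hT
    filter_upwards [hin, hy] with t ht hyt
    have h1 := hest t ht y hyt
    rw [le_div_iff₀ (hpos t ht)] at h1
    refine le_trans ?_ h1
    gcongr
    obtain ⟨s, hs⟩ := (hmin t ht).1
    have h2 : minSpeed η (z 0) T ≤ ‖deriv (fun s => η T (z 0 s)) s‖ := hminT.2 (mem_range_self s)
    have h3 := norm_sub_norm_le (deriv (fun s => η T (z 0 s)) s) (deriv (fun s => η t (z 0 s)) s)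
    have h4 := (hfin s).2 t ht
    rw [← hs, speed]
    linarith
  · intro τ y hτ hlim
    have h1 : Tendsto (fun n => (A + Cw * k * A + 1) / ‖fderiv ℝ (um (τ n)) (y n)‖) atTop (𝓝 0) :=
      hlim.const_div_atTop _
    refine tendsto_of_tendsto_of_tendsto_of_le_of_le' tendsto_const_nhds h1
      (Eventually.of_forall fun n => (hpos _ (hτ n).1).le) ?_
    filter_upwards [hlim.eventually_gt_atTop 0] with n hn
    have h2 := hest _ (hτ n).1 _ (hτ n).2
    rw [le_div_iff₀ (hpos _ (hτ n).1)] at h2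
    rw [le_div_iff₀ hn]
    linarith
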